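/- Fourier transforms are normalized by $\widehat f(\xi)=\int e^{-2\pi i\langle x,\xi\rangle}f(x)\,dx$; those of positive tempered measures are taken in the sense of tempered distributions. For a locally finite subset $\chi$ of a Euclidean space $V$ and $R>0$ let $\gamma_R=\frac1{|B_R|}\sum_{x,y\in\chi\cap B_R}\delta_{y-x}$, where $B_R$ is the ball of radius $R$ centered at $0$ and $|B_R|$ its Lebesgue measure. The autocorrelation of $\chi$ is the limit of $\gamma_R$ in the vague topology as $R\to\infty$, if it exists, and the diffraction measure of $\chi$ is the Fourier transform (a positive measure) of its autocorrelation. **Theorem.** Let $E,F$ be linear subspaces of $\mathbb R^d$ with $\mathbb R^d=E\oplus F$ (not necessarily orthogonal). Write $x=x_E+x_F$ with $x_E=p_E(x)\in E$, $x_F\in F$, and let $x_E^\perp$, $x_F^\perp$ be the orthogonal projections of $x$ on $E$ and on $F$. Let $W$ be a bounded Borel subset of $F$. Let $\phi$ be a stationary and square integrable point process on $\mathbb R^d$ (a random locally finite subset of $\mathbb{R}^d$) which is ergodic under the translations by the vectors of $E$, and assume that almost surely $p_E$ is injective on $\{x\in\phi: x_F\in W\}$. Put $$\chi=\{x_E :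 x\in\phi,\ x_F\in W\}\subset E .$$ Let $\widetilde Q$ be the Palm measure of $\phi$, $\widetilde Q(G)=\frac1{|B|}\,\mathbb E\sum_{x\in\phi\cap B}1_G(\phi-x)$, where $B\subset\mathbb R^d$ is any Borel set with $0<|B|<\infty$; let $I(\widetilde Q)$ be its intensity measure, $I(\widetilde Q)(A)=\int \mathrm{card}(\varphi\cap A)\,d\widetilde Q(\varphi)$. Let $C_E\subset E$ and $C_F\subset F$ be Borel sets of Lebesgue measure $1$ in $E$ and in $F$, and let $\alpha$ be the Lebesgue measure in $\mathbb R^d$ of $C_E+C_F$. Let $\psi=1_W*1_{-W}$ (convolution on $F$ with respect to Lebesgue measure), and let $\widehat\psi$ be its Fourier transform on $F$. Then $I(\widetilde Q)$ is tempered and its Fourier transform $\widehat{I(\widetilde Q)}$ is a positive tempered measure on $\mathbb R^d$, and, almost surely, $\chi$ admits the autocorrelation measure $$\gamma(C)=\alpha\int_{\mathbb R^d}\psi(x_F)\,1_C(x_E)\;I(\widetilde Q)(dx),\qquad C\subset E\ \text{Borel},$$ and the diffraction measure $$\widehat\gamma(C)=\alpha^2\int_{\mathbb R^d}\widehat\psi(x_F^\perp)\,1_C(x_E^\perp)\;\widehat{I(\widetilde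 Q)}(dx),\qquad C\subset E\ \text{Borel}.$$ -/

import Mathlib

open MeasureTheory Set Filter Topology
open scoped ENNReal Pointwise FourierTransform SchwartzMap

noncomputable section

/-- A locally finite subset of `V`: every bounded set contains only finitely many of its points. -/
@[ext]
structure Config (V : Type*) [NormedAddCommGroup V] where
  carrier : Set V
  finite_inter : ∀ A : Set V, Bornology.IsBounded A → (A ∩ carrier).Finite

namespace Config

section Basic

variable {V : Type*} [NormedAddCommGroup V]

/-- The number `N_A(φ)` of points of `φ` in `A` (meant for bounded `A`, where it is finite). -/
def count (A : Set V) (φ : Config V) : ℕ := (A ∩ φ.carrier).ncard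

/-- The σ-algebra generated by the maps `N_A`, for `A` a bounded Borel set. -/
instance measurableSpaceConfig [MeasurableSpace V] : MeasurableSpace (Config V) :=
  ⨆ (A : Set V) (_ : MeasurableSet A) (_ : Bornology.IsBounded A),
    MeasurableSpace.comap (count A) ⊤

/-- The translation `T_t φ = φ - t`. -/
def translate (t : V) (φ : Config V) : Config V where
  carrier := (fun x => x - t) '' φ.carrier
  finite_inter A hA := by
    have hb : Bornology.IsBounded ((fun x => x - t) ⁻¹' A) := by
      obtain ⟨C, hC⟩ := hA.exists_norm_le
      refine isBounded_iff_forall_norm_le.2 ⟨C + ‖t‖, fun x hx => ?_⟩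
      have h1 := hC _ hx
      have h2 := norm_add_le (x - t) t
      rw [sub_add_cancel] at h2
      linarith
    refine ((φ.finite_inter _ hb).image (fun x => x - t)).subset ?_
    rintro _ ⟨hA', x, hx, rfl⟩
    exact ⟨x, ⟨hA', hx⟩, rfl⟩

theorem countable_carrier (φ : Config V) : φ.carrier.Countable := by
  have : φ.carrier = ⋃ n : ℕ, Metric.ball (0 : V) n ∩ φ.carrier := by
    rw [← iUnion_inter, Metric.iUnion_ball_nat, univ_inter]
  rw [this]
  exact countable_iUnion fun n => (φ.finite_inter _ Metric.isBounded_ball).countable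

theorem measurable_count [MeasurableSpace V] {A : Set V} (hA : MeasurableSet A) (hb : Bornology.IsBounded A) :
    Measurable (count A) := by
  refine Measurable.of_comap_le ?_
  exact le_iSup_of_le A (le_iSup_of_le hA (le_iSup_of_le hb le_rfl))

theorem measurable_of_count [MeasurableSpace V] {Ω : Type*} [MeasurableSpace Ω] {g : Ω → Config V}
    (h : ∀ A : Set V, MeasurableSet A → Bornology.IsBounded A →
      Measurable fun ω => count A (g ω)) : Measurable g := by
  refine Measurable.of_le_map ?_
  refine iSup_le fun A => iSup_le fun hA => iSup_le fun hb => ?_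
  rintro _ ⟨s, -, rfl⟩
  exact h A hA hb (MeasurableSet.of_discrete (s := s))

end Basic

section Measurability

variable {V : Type*} [NormedAddCommGroup V] [MeasurableSpace V] [BorelSpace V]

/-- The counting measure of the points of `φ` in the ball of radius `n`. -/
def ballMeasure (n : ℕ) (φ : Config V) : Measure V :=
  Measure.count.restrict (Metric.ball 0 n ∩ φ.carrier)

theorem ballMeasure_apply (n : ℕ) (φ : Config V) {A : Set V} (hA : MeasurableSet A) :
    ballMeasure n φ A = ((A ∩ Metric.ball 0 n ∩ φ.carrier).encard : ℝ≥0∞) := by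
  rw [ballMeasure, Measure.restrict_apply hA, Measure.count_apply, inter_assoc]
  exact hA.inter (Metric.isOpen_ball.measurableSet.inter φ.countable_carrier.measurableSet)

theorem ballMeasure_apply_count (n : ℕ) (φ : Config V) {A : Set V} (hA : MeasurableSet A) :
    ballMeasure n φ A = (count (A ∩ Metric.ball 0 n) φ : ℝ≥0∞) := by
  rw [ballMeasure_apply n φ hA, count, ← Set.Finite.cast_ncard_eq
    (φ.finite_inter _ (Metric.isBounded_ball.subset inter_subset_right))]
  rfl

/-- `ballMeasure n` as a kernel. -/
def ballKernel (V : Type*) [NormedAddCommGroup V] [MeasurableSpace V] [BorelSpace V] (n : ℕ) :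
    ProbabilityTheory.Kernel (Config V) V where
  toFun := ballMeasure n
  measurable' := by
    refine Measure.measurable_of_measurable_coe _ fun A hA => ?_
    simp_rw [ballMeasure_apply_count n _ hA]
    exact (measurable_from_top (f := fun k : ℕ => (k : ℝ≥0∞))).comp
      (measurable_count (hA.inter Metric.isOpen_ball.measurableSet)
        (Metric.isBounded_ball.subset inter_subset_right))

theorem isFiniteMeasure_ballKernel (n : ℕ) (φ : Config V) :
    IsFiniteMeasure (ballKernel V n φ) := by
  refine ⟨?_⟩
  change ballMeasure n φ univ < ∞
  rw [ballMeasure_apply_count n φ MeasurableSet.univ]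
  exact ENNReal.natCast_lt_top _

theorem encard_eq_iSup (φ : Config V) {A : Set V} (hA : MeasurableSet A) :
    ((A ∩ φ.carrier).encard : ℝ≥0∞) = ⨆ n, ballMeasure n φ A := by
  have h1 : ∀ n, ballMeasure n φ A
      = Measure.count.restrict φ.carrier (A ∩ Metric.ball 0 (n : ℝ)) := fun n => by
    rw [ballMeasure, Measure.restrict_apply hA,
      Measure.restrict_apply (hA.inter Metric.isOpen_ball.measurableSet), inter_assoc]
  simp_rw [h1]
  rw [← Monotone.measure_iUnion, ← inter_iUnion, Metric.iUnion_ball_nat, inter_univ,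
    Measure.restrict_apply hA, Measure.count_apply]
  · exact hA.inter φ.countable_carrier.measurableSet
  · intro m n hmn
    exact inter_subset_inter_right _ (Metric.ball_subset_ball (by exact_mod_cast hmn))

/-- Counting the points of a configuration in a measurably varying set is measurable. -/
theorem measurable_encard {Ω : Type*} [MeasurableSpace Ω] {g : Ω → Config V} (hg : Measurable g)
    {S : Set (Ω × V)} (hS : MeasurableSet S) :
    Measurable fun ω => ((Prod.mk ω ⁻¹' S ∩ (g ω).carrier).encard : ℝ≥0∞) := by
  simp_rw [fun ω => encard_eq_iSup (g ω) (measurable_prodMk_left (x := ω) hS)]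
  refine Measurable.iSup fun n => ?_
  exact ProbabilityTheory.Kernel.measurable_kernel_prodMk_left_of_finite
    (κ := (ballKernel V n).comap g hg) hS (fun ω => isFiniteMeasure_ballKernel n (g ω))

/-- Joint measurability of `(φ, t) ↦ φ - t`. -/
theorem measurable_translate [SecondCountableTopology V] :
    Measurable fun p : Config V × V => translate p.2 p.1 := by
  refine measurable_of_count fun A hA hb => ?_
  have hS : MeasurableSet {q : (Config V × V) × V | q.2 - q.1.2 ∈ A} :=
    (measurable_snd.sub (measurable_snd.comp measurable_fst)) hA
  have key : ∀ p : Config V × V, (count A (translate p.2 p.1) : ℝ≥0∞)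
      = ((Prod.mk p ⁻¹' {q : (Config V × V) × V | q.2 - q.1.2 ∈ A}
          ∩ p.1.carrier).encard : ℝ≥0∞) := by
    intro p
    have h1 : A ∩ (translate p.2 p.1).carrier = (fun x => x - p.2) ''
        (Prod.mk p ⁻¹' {q : (Config V × V) × V | q.2 - q.1.2 ∈ A} ∩ p.1.carrier) := by
      ext y
      constructor
      · rintro ⟨hy, x, hx, rfl⟩
        exact ⟨x, ⟨hy, hx⟩, rfl⟩
      · rintro ⟨x, ⟨hy, hx⟩, rfl⟩
        exact ⟨hy, x, hx, rfl⟩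
    rw [← (sub_left_injective (b := p.2)).encard_image, ← h1, count,
      ← Set.Finite.cast_ncard_eq ((translate p.2 p.1).finite_inter _ hb)]
    rfl
  have hm := measurable_encard (g := fun p : Config V × V => p.1) measurable_fst hS
  refine measurable_to_countable' fun k => ?_
  have : (fun p : Config V × V => count A (translate p.2 p.1)) ⁻¹' {k}
      = (fun p : Config V × V => ((Prod.mk p ⁻¹' {q : (Config V × V) × V | q.2 - q.1.2 ∈ A}
          ∩ p.1.carrier).encard : ℝ≥0∞)) ⁻¹' {(k : ℝ≥0∞)} := by
    ext p
    simp only [mem_preimage, mem_singleton_iff, ← key p, Nat.cast_inj]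
  rw [this]
  exact hm (measurableSet_singleton _)

theorem measurable_tsum_indicator [SecondCountableTopology V] {B : Set V} (hB : MeasurableSet B)
    {G : Set (Config V)} (hG : MeasurableSet G) :
    Measurable fun φ : Config V =>
      ∑' x : ↥(φ.carrier ∩ B), G.indicator (fun _ => (1 : ℝ≥0∞)) (translate (x : V) φ) := by
  have hS : MeasurableSet {q : Config V × V | q.2 ∈ B ∧ translate q.2 q.1 ∈ G} :=
    (measurable_snd hB).inter (measurable_translate hG)
  convert measurable_encard measurable_id hS using 1
  funext φ
  symm
  rw [← ENNReal.tsum_set_one]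
  rw [tsum_subtype (φ.carrier ∩ B)
    (fun x => G.indicator (fun _ => (1 : ℝ≥0∞)) (translate x φ)), tsum_subtype _ (fun _ => 1)]
  refine tsum_congr fun x => ?_
  classical
  simp only [Set.indicator_apply]
  by_cases h1 : x ∈ φ.carrier <;> by_cases h2 : x ∈ B <;> by_cases h3 : translate x φ ∈ G <;>
    simp [h1, h2, h3]

/-- The intensity measure `I(m)(A) = ∫ card(φ ∩ A) dm(φ)` of a measure on configurations. -/
def intensity (m : Measure (Config V)) : Measure V :=
  Measure.ofMeasurable (fun A _ => ∫⁻ φ, ((A ∩ φ.carrier).encard : ℝ≥0∞) ∂m)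
    (by simp)
    (by
      intro A hA hd
      rw [← lintegral_tsum fun n => ?_]
      · refine lintegral_congr fun φ => ?_
        have hc : ∀ s : Set V, MeasurableSet s → ((s ∩ φ.carrier).encard : ℝ≥0∞)
            = Measure.count.restrict φ.carrier s := fun s hs => by
          rw [Measure.restrict_apply hs,
            Measure.count_apply (hs.inter φ.countable_carrier.measurableSet)]
        rw [hc _ (MeasurableSet.iUnion hA), measure_iUnion hd hA]
        exact tsum_congr fun n => (hc _ (hA n)).symm
      · exact (measurable_encard measurable_id (measurable_snd (hA n))).aemeasurable)

theorem intensity_apply (m : Measure (Config V)) {A : Set V} (hA : MeasurableSet A) :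
    intensity m A = ∫⁻ φ, ((A ∩ φ.carrier).encard : ℝ≥0∞) ∂m :=
  Measure.ofMeasurable_apply A hA

end Measurability

section Palm

variable {V : Type*} [NormedAddCommGroup V] [InnerProductSpace ℝ V] [FiniteDimensional ℝ V]
  [MeasurableSpace V] [BorelSpace V]

/-- The Palm measure `F ↦ |B|⁻¹ E ∑_{x ∈ φ ∩ B} 1_F(φ - x)` of the law `m` of a point process,
computed with the Borel set `B`. -/
def palm (m : Measure (Config V)) (B : Set V) (hB : MeasurableSet B) : Measure (Config V) :=
  Measure.ofMeasurable
    (fun G _ => (volume B)⁻¹ * ∫⁻ φ, ∑' x : ↥(φ.carrier ∩ B),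
      G.indicator (fun _ => (1 : ℝ≥0∞)) (translate (x : V) φ) ∂m)
    (by simp)
    (by
      intro G hG hd
      have : ProperSpace V := FiniteDimensional.proper_real V
      rw [ENNReal.tsum_mul_left,
        ← lintegral_tsum fun n => (measurable_tsum_indicator hB (hG n)).aemeasurable]
      congr 1
      refine lintegral_congr fun φ => ?_
      rw [ENNReal.tsum_comm]
      refine tsum_congr fun x => ?_
      classical
      by_cases hx : translate (x : V) φ ∈ ⋃ n, G n
      · obtain ⟨n, hn⟩ := mem_iUnion.1 hx
        rw [indicator_of_mem hx, tsum_eq_single n, indicator_of_mem hn]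
        intro k hk
        exact indicator_of_notMem (fun hk' => (disjoint_left.1 (hd hk) hk' hn)) _
      · rw [indicator_of_notMem hx]
        refine (ENNReal.tsum_eq_zero.2 fun n => ?_).symm
        exact indicator_of_notMem (fun hn => hx (mem_iUnion.2 ⟨n, hn⟩)) _)

theorem palm_apply (m : Measure (Config V)) {B : Set V} (hB : MeasurableSet B)
    {G : Set (Config V)} (hG : MeasurableSet G) :
    palm m B hB G = (volume B)⁻¹ * ∫⁻ φ, ∑' x : ↥(φ.carrier ∩ B),
      G.indicator (fun _ => (1 : ℝ≥0∞)) (translate (x : V) φ) ∂m :=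
  Measure.ofMeasurable_apply G hG

end Palm

end Config

/-- The stationarity of a law of a point process: invariance under all translations. -/
def IsStationaryLaw {V : Type*} [NormedAddCommGroup V] [MeasurableSpace V]
    (m : Measure (Config V)) : Prop :=
  ∀ t : V, m.map (Config.translate t) = m

/-- Ergodicity of a law of a point process under the translations by the vectors of `E`. -/
def IsErgodicUnder {V : Type*} [NormedAddCommGroup V] [NormedSpace ℝ V] [MeasurableSpace V]
    (m : Measure (Config V)) (E : Submodule ℝ V) : Prop :=
  ∀ G : Set (Config V), MeasurableSet G → (∀ t ∈ E, Config.translate t ⁻¹' G = G) →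
    m G = 0 ∨ m G = 1

/-- Square integrability of (the law of) a point process. -/
def IsSquareIntegrable {V : Type*} [NormedAddCommGroup V] [MeasurableSpace V]
    (m : Measure (Config V)) : Prop :=
  ∀ K : Set V, IsCompact K → MemLp (fun φ => (Config.count K φ : ℝ)) 2 m

section Diffraction

variable {V : Type*} [NormedAddCommGroup V] [InnerProductSpace ℝ V] [FiniteDimensional ℝ V]
  [MeasurableSpace V] [BorelSpace V]

/-- `γ_R = |B_R|⁻¹ ∑_{x, y ∈ χ ∩ B_R} δ_{y - x}`. -/
def patterson (χ : Config V) (R : ℝ) : Measure V :=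
  (volume (Metric.closedBall (0 : V) R))⁻¹ •
    Measure.sum fun p : ↥((χ.carrier ∩ Metric.closedBall 0 R) ×ˢ
      (χ.carrier ∩ Metric.closedBall 0 R)) => Measure.dirac (p.1.2 - p.1.1)

/-- `γ` is the autocorrelation of `χ`: the limit of the `γ_R` in the vague topology. -/
structure HasAutocorrelation (χ : Config V) (γ : Measure V) : Prop where
  locallyFinite : IsLocallyFiniteMeasure γ
  tendsto : ∀ f : V → ℝ, Continuous f → HasCompactSupport f →
    Tendsto (fun R : ℝ => ∫ x, f x ∂(patterson χ R)) atTop (𝓝 (∫ x, f x ∂γ))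

/-- `ν` is the Fourier transform of `μ` in the sense of tempered distributions, both being positive
tempered measures. Normalization: `f̂(ξ) = ∫ exp(-2πi⟨x, ξ⟩) f(x) dx`. -/
structure IsFourierTransform (μ ν : Measure V) : Prop where
  temperate_left : μ.HasTemperateGrowth
  temperate_right : ν.HasTemperateGrowth
  integral_eq : ∀ f : 𝓢(V, ℂ), ∫ x, 𝓕 (f : V → ℂ) x ∂μ = ∫ x, f x ∂ν

/-- `ν` is the diffraction measure of `χ`: the Fourier transform of its autocorrelation. -/
def HasDiffraction (χ : Config V) (ν : Measure V) : Prop :=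
  ∃ γ : Measure V, HasAutocorrelation χ γ ∧ IsFourierTransform γ ν

end Diffraction

section CutAndProject

variable {V : Type*} [NormedAddCommGroup V] [InnerProductSpace ℝ V] [FiniteDimensional ℝ V]

/-- The strip `E × W`, i.e. the set of the `x` with `x_F ∈ W` (`x = x_E + x_F`). -/
def strip {E F : Submodule ℝ V} (h : IsCompl E F) (W : Set F) : Set V :=
  {x | F.projectionOnto E h.symm x ∈ W}

/-- `π(φ) = p_E(φ ∩ (E × W))`, where `W` is bounded. -/
def cutProject {E F : Submodule ℝ V} (h : IsCompl E F) (W : Set F) (hW : Bornology.IsBounded W)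
    (φ : Config V) : Config E where
  carrier := E.projectionOnto F h '' (φ.carrier ∩ strip h W)
  finite_inter A hA := by
    have hb : Bornology.IsBounded {x : V | E.projectionOnto F h x ∈ A ∧ x ∈ strip h W} := by
      obtain ⟨a, ha⟩ := hA.exists_norm_le
      obtain ⟨b, hb⟩ := hW.exists_norm_le
      refine isBounded_iff_forall_norm_le.2 ⟨a + b, fun x hx => ?_⟩
      have h1 := ha _ hx.1
      have h2 := hb _ hx.2
      have h3 : (E.projectionOnto F h x : V) + (F.projectionOnto E h.symm x : V) = x := by
        simp only [Submodule.coe_projectionOnto_apply]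
        exact Submodule.projection_add_projection_eq_self h x
      have h4 := norm_add_le (E.projectionOnto F h x : V) (F.projectionOnto E h.symm x : V)
      rw [h3] at h4
      simp only [Submodule.coe_norm] at h1 h2
      linarith
    refine ((φ.finite_inter _ hb).image (E.projectionOnto F h)).subset ?_
    rintro _ ⟨hA', x, hx, rfl⟩
    exact ⟨x, ⟨⟨hA', hx.2⟩, hx.1⟩, rfl⟩

/-- `ψ = 1_W * 1_{-W}`, the convolution on `F` being taken with respect to Lebesgue measure. -/
def windowAutocorr {F : Submodule ℝ V} [MeasurableSpace V] [BorelSpace V] (W : Set F) : F → ℝ :=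
  convolution (W.indicator fun _ => (1 : ℝ)) ((-W).indicator fun _ => (1 : ℝ))
    (ContinuousLinearMap.mul ℝ ℝ) volume

/-- The Fourier transform `ψ̂` of `ψ = 1_W * 1_{-W}`. It equals `|𝓕 1_W|²`, so it is real and
nonnegative and the real part loses nothing. -/
def windowIntensity {F : Submodule ℝ V} [MeasurableSpace V] [BorelSpace V] (W : Set F) (y : F) :
    ℝ :=
  (𝓕 (fun z : F => (windowAutocorr W z : ℂ)) y).re

end CutAndProject

end

set_option linter.unusedSectionVars false

noncomputable section

/-! Write `c` for the intensity of the Palm measure, and `ψ` for `windowAutocorr W`. The proof has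
three largely independent ingredients.

Autocorrelation. For a test function `f ≥ 0` on `E` vanishing beyond radius `r`, let `S_A` be the
sum of `f (y_E - x_E)` over the pairs of points of `φ` in the strip with `x_E ∈ A` (`pairSum`).
Since `p_E` is injective on the strip, `∫ f dγ_R` is a double sum over `φ`, and it lies between the
values of `S_A / |B_R|` for `A = B_{R-r}` and `A = B_R`. Translations by `E` preserve the strip, so
that `|B_1| S_{B_R}` is trapped between the integrals of `t ↦ S_{B_1}(φ - t)` over `B_{R-1}` and
`B_{R+1}`. Wiener's ergodic theorem for the action of `E` (`averagesConverge`) then gives the limit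
`E S_{B_1} / |B_1|`. This mean comes from Campbell's formula for pairs (`lintegral_pairs`): in the
coordinates `(x, y - x)` the second moment measure is Lebesgue measure times `c`. Writing Lebesgue
measure of `V` as `α de du` on `E × F`, the integral over `u` of `1_W(u) 1_W(u + z_F)` produces
`ψ(z_F)`. A countable dense family of test functions yields one null set for all of them.

Spectral measure of `c`. Stationarity and square integrability make `c` translation bounded. It is
positive definite, because integrating `h(y) conj h(x)` against the second moment measure gives `E
|∑ h(x)|² ≥ 0`. For modulated Gaussians `h`, this says exactly that the Fourier transform of
`exp(-πε‖z‖²) c` is nonnegative (`isGaussPosDef_intensity`). These transforms, seen as densities,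
have unit balls of mass bounded uniformly in `ε`, and a limit point as `ε → 0` is the Fourier
transform `η` of `c` (`exists_fourier_of_isGaussPosDef`). The duality holds for continuous functions
that decay polynomially together with their transform, so no smoothness has to be checked when it is
used.

Diffraction. As `⟨x, y⟩ = ⟨x_E, y_E^⊥⟩ + ⟨x_F, y_F^⊥⟩`, the transform of `p(y_E^⊥) q(y_F^⊥)` is `α⁻¹
p̂(x_E) q̂(x_F)`. With `q = ψ̂`, whose transform is `ψ` because `ψ` is even, duality between `c` and
`η` gives formally `α² ∫ f(y_E^⊥) ψ̂(y_F^⊥) dη = α ∫ f̂(x_E) ψ(x_F) dc`, which is the claim.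
However, `ψ̂` need not decay fast enough to be tested against `η`, so it is multiplied by a Gaussian
that widens to `1`. On the side of `c` the regularizations of `ψ` are dominated by one Gaussian. On
the side of `η`, Fatou's lemma with Gaussian `f` first shows that the candidate measure is
translation bounded, and this supplies the integrability for dominated convergence
(`isFourierTransform_cutDiffraction`). -/

/-- A jointly measurable, measure preserving action of the additive group `G` on `(X, m)`. -/
structure IsMeasurePreservingFlow {X G : Type*} [MeasurableSpace X] [AddGroup G]
    [MeasurableSpace G] (T : G → X → X) (m : Measure X) : Prop where
  measurable : Measurable fun p : G × X => T p.1 p.2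
  measurePreserving : ∀ t, MeasurePreserving (T t) m m
  zero : ∀ x, T 0 x = x
  add : ∀ s t x, T s (T t x) = T (s + t) x

/-! ### Measure preserving flows: the maximal inequality and ergodicity. -/

namespace IsMeasurePreservingFlow

open Metric

variable {X : Type*} [MeasurableSpace X] {m : Measure X} [IsProbabilityMeasure m]
  {G : Type*} [NormedAddCommGroup G] [NormedSpace ℝ G] [FiniteDimensional ℝ G]
  [MeasurableSpace G] [BorelSpace G] {μ : Measure G} [μ.IsAddHaarMeasure]
  {T : G → X → X}

theorem measurable_swap (hT : IsMeasurePreservingFlow T m) :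
    Measurable fun p : X × G => T p.2 p.1 :=
  hT.measurable.comp _root_.measurable_swap

theorem lintegral_comp (hT : IsMeasurePreservingFlow T m) {f : X → ℝ≥0∞} (hf : Measurable f)
    (s : Set G) :
    ∫⁻ x, ∫⁻ t in s, f (T t x) ∂μ ∂m = μ s * ∫⁻ x, f x ∂m := by
  have hm : AEMeasurable (Function.uncurry fun x t => f (T t x)) (m.prod (μ.restrict s)) :=
    (hf.comp hT.measurable_swap).aemeasurable
  rw [lintegral_lintegral_swap hm]
  simp_rw [(hT.measurePreserving _).lintegral_comp hf]
  simp [mul_comm]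

theorem measurePreserving_prod (hT : IsMeasurePreservingFlow T m) (s : Set G) :
    MeasurePreserving (fun p : X × G => T p.2 p.1) (m.prod (μ.restrict s)) (μ s • m) := by
  refine ⟨hT.measurable_swap, ?_⟩
  ext A hA
  rw [Measure.map_apply hT.measurable_swap hA, ← lintegral_indicator_one (hT.measurable_swap hA),
    lintegral_prod _ (by
      exact (measurable_one.indicator (hT.measurable_swap hA)).aemeasurable)]
  have := hT.lintegral_comp (μ := μ) (f := A.indicator 1) (measurable_one.indicator hA) s
  rw [lintegral_indicator_one hA] at this
  rw [Measure.smul_apply, smul_eq_mul, ← this]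
  rfl

/-- A null set is met by almost every orbit only at a null set of times. Hence ergodic averages do
not depend on the representative of the function. -/
theorem ae_ae (hT : IsMeasurePreservingFlow T m) {p : X → Prop} (hp : ∀ᵐ x ∂m, p x) :
    ∀ᵐ x ∂m, ∀ᵐ t ∂μ, p (T t x) := by
  have h := hT.measurePreserving_prod (μ := μ) univ
  rw [Measure.restrict_univ] at h
  have h2 : ∀ᵐ q ∂m.prod μ, p (T q.2 q.1) :=
    h.quasiMeasurePreserving.ae (Measure.ae_smul_measure hp _)
  exact Measure.ae_ae_of_ae_prod h2

theorem ae_integrableOn (hT : IsMeasurePreservingFlow T m) {f : X → ℝ} (hf : Integrable f m) :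
    ∀ᵐ x ∂m, ∀ n : ℕ, IntegrableOn (fun t => f (T t x)) (closedBall 0 n) μ := by
  rw [ae_all_iff]
  intro n
  have h := hT.measurePreserving_prod (μ := μ) (closedBall 0 n)
  have h3 : Integrable (fun q : X × G => f (T q.2 q.1)) (m.prod (μ.restrict (closedBall 0 n))) :=
    h.integrable_comp_of_integrable (hf.smul_measure measure_closedBall_lt_top.ne)
  exact h3.prod_right_ae

/-- The covering argument runs along a single orbit. Each time `t` in `B_N` with `T t x ∈ O` is the
centre of a ball of radius at most `N` on which `f` has average above `a`. Vitali's lemma (any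
enlargement factor above `3` would do; here it is `4`) extracts disjoint balls, all inside `B_{2N}`,
whose enlargements cover these times. Integrating in `x` and using invariance turns both sides into
multiples of `μ (B_N)`, and the constant is `4^dim` from the enlargement times `2^dim` from
`B_{2N}`. -/
theorem maximal_aux (hT : IsMeasurePreservingFlow T m) {f : X → ℝ≥0∞} (hf : Measurable f)
    (N : ℕ) (a : ℝ≥0∞) :
    a * m {x | ∃ n ∈ Finset.Icc 1 N,
      a * μ (closedBall 0 n) < ∫⁻ t in closedBall 0 n, f (T t x) ∂μ} ≤
      ENNReal.ofReal (8 ^ Module.finrank ℝ G) * ∫⁻ x, f x ∂m := by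
  set O : Set X := {x | ∃ n ∈ Finset.Icc 1 N,
      a * μ (closedBall 0 n) < ∫⁻ t in closedBall 0 n, f (T t x) ∂μ} with hO
  have hOm : MeasurableSet O := by
    have : O = ⋃ n ∈ Finset.Icc 1 N, {x | a * μ (closedBall 0 n) <
        ∫⁻ t in closedBall 0 n, f (T t x) ∂μ} := by
      ext x; simp [hO]
    rw [this]
    refine Finset.measurableSet_biUnion _ fun n _ => measurableSet_lt measurable_const ?_
    exact (hf.comp hT.measurable_swap).lintegral_prod_right'
  have key : ∀ x, a * ∫⁻ t in closedBall (0 : G) N, O.indicator 1 (T t x) ∂μ ≤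
      ENNReal.ofReal (4 ^ Module.finrank ℝ G) *
        ∫⁻ t in closedBall 0 (2 * N), f (T t x) ∂μ := by
    intro x
    set S : Set G := {t | t ∈ closedBall (0 : G) N ∧ T t x ∈ O} with hS
    have hmx : Measurable fun t => T t x := hT.measurable.comp measurable_prodMk_right
    have h1 : ∫⁻ t in closedBall (0 : G) N, O.indicator 1 (T t x) ∂μ = μ S := by
      have : (fun t => O.indicator (1 : X → ℝ≥0∞) (T t x)) =
        ((fun t => T t x) ⁻¹' O).indicator 1 := by ext t; rfl
      rw [this, lintegral_indicator_one (hmx hOm), Measure.restrict_apply (hmx hOm), inter_comm]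
      rfl
    have hex : ∀ t ∈ S, ∃ n ∈ Finset.Icc 1 N,
        a * μ (closedBall 0 n) < ∫⁻ s in closedBall 0 n, f (T s (T t x)) ∂μ := fun t ht => ht.2
    choose! r hr hr2 using hex
    obtain ⟨u, huS, hud, hu⟩ := Vitali.exists_disjoint_subfamily_covering_enlargement_closedBall S
      (fun t : G => t) (fun t => (r t : ℝ)) N
      (fun t ht => by exact_mod_cast (Finset.mem_Icc.1 (hr t ht)).2) 4 (by norm_num)
    have hrpos : ∀ t ∈ S, (0 : ℝ) < r t := fun t ht => by
      exact_mod_cast (Finset.mem_Icc.1 (hr t ht)).1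
    have huc : u.Countable := hud.countable_of_nonempty_interior fun t ht => by
      have := ball_subset_interior_closedBall (x := t) (ε := (r t : ℝ))
      exact ⟨t, this (mem_ball_self (hrpos t (huS ht)))⟩
    have hcov : S ⊆ ⋃ b ∈ u, closedBall b (4 * r b) := by
      intro t ht
      obtain ⟨b, hb, hb2⟩ := hu t ht
      exact mem_iUnion₂.2 ⟨b, hb, hb2 (mem_closedBall_self (hrpos t ht).le)⟩
    have hshift : ∀ b, ∫⁻ s in closedBall 0 (r b), f (T s (T b x)) ∂μ =
        ∫⁻ s in closedBall b (r b), f (T s x) ∂μ := by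
      intro b
      have h2 := (measurePreserving_add_right μ b).setLIntegral_comp_preimage
        (s := closedBall b (r b)) measurableSet_closedBall (f := fun s => f (T s x))
        (hf.comp hmx)
      rw [← h2]
      have : (fun s : G => s + b) ⁻¹' closedBall b (r b) = closedBall 0 (r b) := by
        ext s; simp
      rw [this]
      simp_rw [hT.add]
    rw [h1]
    calc a * μ S ≤ a * ∑' b : u, μ (closedBall (b : G) (4 * r b)) := by
          gcongr
          have := huc.to_subtype
          exact (measure_mono hcov).trans (measure_biUnion_le _ huc _)
      _ = ENNReal.ofReal (4 ^ Module.finrank ℝ G) * ∑' b : u, a * μ (closedBall 0 (r b)) := by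
          rw [ENNReal.tsum_mul_left]
          have : ∀ b : u, μ (closedBall (b : G) (4 * r b)) =
            ENNReal.ofReal (4 ^ Module.finrank ℝ G) * μ (closedBall 0 (r b)) := fun b =>
            Measure.addHaar_closedBall_mul_of_pos μ _ (by norm_num) _
          simp_rw [this]
          rw [ENNReal.tsum_mul_left]
          ring
      _ ≤ ENNReal.ofReal (4 ^ Module.finrank ℝ G) *
          ∑' b : u, ∫⁻ s in closedBall (b : G) (r b), f (T s x) ∂μ := by
          gcongr with b
          rw [← hshift]
          exact (hr2 b (huS b.2)).le
      _ = ENNReal.ofReal (4 ^ Module.finrank ℝ G) *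
          ∫⁻ s in ⋃ b ∈ u, closedBall b (r b), f (T s x) ∂μ := by
          rw [lintegral_biUnion huc (fun _ _ => measurableSet_closedBall) hud]
      _ ≤ _ := by
          gcongr
          refine iUnion₂_subset fun b hb => closedBall_subset_closedBall' ?_
          have h3 := mem_closedBall.1 (huS hb).1
          have h4 : (r b : ℝ) ≤ N := by exact_mod_cast (Finset.mem_Icc.1 (hr b (huS hb))).2
          linarith
  have hint := lintegral_mono (μ := m) key
  have hm1 : Measurable fun x => ∫⁻ t in closedBall (0 : G) N, O.indicator 1 (T t x) ∂μ :=
    ((measurable_one.indicator hOm).comp hT.measurable_swap).lintegral_prod_right'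
  have hm2 : Measurable fun x => ∫⁻ t in closedBall (0 : G) (2 * N), f (T t x) ∂μ :=
    (hf.comp hT.measurable_swap).lintegral_prod_right'
  rw [lintegral_const_mul _ hm1, lintegral_const_mul _ hm2,
    hT.lintegral_comp (measurable_one.indicator hOm), hT.lintegral_comp hf,
    lintegral_indicator_one hOm, Measure.addHaar_closedBall_mul_of_pos μ _ two_pos] at hint
  rcases Nat.eq_zero_or_pos N with hN | hN
  · have : O = ∅ := by ext x; simp [hO, hN]
    simp [this]
  have hB0 : μ (closedBall (0 : G) N) ≠ 0 :=
    (measure_closedBall_pos μ _ (by exact_mod_cast hN)).ne'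
  have hBt : μ (closedBall (0 : G) N) ≠ ∞ := measure_closedBall_lt_top.ne
  have h8 : ENNReal.ofReal (8 ^ Module.finrank ℝ G) =
      ENNReal.ofReal (4 ^ Module.finrank ℝ G) * ENNReal.ofReal (2 ^ Module.finrank ℝ G) := by
    rw [← ENNReal.ofReal_mul (by positivity), ← mul_pow]; norm_num
  rw [h8, ← ENNReal.mul_le_mul_iff_right hB0 hBt]
  convert hint using 1 <;> ring

/-- Wiener's maximal inequality. -/
theorem maximal (hT : IsMeasurePreservingFlow T m) {f : X → ℝ≥0∞} (hf : Measurable f)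
    (a : ℝ≥0∞) :
    a * m {x | ∃ n : ℕ, 1 ≤ n ∧
      a * μ (closedBall 0 n) < ∫⁻ t in closedBall 0 n, f (T t x) ∂μ} ≤
      ENNReal.ofReal (8 ^ Module.finrank ℝ G) * ∫⁻ x, f x ∂m := by
  have : {x | ∃ n : ℕ, 1 ≤ n ∧
      a * μ (closedBall 0 n) < ∫⁻ t in closedBall 0 n, f (T t x) ∂μ} =
      ⋃ N : ℕ, {x | ∃ n ∈ Finset.Icc 1 N,
        a * μ (closedBall 0 n) < ∫⁻ t in closedBall 0 n, f (T t x) ∂μ} := by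
    ext x
    simp only [mem_ofPred_eq, mem_iUnion, Finset.mem_Icc]
    exact ⟨fun ⟨n, h1, h2⟩ => ⟨n, n, ⟨h1, le_rfl⟩, h2⟩, fun ⟨N, n, h1, h2⟩ => ⟨n, h1.1, h2⟩⟩
  rw [this, Monotone.measure_iUnion, ENNReal.mul_iSup]
  · exact iSup_le fun N => hT.maximal_aux hf N a
  · rintro M N hMN x ⟨n, h1, h2⟩
    exact ⟨n, Finset.Icc_subset_Icc_right hMN h1, h2⟩

/-- Ergodicity is assumed for strictly invariant sets only, whereas `h` is invariant up to a null
set depending on `t`. The level set `{h ∈ U}` is therefore replaced by the set `Z` of points whose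
orbit lies in it for almost every time: `Z` is strictly invariant because Haar measure is, and
Fubini shows that it agrees with the level set almost everywhere. -/
theorem ae_const_of_invariant (hT : IsMeasurePreservingFlow T m)
    (herg : ∀ s : Set X, MeasurableSet s → (∀ t, T t ⁻¹' s = s) → m s = 0 ∨ m s = 1)
    {h : X → ℝ} (hm : AEStronglyMeasurable h m) (hinv : ∀ t, (fun x => h (T t x)) =ᵐ[m] h) :
    ∃ c : ℝ, h =ᵐ[m] fun _ => c := by
  wlog hh : Measurable h generalizing h
  · obtain ⟨c, hc⟩ := this (h := hm.mk h) hm.stronglyMeasurable_mk.aestronglyMeasurable (fun t =>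
      (((hT.measurePreserving t).quasiMeasurePreserving.ae_eq_comp hm.ae_eq_mk).symm.trans
        (hinv t)).trans hm.ae_eq_mk) hm.stronglyMeasurable_mk.measurable
    exact ⟨c, hm.ae_eq_mk.trans hc⟩
  let μ : Measure G := Measure.addHaar
  refine exists_eventuallyEq_const_of_forall_separating MeasurableSet fun U hU => ?_
  set H : Set X := h ⁻¹' U with hH
  have hHm : MeasurableSet H := hh hU
  let Z : Set X := {x | μ {t | T t x ∉ H} = 0}
  have hZm : MeasurableSet Z := by
    have h1 : MeasurableSet {p : X × G | T p.2 p.1 ∉ H} := hT.measurable_swap hHm.compl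
    exact measurable_measure_prodMk_left h1 (measurableSet_singleton 0)
  have hZinv : ∀ t, T t ⁻¹' Z = Z := by
    intro t
    ext x
    have : {s | T s (T t x) ∉ H} = (fun s => s + t) ⁻¹' {s | T s x ∉ H} := by
      ext s; simp [hT.add]
    simp only [mem_preimage, Z, mem_ofPred_eq, this, measure_preimage_add_right]
  have hZH : ∀ᵐ x ∂m, (x ∈ Z ↔ h x ∈ U) := by
    have h1 : ∀ᵐ q ∂m.prod μ, h (T q.2 q.1) = h q.1 := by
      have hms : MeasurableSet {q : X × G | h (T q.2 q.1) = h q.1} :=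
        measurableSet_eq_fun (hh.comp hT.measurable_swap) (hh.comp measurable_fst)
      have h2 : ∀ᵐ q ∂μ.prod m, h (T q.1 q.2) = h q.2 := by
        have hms' : MeasurableSet {q : G × X | h (T q.1 q.2) = h q.2} :=
          measurableSet_eq_fun (hh.comp hT.measurable) (hh.comp measurable_snd)
        rw [Measure.ae_prod_iff_ae_ae hms']
        exact Eventually.of_forall hinv
      exact (Measure.measurePreserving_swap (μ := m) (ν := μ)).quasiMeasurePreserving.ae
        (p := fun q : G × X => h (T q.1 q.2) = h q.2) h2
    filter_upwards [Measure.ae_ae_of_ae_prod h1] with x hx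
    constructor
    · intro hxZ
      have h3 : ∀ᵐ t ∂μ, T t x ∈ H := hxZ
      obtain ⟨t, ht1, ht2⟩ := (hx.and h3).exists
      have : h (T t x) ∈ U := ht2
      rwa [ht1] at this
    · intro hxU
      change ∀ᵐ t ∂μ, T t x ∈ H
      filter_upwards [hx] with t ht
      change h (T t x) ∈ U
      rwa [ht]
  rcases herg Z hZm hZinv with h0 | h1
  · right
    have : ∀ᵐ x ∂m, x ∉ Z := measure_eq_zero_iff_ae_notMem.1 h0
    filter_upwards [this, hZH] with x hx hx2
    exact fun h => hx (hx2.2 h)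
  · left
    have : ∀ᵐ x ∂m, x ∈ Z := (prob_compl_eq_zero_iff hZm).2 h1
    filter_upwards [this, hZH] with x hx hx2
    exact hx2.1 hx

end IsMeasurePreservingFlow

/-! ### Wiener's ergodic theorem. -/

namespace IsMeasurePreservingFlow

open Metric

variable {X : Type*} [MeasurableSpace X] {m : Measure X} [IsProbabilityMeasure m]
  {G : Type*} [NormedAddCommGroup G] [NormedSpace ℝ G] [FiniteDimensional ℝ G]
  [MeasurableSpace G] [BorelSpace G] {μ : Measure G} [μ.IsAddHaarMeasure]
  {T : G → X → X}

/-- The averages of `f` along the flow, over the balls of integral radius, converge almost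
everywhere to the mean of `f`. -/
def AveragesConverge (T : G → X → X) (m : Measure X) (μ : Measure G) (f : X → ℝ) : Prop :=
  ∀ᵐ x ∂m, Tendsto (fun n : ℕ => ⨍ t in closedBall (0 : G) n, f (T t x) ∂μ) atTop
    (𝓝 (∫ x, f x ∂m))

theorem AveragesConverge.congr (hT : IsMeasurePreservingFlow T m) {f g : X → ℝ}
    (hf : AveragesConverge T m μ f) (h : f =ᵐ[m] g) : AveragesConverge T m μ g := by
  filter_upwards [hf, hT.ae_ae (μ := μ) h] with x hx hx2
  rw [← integral_congr_ae h]
  refine hx.congr fun n => ?_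
  rw [setAverage_eq, setAverage_eq]
  congr 1
  exact integral_congr_ae (ae_restrict_of_ae hx2)

theorem averagesConverge_const (c : ℝ) : AveragesConverge T m μ fun _ => c := by
  refine Eventually.of_forall fun x => ?_
  refine tendsto_const_nhds.congr' ?_
  filter_upwards [eventually_ge_atTop 1] with n hn
  rw [setAverage_const (measure_closedBall_pos μ _ (by exact_mod_cast hn)).ne'
    measure_closedBall_lt_top.ne]
  simp

theorem AveragesConverge.add (hT : IsMeasurePreservingFlow T m) {f g : X → ℝ}
    (hfi : Integrable f m) (hgi : Integrable g m)
    (hf : AveragesConverge T m μ f) (hg : AveragesConverge T m μ g) :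
    AveragesConverge T m μ fun x => f x + g x := by
  filter_upwards [hf, hg, hT.ae_integrableOn (μ := μ) hfi, hT.ae_integrableOn (μ := μ) hgi]
    with x h1 h2 h3 h4
  rw [integral_add hfi hgi]
  refine (h1.add h2).congr fun n => ?_
  simp only [setAverage_eq]
  rw [integral_add (h3 n) (h4 n), smul_add]

theorem AveragesConverge.const_mul {f : X → ℝ} (c : ℝ)
    (hf : AveragesConverge T m μ f) : AveragesConverge T m μ fun x => c * f x := by
  filter_upwards [hf] with x h1
  rw [integral_const_mul]
  refine (h1.const_mul c).congr fun n => ?_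
  simp only [setAverage_eq]
  rw [integral_const_mul, smul_eq_mul, smul_eq_mul]
  ring

/-- Banach's principle: by the maximal inequality, an error small in `L¹` perturbs all averages at
once by at most `δ / 2`, outside of a set of small measure. -/
theorem averagesConverge_of_approx (hT : IsMeasurePreservingFlow T m) {f : X → ℝ}
    (hf : Integrable f m)
    (h : ∀ ε : ℝ, 0 < ε → ∃ g : X → ℝ, Integrable g m ∧ AveragesConverge T m μ g ∧
      ∫⁻ x, ‖f x - g x‖ₑ ∂m ≤ ENNReal.ofReal ε) :
    AveragesConverge T m μ f := by
  have key : ∀ δ : ℝ, 0 < δ → ∀ᵐ x ∂m, ∀ᶠ n : ℕ in atTop,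
      |(⨍ t in closedBall (0 : G) n, f (T t x) ∂μ) - ∫ x, f x ∂m| ≤ δ := by
    intro δ hδ
    rw [ae_iff, ← nonpos_iff_eq_zero]
    refine ENNReal.le_of_forall_pos_le_add fun η hη _ => ?_
    rw [zero_add]
    set K : ℝ := 8 ^ Module.finrank ℝ G with hK
    have hKpos : 0 < K := by positivity
    have hη' : (0 : ℝ) < η := hη
    -- The bound `δ / 4` controls the difference of the two means. The other bound makes the maximal
    -- inequality at level `δ / 2` give a bad set of measure at most `η`. The convergence of the
    -- averages of `g` uses the remaining `δ / 4`.
    obtain ⟨g, hgi, hg, hfg⟩ := h (min (δ / 4) (η * (δ / 2) / K)) (by positivity)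
    have hfgi := hf.sub hgi
    set u := hfgi.1.mk with hu
    have hum : Measurable u := hfgi.1.stronglyMeasurable_mk.measurable
    have hue : f - g =ᵐ[m] u := hfgi.1.ae_eq_mk
    have hul : ∫⁻ x, ‖u x‖ₑ ∂m = ∫⁻ x, ‖f x - g x‖ₑ ∂m :=
      lintegral_congr_ae (hue.mono fun x hx => by
        change _ = ‖(f - g) x‖ₑ
        rw [hx])
    set Bad : Set X := {x | ∃ n : ℕ, 1 ≤ n ∧ ENNReal.ofReal (δ / 2) * μ (closedBall 0 n) <
      ∫⁻ t in closedBall 0 n, ‖u (T t x)‖ₑ ∂μ}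
    have hBad : m Bad ≤ η := by
      have h1 := hT.maximal (μ := μ) hum.enorm (ENNReal.ofReal (δ / 2))
      rw [hul, ← hK] at h1
      have h2 : ENNReal.ofReal K * ∫⁻ x, ‖f x - g x‖ₑ ∂m ≤
          ENNReal.ofReal (δ / 2) * η := by
        calc _ ≤ ENNReal.ofReal K * ENNReal.ofReal (η * (δ / 2) / K) := by
              gcongr
              exact hfg.trans (ENNReal.ofReal_le_ofReal (min_le_right _ _))
          _ = ENNReal.ofReal (δ / 2 * η) := by
              rw [← ENNReal.ofReal_mul hKpos.le]
              congr 1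
              field_simp
          _ = _ := by
              rw [ENNReal.ofReal_mul (by positivity), ENNReal.ofReal_coe_nnreal]
      exact (ENNReal.mul_le_mul_iff_right (by simpa using hδ) ENNReal.ofReal_ne_top).1
        (h1.trans h2)
    have hgood : ∀ᵐ x ∂m, x ∉ Bad → ∀ᶠ n : ℕ in atTop,
        |(⨍ t in closedBall (0 : G) n, f (T t x) ∂μ) - ∫ x, f x ∂m| ≤ δ := by
      filter_upwards [hg, hT.ae_integrableOn (μ := μ) hf, hT.ae_integrableOn (μ := μ) hgi,
        hT.ae_ae (μ := μ) hue] with x h1 h2 h3 h4 hx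
      have h5 : ∀ᶠ n : ℕ in atTop,
          |(⨍ t in closedBall (0 : G) n, g (T t x) ∂μ) - ∫ x, g x ∂m| < δ / 4 :=
        (tendsto_order.1 ((tendsto_iff_norm_sub_tendsto_zero).1 h1)).2 _ (by positivity)
      have h6 : |∫ x, f x ∂m - ∫ x, g x ∂m| ≤ δ / 4 := by
        rw [← integral_sub hf hgi, ← Real.norm_eq_abs, ← ENNReal.ofReal_le_ofReal_iff
          (by positivity), ofReal_norm]
        exact (enorm_integral_le_lintegral_enorm _).trans
          (hfg.trans (ENNReal.ofReal_le_ofReal (min_le_left _ _)))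
      filter_upwards [h5, eventually_ge_atTop 1] with n h7 hn
      have h8 : |⨍ t in closedBall (0 : G) n, (f (T t x) - g (T t x)) ∂μ| ≤ δ / 2 := by
        have hb : ∫⁻ t in closedBall 0 n, ‖u (T t x)‖ₑ ∂μ ≤
            ENNReal.ofReal (δ / 2) * μ (closedBall 0 n) := by
          by_contra hc
          exact hx ⟨n, hn, not_le.1 hc⟩
        have hpos : 0 < μ.real (closedBall (0 : G) n) := ENNReal.toReal_pos
          (measure_closedBall_pos μ _ (by exact_mod_cast hn)).ne' measure_closedBall_lt_top.ne
        have hc : ‖∫ t in closedBall (0 : G) n, (f (T t x) - g (T t x)) ∂μ‖ ≤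
            δ / 2 * μ.real (closedBall (0 : G) n) := by
          rw [← ENNReal.ofReal_le_ofReal_iff (by positivity), ofReal_norm,
            ENNReal.ofReal_mul (by positivity), ofReal_measureReal measure_closedBall_lt_top.ne]
          refine (enorm_integral_le_lintegral_enorm _).trans (le_trans (le_of_eq ?_) hb)
          refine lintegral_congr_ae (ae_restrict_of_ae (h4.mono fun t ht => ?_))
          change ‖(f - g) (T t x)‖ₑ = _
          rw [ht]
        rw [setAverage_eq, smul_eq_mul, abs_mul, abs_of_pos (inv_pos.2 hpos),
          inv_mul_le_iff₀ hpos, mul_comm]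
        exact hc
      have h9 : (⨍ t in closedBall (0 : G) n, f (T t x) ∂μ) =
          (⨍ t in closedBall (0 : G) n, (f (T t x) - g (T t x)) ∂μ) +
          ⨍ t in closedBall (0 : G) n, g (T t x) ∂μ := by
        simp only [setAverage_eq]
        rw [integral_sub (h2 n) (h3 n), ← smul_add, sub_add_cancel]
      rw [h9]
      rw [abs_le] at h8 h6 ⊢
      rw [abs_lt] at h7
      constructor <;> linarith
    calc _ ≤ m Bad := by
          refine measure_mono_ae ?_
          filter_upwards [hgood] with x hx hx2
          by_contra hc
          exact hx2 (hx hc)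
      _ ≤ _ := hBad
  have h2 : ∀ᵐ x ∂m, ∀ k : ℕ, ∀ᶠ n : ℕ in atTop,
      |(⨍ t in closedBall (0 : G) n, f (T t x) ∂μ) - ∫ x, f x ∂m| ≤ 1 / ((k : ℝ) + 1) :=
    ae_all_iff.2 fun k => key _ (by positivity)
  filter_upwards [h2] with x hx
  rw [Metric.tendsto_nhds]
  intro ε hε
  obtain ⟨k, hk⟩ := exists_nat_one_div_lt hε
  filter_upwards [hx k] with n hn
  exact lt_of_le_of_lt hn hk

/-- The volume of balls grows polynomially, so changing the radius by a constant is negligible. This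
Følner property serves both for coboundaries and for passing between nearby radii. -/
theorem tendsto_measure_closedBall_ratio (c : ℝ) :
    Tendsto (fun n : ℕ => μ.real (closedBall (0 : G) (n + c)) / μ.real (closedBall (0 : G) n))
      atTop (𝓝 1) := by
  have h1 : Tendsto (fun n : ℕ => (1 + c / (n : ℝ)) ^ Module.finrank ℝ G) atTop (𝓝 1) := by
    have : Tendsto (fun n : ℕ => 1 + c / (n : ℝ)) atTop (𝓝 (1 + 0)) :=
      tendsto_const_nhds.add (tendsto_const_div_atTop_nhds_zero_nat c)
    simpa using this.pow (Module.finrank ℝ G)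
  refine h1.congr' ?_
  obtain ⟨N, hN⟩ := exists_nat_ge |c|
  filter_upwards [eventually_ge_atTop (N + 1)] with n hn
  have hn1 : (N : ℝ) + 1 ≤ n := by exact_mod_cast hn
  have hc := abs_le.1 hN
  have hn0 : (0 : ℝ) < n := by have : (0 : ℝ) ≤ N := N.cast_nonneg; linarith
  have hpos : 0 < μ.real (closedBall (0 : G) 1) := ENNReal.toReal_pos
    (measure_closedBall_pos μ _ one_pos).ne' measure_closedBall_lt_top.ne
  rw [Measure.real, Measure.real, Measure.addHaar_closedBall' μ _ (by linarith),
    Measure.addHaar_closedBall' μ _ hn0.le, ENNReal.toReal_mul, ENNReal.toReal_mul,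
    ENNReal.toReal_ofReal (pow_nonneg (by linarith) _), ENNReal.toReal_ofReal (by positivity),
    mul_div_mul_right _ _ (by exact hpos.ne'), ← div_pow]
  congr 1
  field_simp

/-- The integral over `B_n` of a coboundary is the difference of the integrals of one bounded
function over `s + B_n` and `B_n`. Both differ from the integral over the ball of radius `n + ‖s‖`
by at most the volume of the shell, whence the factor `2`. -/
theorem averagesConverge_coboundary (hT : IsMeasurePreservingFlow T m) {g : X → ℝ}
    (hg : Measurable g) (hb : ∀ x, |g x| ≤ 1) (s : G) :
    AveragesConverge T m μ fun x => g (T s x) - g x := by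
  have hgi : Integrable g m := Integrable.of_bound hg.aestronglyMeasurable 1
    (Eventually.of_forall hb)
  have hgs : Integrable (fun x => g (T s x)) m :=
    (hT.measurePreserving s).integrable_comp_of_integrable hgi
  have h0 : ∫ x, (g (T s x) - g x) ∂m = 0 := by
    have h1 := integral_map (hT.measurePreserving s).measurable.aemeasurable
      (f := g) (by rw [(hT.measurePreserving s).map_eq]; exact hg.aestronglyMeasurable)
    rw [(hT.measurePreserving s).map_eq] at h1
    rw [integral_sub hgs hgi, ← h1, sub_self]
  refine Eventually.of_forall fun x => ?_
  rw [h0]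
  have hlim : Tendsto (fun n : ℕ => 2 * (μ.real (closedBall (0 : G) (n + ‖s‖)) /
      μ.real (closedBall (0 : G) n) - 1)) atTop (𝓝 0) := by
    simpa using ((tendsto_measure_closedBall_ratio (μ := μ) ‖s‖).sub_const 1).const_mul 2
  refine squeeze_zero_norm' ?_ hlim
  filter_upwards [eventually_ge_atTop 1] with n hn
  set w : G → ℝ := fun t => g (T t x) with hw
  have hwm : Measurable w := hg.comp (hT.measurable.comp measurable_prodMk_right)
  have hwb : ∀ t, ‖w t‖ ≤ 1 := fun t => hb _
  have hwi : ∀ {A : Set G}, μ A < ∞ → IntegrableOn w A μ := fun hA =>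
    IntegrableOn.of_bound hA hwm.aestronglyMeasurable 1 (Eventually.of_forall hwb)
  have hpos : 0 < μ.real (closedBall (0 : G) n) := ENNReal.toReal_pos
    (measure_closedBall_pos μ _ (by exact_mod_cast hn)).ne' measure_closedBall_lt_top.ne
  have hcenter : ∀ (a : G) (r : ℝ), μ.real (closedBall a r) = μ.real (closedBall 0 r) :=
    fun a r => by rw [Measure.real, Measure.real, Measure.addHaar_closedBall_center]
  have hdiff : ∀ a : G, ‖a‖ ≤ ‖s‖ → |(∫ t in closedBall (0 : G) (n + ‖s‖), w t ∂μ) -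
      ∫ t in closedBall a n, w t ∂μ| ≤
      μ.real (closedBall (0 : G) (n + ‖s‖)) - μ.real (closedBall (0 : G) n) := by
    intro a ha
    have hsub : closedBall a n ⊆ closedBall (0 : G) (n + ‖s‖) :=
      closedBall_subset_closedBall' (by rw [dist_zero_right]; linarith)
    rw [← setIntegral_sdiff measurableSet_closedBall (hwi measure_closedBall_lt_top) hsub,
      ← hcenter a n, ← measureReal_sdiff hsub measurableSet_closedBall
        measure_closedBall_lt_top.ne, ← Real.norm_eq_abs]
    have := norm_setIntegral_le_of_norm_le_const
      (lt_of_le_of_lt (measure_mono sdiff_subset) measure_closedBall_lt_top)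
      (f := w) (μ := μ) (s := closedBall (0 : G) (n + ‖s‖) \ closedBall a n) (C := 1)
      fun t _ => hwb t
    simpa using this
  have hshift : ∫ t in closedBall (0 : G) n, g (T s (T t x)) ∂μ = ∫ t in closedBall s n, w t ∂μ := by
    have h2 := (measurePreserving_add_left μ s).setIntegral_preimage_emb
      (measurableEmbedding_addLeft s) w (closedBall s n)
    rw [← h2]
    have : (fun t : G => s + t) ⁻¹' closedBall s n = closedBall 0 n := by
      ext t; simp
    rw [this]
    simp_rw [hT.add]
    rfl
  have hshifti : IntegrableOn (fun t => g (T s (T t x))) (closedBall (0 : G) n) μ :=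
    IntegrableOn.of_bound measure_closedBall_lt_top (hg.comp ((hT.measurePreserving s).measurable.comp
      (hT.measurable.comp measurable_prodMk_right))).aestronglyMeasurable 1
      (Eventually.of_forall fun t => hb _)
  rw [setAverage_eq, integral_sub hshifti (hwi measure_closedBall_lt_top), hshift, norm_smul,
    norm_inv, Real.norm_of_nonneg hpos.le, inv_mul_le_iff₀ hpos, Real.norm_eq_abs]
  have h1 := abs_le.1 (hdiff s le_rfl)
  have h2 := abs_le.1 (hdiff 0 (by simp))
  have h3 : μ.real (closedBall (0 : G) n) * (2 * (μ.real (closedBall (0 : G) (n + ‖s‖)) /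
      μ.real (closedBall (0 : G) n) - 1)) =
      2 * (μ.real (closedBall (0 : G) (n + ‖s‖)) - μ.real (closedBall (0 : G) n)) := by
    field_simp
  rw [h3, abs_le]
  constructor <;> linarith

/-- The averages of square integrable functions converge. -/
theorem averagesConverge_L2 (hT : IsMeasurePreservingFlow T m)
    (herg : ∀ s : Set X, MeasurableSet s → (∀ t, T t ⁻¹' s = s) → m s = 0 ∨ m s = 1)
    (f : Lp ℝ 2 m) : AveragesConverge T m μ f := by
  have hint : ∀ f : Lp ℝ 2 m, Integrable f m := fun f =>
    (Lp.memLp f).integrable one_le_two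
  let 𝒞 : Submodule ℝ (Lp ℝ 2 m) :=
    { carrier := {f | AveragesConverge T m μ f}
      zero_mem' := (averagesConverge_const (T := T) (m := m) (μ := μ) 0).congr hT
        (Lp.coeFn_zero ℝ 2 m).symm
      add_mem' := fun {f g} hf hg =>
        (AveragesConverge.add hT (hint f) (hint g) hf hg).congr hT (Lp.coeFn_add f g).symm
      smul_mem' := fun c f hf => (AveragesConverge.const_mul c hf).congr hT
        (Lp.coeFn_smul c f).symm }
  have hclosed : IsClosed (𝒞 : Set (Lp ℝ 2 m)) := by
    refine isClosed_of_closure_subset fun f hf => ?_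
    refine averagesConverge_of_approx hT (hint f) fun ε hε => ?_
    obtain ⟨g, hg, hfg⟩ := Metric.mem_closure_iff.1 hf ε hε
    refine ⟨g, hint g, hg, ?_⟩
    have h1 : ∫⁻ x, ‖f x - g x‖ₑ ∂m = eLpNorm (f - g : Lp ℝ 2 m) 1 m := by
      rw [eLpNorm_one_eq_lintegral_enorm]
      exact lintegral_congr_ae ((Lp.coeFn_sub f g).mono fun x hx => by simp only [hx]; rfl)
    rw [h1]
    refine (eLpNorm_le_eLpNorm_of_exponent_le one_le_two
      (Lp.memLp (f - g)).1).trans ?_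
    rw [dist_eq_norm, Lp.norm_def] at hfg
    rw [← ENNReal.ofReal_toReal (Lp.eLpNorm_ne_top (f - g))]
    exact ENNReal.ofReal_le_ofReal hfg.le
  have hmem_ind : ∀ (A : Set X) (hA : MeasurableSet A) (s : G),
      indicatorConstLp 2 ((hT.measurePreserving s).measurable hA) (measure_ne_top m _) (1 : ℝ) -
        indicatorConstLp 2 hA (measure_ne_top m _) (1 : ℝ) ∈ 𝒞 := by
    intro A hA s
    refine (averagesConverge_coboundary (μ := μ) hT (g := A.indicator fun _ => (1 : ℝ))
      (measurable_const.indicator hA) (fun x => ?_) s).congr hT ?_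
    · by_cases hx : x ∈ A <;> simp [hx]
    · filter_upwards [Lp.coeFn_sub
        (indicatorConstLp 2 ((hT.measurePreserving s).measurable hA) (measure_ne_top m _) (1 : ℝ))
        (indicatorConstLp 2 hA (measure_ne_top m _) (1 : ℝ)),
        indicatorConstLp_coeFn (p := 2) (hs := (hT.measurePreserving s).measurable hA)
          (hμs := measure_ne_top m _) (c := (1 : ℝ)),
        indicatorConstLp_coeFn (p := 2) (hs := hA)
          (hμs := measure_ne_top m _) (c := (1 : ℝ))] with x h1 h2 h3
      rw [h1, Pi.sub_apply, h2, h3]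
      rfl
  have hmem_one : indicatorConstLp 2 MeasurableSet.univ (measure_ne_top m _) (1 : ℝ) ∈ 𝒞 := by
    refine (averagesConverge_const (T := T) (m := m) (μ := μ) 1).congr hT ?_
    filter_upwards [indicatorConstLp_coeFn (p := 2) (hs := MeasurableSet.univ)
          (hμs := measure_ne_top m _) (c := (1 : ℝ))] with x h2
    rw [h2]; simp
  -- As in von Neumann's theorem: a vector orthogonal to the coboundaries of indicators is
  -- invariant, hence constant by ergodicity, and orthogonality to `1` makes the constant zero.
  have horth : 𝒞ᗮ = ⊥ := by
    rw [Submodule.eq_bot_iff]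
    intro h hh
    have hinner : ∀ (A : Set X) (hA : MeasurableSet A),
        inner ℝ (indicatorConstLp 2 hA (measure_ne_top m _) (1 : ℝ)) h = ∫ x in A, h x ∂m :=
      fun A hA => L2.inner_indicatorConstLp_one (𝕜 := ℝ) hA (measure_ne_top m _) h
    obtain ⟨c, hc⟩ := hT.ae_const_of_invariant herg (h := h) (hint h).1 (fun s => by
      have hsi : Integrable (fun x => h (T s x)) m :=
        (hT.measurePreserving s).integrable_comp_of_integrable (hint h)
      have hmp := hT.measurePreserving (-s)
      refine Integrable.ae_eq_of_forall_setIntegral_eq _ _ hsi (hint h) fun A hA _ => ?_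
      have h1 := (Submodule.mem_orthogonal _ _).1 hh _ (hmem_ind A hA (-s))
      rw [inner_sub_left, hinner, hinner, sub_eq_zero] at h1
      have h2 := setIntegral_map (μ := m) (g := T s) (f := h)
        (s := T (-s) ⁻¹' A) (hmp.measurable hA)
        (by rw [(hT.measurePreserving s).map_eq]; exact (hint h).1)
        (hT.measurePreserving s).measurable.aemeasurable
      have h3 : T s ⁻¹' (T (-s) ⁻¹' A) = A := by
        ext x; simp [hT.add, hT.zero]
      rw [(hT.measurePreserving s).map_eq, h3] at h2
      rw [← h1, h2])
    have h1 := (Submodule.mem_orthogonal _ _).1 hh _ hmem_one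
    rw [hinner, setIntegral_univ, integral_congr_ae hc] at h1
    simp only [integral_const, probReal_univ, smul_eq_mul, one_mul] at h1
    rw [h1] at hc
    exact (Lp.eq_zero_iff_ae_eq_zero).2 hc
  have htop : 𝒞 = ⊤ := by
    have := (Submodule.topologicalClosure_eq_top_iff (K := 𝒞)).2 horth
    rwa [hclosed.submodule_topologicalClosure_eq] at this
  have : f ∈ 𝒞 := by rw [htop]; trivial
  exact this

/-- **Wiener's ergodic theorem**: the averages of an integrable function over the balls converge
almost everywhere to its mean. -/
theorem averagesConverge (hT : IsMeasurePreservingFlow T m)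
    (herg : ∀ s : Set X, MeasurableSet s → (∀ t, T t ⁻¹' s = s) → m s = 0 ∨ m s = 1)
    {f : X → ℝ} (hf : Integrable f m) : AveragesConverge T m μ f := by
  refine averagesConverge_of_approx hT hf fun ε hε => ?_
  obtain ⟨g, hg, -⟩ := (memLp_one_iff_integrable.2 hf).exists_simpleFunc_eLpNorm_sub_lt
    ENNReal.one_ne_top (ε := ENNReal.ofReal ε) (by simpa using hε)
  have hg2 : MemLp g 2 m := SimpleFunc.memLp_of_isFiniteMeasure g 2 m
  refine ⟨g, hg2.integrable one_le_two,
    (hT.averagesConverge_L2 herg hg2.toLp).congr hT hg2.coeFn_toLp, ?_⟩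
  rw [eLpNorm_one_eq_lintegral_enorm] at hg
  exact hg.le

end IsMeasurePreservingFlow

/-- The masses may be unbounded in `a`, so the kernel need not be finite. Dividing by the mass gives
a finite kernel, and the mass is a finite density that restores the original one. -/
theorem ProbabilityTheory.Kernel.isSFiniteKernel_of_isFiniteMeasure {α β : Type*}
    [MeasurableSpace α] [MeasurableSpace β] (κ : Kernel α β) (h : ∀ a, IsFiniteMeasure (κ a)) :
    IsSFiniteKernel κ := by
  have hm : Measurable fun a => κ a univ := κ.measurable_coe MeasurableSet.univ
  let κ' : Kernel α β :=
    { toFun := fun a => (κ a univ)⁻¹ • κ a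
      measurable' := by
        refine Measure.measurable_of_measurable_coe _ fun s hs => ?_
        simp only [Measure.smul_apply, smul_eq_mul]
        exact hm.inv.mul (κ.measurable_coe hs) }
  have hκ' : IsFiniteKernel κ' := ⟨⟨1, ENNReal.one_lt_top, fun a => by
    change (κ a univ)⁻¹ * κ a univ ≤ 1
    exact ENNReal.inv_mul_le_one _⟩⟩
  have heq : κ = κ'.withDensity fun a _ => κ a univ := by
    ext a s hs
    rw [Kernel.withDensity_apply' _ (by exact hm.comp measurable_fst)]
    rw [MeasureTheory.setLIntegral_const]
    change κ a s = κ a univ * ((κ a univ)⁻¹ * κ a s)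
    by_cases h0 : κ a univ = 0
    · have : κ a s = 0 := measure_mono_null (subset_univ _) h0
      simp [this]
    · rw [← mul_assoc, ENNReal.mul_inv_cancel h0 (measure_ne_top _ _), one_mul]
  rw [heq]
  exact IsSFiniteKernel.withDensity _ fun a _ => measure_ne_top _ _

/-! ### Counting measures, second moments and the Palm measure. -/

namespace Config

open ProbabilityTheory Metric

section Counting

variable {V : Type*} [NormedAddCommGroup V] [MeasurableSpace V] [BorelSpace V]

/-- The counting measure of the points of a configuration. -/
def counting (φ : Config V) : Measure V := Measure.count.restrict φ.carrier

theorem counting_apply (φ : Config V) {A : Set V} (hA : MeasurableSet A) :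
    counting φ A = ((A ∩ φ.carrier).encard : ℝ≥0∞) := by
  rw [counting, Measure.restrict_apply hA,
    Measure.count_apply (hA.inter φ.countable_carrier.measurableSet)]

theorem counting_apply_of_isBounded (φ : Config V) {A : Set V} (hA : MeasurableSet A)
    (hb : Bornology.IsBounded A) : counting φ A = count A φ := by
  rw [counting_apply φ hA, count, ← Set.Finite.cast_ncard_eq (φ.finite_inter _ hb)]
  rfl

theorem setLIntegral_counting (φ : Config V) (f : V → ℝ≥0∞) {B : Set V} (hB : MeasurableSet B) :
    ∫⁻ x in B, f x ∂counting φ = ∑' x : ↥(φ.carrier ∩ B), f x := by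
  rw [counting, Measure.restrict_restrict hB, inter_comm, lintegral_countable _
    (φ.countable_carrier.mono inter_subset_left)]
  simp

theorem measurable_counting : Measurable (counting : Config V → Measure V) := by
  refine Measure.measurable_of_measurable_coe _ fun A hA => ?_
  simp_rw [counting_apply _ hA]
  exact measurable_encard measurable_id (S := Prod.snd ⁻¹' A) (measurable_snd hA)

/-- The counting measures as a kernel. -/
def countingKernel (V : Type*) [NormedAddCommGroup V] [MeasurableSpace V] [BorelSpace V] :
    Kernel (Config V) V where
  toFun := counting
  measurable' := measurable_counting

@[simp]
theorem countingKernel_apply (φ : Config V) : countingKernel V φ = counting φ := rfl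

/-- A configuration has finitely many points in each shell `n ≤ ‖x‖ < n + 1`, and the shells
partition the space. -/
instance isSFiniteKernel_countingKernel : IsSFiniteKernel (countingKernel V) := by
  let A : ℕ → Set V := fun n => {x | ⌊‖x‖⌋₊ = n}
  have hA : ∀ n, MeasurableSet (A n) := fun n =>
    (Nat.measurable_floor.comp measurable_norm) (measurableSet_singleton n)
  have hAb : ∀ n, Bornology.IsBounded (A n) := fun n =>
    isBounded_iff_forall_norm_le.2 ⟨n + 1, fun x hx => by
      have := (Nat.lt_floor_add_one ‖x‖).le
      have hx' : ⌊‖x‖⌋₊ = n := hx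
      rwa [hx'] at this⟩
  have hAd : Pairwise (Function.onFun Disjoint A) := fun i j hij =>
    disjoint_left.2 fun x hx hx' => hij (hx.symm.trans hx')
  have hAu : ⋃ n, A n = univ := by ext x; simp [A]
  have hfin : ∀ n, IsSFiniteKernel ((countingKernel V).restrict (hA n)) := fun n =>
    Kernel.isSFiniteKernel_of_isFiniteMeasure _ fun φ => ⟨by
      rw [Kernel.restrict_apply, Measure.restrict_apply_univ, countingKernel_apply,
        counting_apply_of_isBounded _ (hA n) (hAb n)]
      exact ENNReal.natCast_lt_top _⟩
  have : countingKernel V = Kernel.sum fun n => (countingKernel V).restrict (hA n) := by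
    ext1 φ
    rw [Kernel.sum_apply]
    simp_rw [Kernel.restrict_apply]
    rw [← Measure.restrict_iUnion hAd hA, hAu, Measure.restrict_univ]
  rw [this]
  exact Kernel.isSFiniteKernel_sum

instance sFinite_counting (φ : Config V) : SFinite (counting φ) :=
  inferInstanceAs (SFinite (countingKernel V φ))

theorem counting_translate (t : V) (φ : Config V) :
    counting (translate t φ) = (counting φ).map fun x => x - t := by
  have hm : Measurable fun x : V => x - t := (Homeomorph.subRight t).continuous.measurable
  ext A hA
  rw [Measure.map_apply hm hA, counting_apply _ hA, counting_apply _ (hm hA),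
    ← (sub_left_injective (b := t)).encard_image ((fun x => x - t) ⁻¹' A ∩ φ.carrier),
    image_preimage_inter]
  rfl

theorem lintegral_counting_translate (t : V) (φ : Config V) {f : V → ℝ≥0∞} (hf : Measurable f) :
    ∫⁻ x, f x ∂counting (translate t φ) = ∫⁻ x, f (x - t) ∂counting φ := by
  have hm : Measurable fun x : V => x - t := (Homeomorph.subRight t).continuous.measurable
  rw [counting_translate, lintegral_map hf hm]

theorem translate_translate (s t : V) (φ : Config V) :
    translate s (translate t φ) = translate (s + t) φ := by
  ext x
  simp only [translate, mem_image, exists_exists_and_eq_and]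
  refine exists_congr fun y => and_congr_right fun _ => ?_
  rw [sub_sub, add_comm]

theorem translate_zero (φ : Config V) : translate 0 φ = φ := by
  ext x
  simp [translate]

theorem measurable_translate_right [SecondCountableTopology V] (t : V) :
    Measurable (translate t : Config V → Config V) :=
  measurable_translate.comp measurable_prodMk_right

end Counting

section Campbell

variable {V : Type*} [NormedAddCommGroup V] [InnerProductSpace ℝ V] [FiniteDimensional ℝ V]
  [MeasurableSpace V] [BorelSpace V] {m : Measure (Config V)}

/-- The second moment measure of a point process. -/
def secondMoment (m : Measure (Config V)) : Measure (V × V) :=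
  m.bind (countingKernel V ×ₖ countingKernel V)

theorem lintegral_secondMoment (m : Measure (Config V)) {g : V × V → ℝ≥0∞} (hg : Measurable g) :
    ∫⁻ p, g p ∂secondMoment m =
      ∫⁻ φ, ∫⁻ x, ∫⁻ y, g (x, y) ∂counting φ ∂counting φ ∂m := by
  rw [secondMoment, Measure.lintegral_bind (Kernel.aemeasurable _) hg.aemeasurable]
  refine lintegral_congr fun φ => ?_
  rw [Kernel.lintegral_prod _ _ _ hg]
  rfl

theorem lintegral_translate [SecondCountableTopology V] (hstat : IsStationaryLaw m) (t : V)
    {F : Config V → ℝ≥0∞} (hF : Measurable F) :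
    ∫⁻ φ, F (translate t φ) ∂m = ∫⁻ φ, F φ ∂m := by
  rw [← lintegral_map hF (measurable_translate_right t), hstat t]

theorem lintegral_count_sq_lt_top (hsq : IsSquareIntegrable m) {K : Set V} (hK : IsCompact K) :
    ∫⁻ φ, counting φ K ^ 2 ∂m < ∞ := by
  have h := (hsq K hK).integrable_sq.2
  rw [HasFiniteIntegral] at h
  refine lt_of_le_of_lt (le_of_eq (lintegral_congr fun φ => ?_)) h
  rw [counting_apply_of_isBounded φ hK.isClosed.measurableSet hK.isBounded, enorm_pow,
    Real.enorm_natCast]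

theorem secondMoment_prod_lt_top (hsq : IsSquareIntegrable m) {K : Set V} (hK : IsCompact K) :
    secondMoment m (K ×ˢ K) < ∞ := by
  have hKm : MeasurableSet K := hK.isClosed.measurableSet
  rw [← lintegral_indicator_one (hKm.prod hKm), lintegral_secondMoment m
    (measurable_one.indicator (hKm.prod hKm))]
  refine lt_of_le_of_lt (le_of_eq (lintegral_congr fun φ => ?_)) (lintegral_count_sq_lt_top hsq hK)
  have h1 : ∀ x y : V, (K ×ˢ K).indicator (1 : V × V → ℝ≥0∞) (x, y) =
      K.indicator 1 x * K.indicator 1 y := fun x y => by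
    by_cases hx : x ∈ K <;> by_cases hy : y ∈ K <;> simp [hx, hy]
  simp_rw [h1]
  rw [lintegral_lintegral_mul (measurable_one.indicator hKm).aemeasurable
    (measurable_one.indicator hKm).aemeasurable, lintegral_indicator_one hKm, sq]

/-- The law of `(x, y - x)`, for `x` and `y` in the configuration. -/
def diffMoment (m : Measure (Config V)) : Measure (V × V) :=
  (secondMoment m).map fun p => (p.1, p.2 - p.1)

theorem lintegral_diffMoment (m : Measure (Config V)) {g : V × V → ℝ≥0∞} (hg : Measurable g) :
    ∫⁻ p, g p ∂diffMoment m =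
      ∫⁻ φ, ∫⁻ x, ∫⁻ y, g (x, y - x) ∂counting φ ∂counting φ ∂m := by
  have h : Measurable fun p : V × V => (p.1, p.2 - p.1) := by fun_prop
  rw [diffMoment, lintegral_map hg h]
  exact lintegral_secondMoment m (hg.comp h)

theorem diffMoment_prod (m : Measure (Config V)) {A D : Set V} (hA : MeasurableSet A)
    (hD : MeasurableSet D) :
    diffMoment m (A ×ˢ D) = ∫⁻ φ, ∫⁻ x in A, counting (translate x φ) D ∂counting φ ∂m := by
  rw [← lintegral_indicator_one (hA.prod hD), lintegral_diffMoment m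
    (measurable_one.indicator (hA.prod hD))]
  refine lintegral_congr fun φ => ?_
  rw [← lintegral_indicator hA]
  refine lintegral_congr fun x => ?_
  by_cases hx : x ∈ A
  · rw [indicator_of_mem hx, ← lintegral_indicator_one hD, lintegral_counting_translate _ _
      (measurable_one.indicator hD)]
    refine lintegral_congr fun y => ?_
    by_cases hy : y - x ∈ D <;> simp [hx, hy]
  · simp [hx]

theorem measurable_lintegral_counting {F : Config V × V → ℝ≥0∞} (hF : Measurable F) :
    Measurable fun φ => ∫⁻ x, F (φ, x) ∂counting φ :=
  Measurable.lintegral_kernel_prod_right (κ := countingKernel V) (f := fun φ x => F (φ, x)) hF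

theorem measurable_counting_translate {D : Set V} (hD : MeasurableSet D) :
    Measurable fun q : Config V × V => counting (translate q.2 q.1) D :=
  (Measure.measurable_coe hD).comp (measurable_counting.comp measurable_translate)

/-- Translating a configuration moves `x` but leaves `y - x` unchanged, so stationarity becomes
invariance in the first coordinate alone. -/
theorem diffMoment_prod_preimage_sub (hstat : IsStationaryLaw m) {A D : Set V}
    (hA : MeasurableSet A) (hD : MeasurableSet D) (t : V) :
    diffMoment m (((fun x => x - t) ⁻¹' A) ×ˢ D) = diffMoment m (A ×ˢ D) := by
  have hAt : MeasurableSet ((fun x : V => x - t) ⁻¹' A) :=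
    (measurable_id.sub_const t) hA
  have hF : Measurable fun q : Config V × V => A.indicator (fun _ => (1 : ℝ≥0∞)) q.2 *
      counting (translate q.2 q.1) D :=
    ((measurable_const.indicator hA).comp measurable_snd).mul (measurable_counting_translate hD)
  have hrw : ∀ A : Set V, MeasurableSet A → ∀ φ : Config V,
      ∫⁻ x in A, counting (translate x φ) D ∂counting φ =
      ∫⁻ x, A.indicator (fun _ => (1 : ℝ≥0∞)) x * counting (translate x φ) D ∂counting φ := by
    intro A hA φ
    rw [← lintegral_indicator hA]
    refine lintegral_congr fun x => ?_
    by_cases hx : x ∈ A <;> simp [hx]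
  rw [diffMoment_prod m hA hD, diffMoment_prod m hAt hD]
  simp_rw [hrw _ hA, hrw _ hAt]
  rw [← lintegral_translate hstat t (measurable_lintegral_counting hF)]
  refine lintegral_congr fun φ => ?_
  rw [lintegral_counting_translate]
  · refine lintegral_congr fun x => ?_
    simp only [translate_translate, sub_add_cancel]
    rfl
  · exact hF.comp measurable_prodMk_left

/-- Seen as a push-forward of the law of a configuration with a marked point in `B`, the Palm
measure can be integrated against by change of variables and Fubini. -/
theorem palm_eq_map (m : Measure (Config V)) [SFinite m] {B : Set V} (hB : MeasurableSet B) :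
    palm m B hB = (volume B)⁻¹ • ((m ⊗ₘ countingKernel V).restrict (Prod.snd ⁻¹' B)).map
      fun q => translate q.2 q.1 := by
  ext G hG
  have hGm : MeasurableSet {q : Config V × V | translate q.2 q.1 ∈ G} := measurable_translate hG
  rw [palm_apply m hB hG, Measure.smul_apply, Measure.map_apply measurable_translate hG,
    smul_eq_mul, Measure.restrict_apply (measurable_translate hG),
    Measure.compProd_apply ((measurable_translate hG).inter (measurable_snd hB))]
  congr 1
  refine lintegral_congr fun φ => ?_
  rw [← setLIntegral_counting φ (fun x => G.indicator (fun _ => (1 : ℝ≥0∞)) (translate x φ)) hB]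
  have hGφ : MeasurableSet {x : V | translate x φ ∈ G} :=
    (measurable_translate.comp measurable_prodMk_left) hG
  change ∫⁻ x in B, {x : V | translate x φ ∈ G}.indicator 1 x ∂counting φ = _
  rw [lintegral_indicator_one hGφ, Measure.restrict_apply hGφ]
  rfl

theorem intensity_palm (m : Measure (Config V)) [SFinite m] {B : Set V} (hB : MeasurableSet B)
    {D : Set V} (hD : MeasurableSet D) :
    intensity (palm m B hB) D = (volume B)⁻¹ * diffMoment m (B ×ˢ D) := by
  rw [intensity_apply _ hD, palm_eq_map, diffMoment_prod m hB hD]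
  simp_rw [← counting_apply _ hD]
  have hc : Measurable fun φ : Config V => counting φ D :=
    (Measure.measurable_coe hD).comp measurable_counting
  have hF := measurable_counting_translate (V := V) hD
  rw [lintegral_smul_measure, lintegral_map hc measurable_translate, smul_eq_mul,
    ← lintegral_indicator (measurable_snd hB),
    Measure.lintegral_compProd (hF.indicator (measurable_snd hB))]
  congr 1
  refine lintegral_congr fun φ => ?_
  rw [← lintegral_indicator hB]
  rfl

end Campbell

end Config

/-- The closed balls of radius one have uniformly bounded measure. -/
def IsTranslationBounded {V : Type*} [NormedAddCommGroup V] [MeasurableSpace V]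
    (μ : Measure V) : Prop :=
  ∃ C : ℝ≥0∞, C ≠ ∞ ∧ ∀ u : V, μ (Metric.closedBall u 1) ≤ C

/-! ### Campbell's formula for pairs and translation boundedness. -/

namespace Config

open ProbabilityTheory Metric

variable {V : Type*} [NormedAddCommGroup V] [InnerProductSpace ℝ V] [FiniteDimensional ℝ V]
  [MeasurableSpace V] [BorelSpace V] {m : Measure (Config V)}

theorem diffMoment_prod_lt_top (hsq : IsSquareIntegrable m) {A D : Set V} (hA : MeasurableSet A)
    (hD : MeasurableSet D) (hAb : Bornology.IsBounded A) (hDb : Bornology.IsBounded D) :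
    diffMoment m (A ×ˢ D) < ∞ := by
  obtain ⟨a, ha⟩ := hAb.exists_norm_le
  obtain ⟨b, hb⟩ := hDb.exists_norm_le
  have hm : Measurable fun p : V × V => (p.1, p.2 - p.1) := by fun_prop
  rw [diffMoment, Measure.map_apply hm (hA.prod hD)]
  refine lt_of_le_of_lt (measure_mono ?_)
    (secondMoment_prod_lt_top hsq (isCompact_closedBall (0 : V) (|a| + |b|)))
  rintro ⟨x, y⟩ ⟨hx, hy⟩
  have h1 : ‖x‖ ≤ |a| := (ha x hx).trans (le_abs_self a)
  have h2 : ‖y - x‖ ≤ |b| := (hb _ hy).trans (le_abs_self b)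
  have h3 : ‖y‖ ≤ ‖y - x‖ + ‖x‖ := by
    simpa using norm_add_le (y - x) x
  have h4 := abs_nonneg b
  simp only [mem_prod, mem_closedBall, dist_zero_right]
  constructor <;> linarith

/-- In `A` this is a translation invariant measure, finite on compact sets because `D` is bounded
and the process is square integrable. Uniqueness of Haar measure gives the proportionality. -/
theorem diffMoment_prod_of_isBounded (hstat : IsStationaryLaw m) (hsq : IsSquareIntegrable m)
    {D : Set V} (hD : MeasurableSet D) (hDb : Bornology.IsBounded D) :
    ∃ κ : ℝ≥0∞, κ ≠ ∞ ∧ ∀ A : Set V, MeasurableSet A →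
      diffMoment m (A ×ˢ D) = κ * volume A := by
  let ν : Measure V := ((diffMoment m).restrict (univ ×ˢ D)).map Prod.fst
  have hν : ∀ A, MeasurableSet A → ν A = diffMoment m (A ×ˢ D) := by
    intro A hA
    rw [Measure.map_apply measurable_fst hA, Measure.restrict_apply (measurable_fst hA)]
    congr 1
    ext p
    simp
  have h1 : IsFiniteMeasureOnCompacts ν := ⟨fun K hK => by
    rw [hν K hK.isClosed.measurableSet]
    exact diffMoment_prod_lt_top hsq hK.isClosed.measurableSet hD hK.isBounded hDb⟩
  have h2 : ν.IsAddLeftInvariant := ⟨fun t => by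
    ext A hA
    rw [Measure.map_apply (measurable_const_add t) hA, hν A hA, hν _ (measurable_const_add t hA),
      ← diffMoment_prod_preimage_sub hstat hA hD (-t)]
    congr 2
    ext x
    simp [add_comm]⟩
  refine ⟨ν.addHaarScalarFactor volume, ENNReal.coe_ne_top, fun A hA => ?_⟩
  rw [← hν A hA]
  conv_lhs => rw [Measure.isAddLeftInvariant_eq_smul ν volume]
  rfl

/-- The factor in front of Lebesgue measure is identified by evaluating at `A = B`, where it is the
definition of the Palm intensity; in particular the choice of `B` does not matter. Unbounded `D` are
exhausted by balls. -/
theorem diffMoment_eq_prod [IsProbabilityMeasure m] (hstat : IsStationaryLaw m)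
    (hsq : IsSquareIntegrable m) {B : Set V} (hB : MeasurableSet B) (hB0 : volume B ≠ 0)
    (hBt : volume B ≠ ∞) :
    IsLocallyFiniteMeasure (intensity (palm m B hB)) ∧
      diffMoment m = volume.prod (intensity (palm m B hB)) := by
  have key : ∀ D : Set V, MeasurableSet D → Bornology.IsBounded D →
      intensity (palm m B hB) D ≠ ∞ ∧ ∀ A : Set V, MeasurableSet A →
      diffMoment m (A ×ˢ D) = intensity (palm m B hB) D * volume A := by
    intro D hD hDb
    obtain ⟨κ, hκ, h⟩ := diffMoment_prod_of_isBounded hstat hsq hD hDb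
    have : intensity (palm m B hB) D = κ := by
      rw [intensity_palm m hB hD, h B hB, mul_comm κ, ← mul_assoc,
        ENNReal.inv_mul_cancel hB0 hBt, one_mul]
    rw [this]
    exact ⟨hκ, h⟩
  have hlf : IsLocallyFiniteMeasure (intensity (palm m B hB)) := ⟨fun x =>
    ⟨closedBall x 1, closedBall_mem_nhds x one_pos,
      (key _ measurableSet_closedBall isBounded_closedBall).1.lt_top⟩⟩
  refine ⟨hlf, (Measure.prod_eq fun A D hA hD => ?_).symm⟩
  have hmono : Monotone fun n : ℕ => D ∩ closedBall (0 : V) n := fun i j hij =>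
    inter_subset_inter_right _ (closedBall_subset_closedBall (by exact_mod_cast hij))
  have hU : D = ⋃ n : ℕ, D ∩ closedBall (0 : V) n := by
    rw [← inter_iUnion, iUnion_closedBall_nat, inter_univ]
  have hAD : A ×ˢ D = ⋃ n : ℕ, A ×ˢ (D ∩ closedBall (0 : V) n) := by
    rw [← prod_iUnion, ← hU]
  rw [hAD, Monotone.measure_iUnion (fun i j hij => prod_mono_right (hmono hij))]
  conv_rhs => rw [hU, hmono.measure_iUnion, ENNReal.mul_iSup]
  refine iSup_congr fun n => ?_
  rw [(key _ (hD.inter measurableSet_closedBall)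
    (isBounded_closedBall.subset inter_subset_right)).2 A hA, mul_comm]

/-- Campbell's formula for pairs of points. -/
theorem lintegral_pairs [IsProbabilityMeasure m] (hstat : IsStationaryLaw m)
    (hsq : IsSquareIntegrable m) {B : Set V} (hB : MeasurableSet B) (hB0 : volume B ≠ 0)
    (hBt : volume B ≠ ∞) {g : V × V → ℝ≥0∞} (hg : Measurable g) :
    ∫⁻ φ, ∫⁻ x, ∫⁻ y, g (x, y) ∂counting φ ∂counting φ ∂m =
      ∫⁻ x, ∫⁻ z, g (x, x + z) ∂intensity (palm m B hB) := by
  obtain ⟨hlf, h⟩ := diffMoment_eq_prod hstat hsq hB hB0 hBt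
  have hg' : Measurable fun p : V × V => g (p.1, p.1 + p.2) := by fun_prop
  have h1 := lintegral_diffMoment m hg'
  rw [h, lintegral_prod _ hg'.aemeasurable] at h1
  rw [h1]
  simp only [add_sub_cancel]

/-- If `x ∈ B_1(0)` and `y - x ∈ B_1(u)`, then `y ∈ B_2(u)`. The number of such pairs is at most the
product of the counts in `B_2(0)` and `B_2(u)`, hence at most the sum of their squares. By
stationarity both squares have the same expectation, whatever `u` is. -/
theorem isTranslationBounded_intensity [IsProbabilityMeasure m] (hstat : IsStationaryLaw m)
    (hsq : IsSquareIntegrable m) {B : Set V} (hB : MeasurableSet B) (hB0 : volume B ≠ 0)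
    (hBt : volume B ≠ ∞) : IsTranslationBounded (intensity (palm m B hB)) := by
  obtain ⟨hlf, h⟩ := diffMoment_eq_prod hstat hsq hB hB0 hBt
  set c := intensity (palm m B hB)
  set S : ℝ≥0∞ := ∫⁻ φ, counting φ (closedBall 0 2) ^ 2 ∂m with hS
  have hSt : S ≠ ∞ := (lintegral_count_sq_lt_top hsq (isCompact_closedBall 0 2)).ne
  have hv0 : volume (closedBall (0 : V) 1) ≠ 0 := (measure_closedBall_pos _ _ one_pos).ne'
  have hvt : volume (closedBall (0 : V) 1) ≠ ∞ := measure_closedBall_lt_top.ne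
  have hmeas : ∀ u : V, Measurable fun φ : Config V => counting φ (closedBall u 2) := fun u =>
    (Measure.measurable_coe measurableSet_closedBall).comp measurable_counting
  refine ⟨(volume (closedBall (0 : V) 1))⁻¹ * (S + S),
    ENNReal.mul_ne_top (ENNReal.inv_ne_top.2 hv0) (ENNReal.add_ne_top.2 ⟨hSt, hSt⟩), fun u => ?_⟩
  have h1 : diffMoment m (closedBall 0 1 ×ˢ closedBall u 1) =
      volume (closedBall (0 : V) 1) * c (closedBall u 1) := by
    rw [h, Measure.prod_prod]
  have h2 : diffMoment m (closedBall 0 1 ×ˢ closedBall u 1) ≤ S + S := by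
    have hSu : ∫⁻ φ, counting φ (closedBall u 2) ^ 2 ∂m = S := by
      rw [hS, ← lintegral_translate hstat u ((hmeas 0).pow_const 2)]
      refine lintegral_congr fun φ => ?_
      rw [counting_translate, Measure.map_apply (measurable_sub_const u)
        measurableSet_closedBall]
      congr 2
      ext x
      simp [dist_eq_norm]
    rw [diffMoment_prod m measurableSet_closedBall measurableSet_closedBall]
    calc _ ≤ ∫⁻ φ, (counting φ (closedBall 0 2) ^ 2 + counting φ (closedBall u 2) ^ 2) ∂m := by
          refine lintegral_mono fun φ => ?_
          calc ∫⁻ x in closedBall 0 1, counting (translate x φ) (closedBall u 1) ∂counting φ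
              ≤ ∫⁻ x in closedBall 0 1, counting φ (closedBall u 2) ∂counting φ := by
                refine setLIntegral_mono measurable_const fun x hx => ?_
                rw [counting_translate, Measure.map_apply (measurable_sub_const x)
                  measurableSet_closedBall]
                refine measure_mono fun y hy => ?_
                rw [mem_closedBall, dist_eq_norm] at hx ⊢
                have hy' : ‖y - x - u‖ ≤ 1 := by
                  simpa [dist_eq_norm] using hy
                have h3 := norm_add_le (y - x - u) (x - 0)
                have h4 : y - x - u + (x - 0) = y - u := by abel
                rw [h4] at h3
                linarith
            _ = counting φ (closedBall u 2) * counting φ (closedBall 0 1) := by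
                rw [setLIntegral_const]
            _ ≤ counting φ (closedBall u 2) * counting φ (closedBall 0 2) := by
                gcongr
                norm_num
            _ ≤ _ := by
                rcases le_total (counting φ (closedBall u 2)) (counting φ (closedBall 0 2))
                  with hle | hle
                · refine le_trans (mul_le_mul_left hle _) ?_
                  rw [← sq]
                  exact le_self_add
                · refine le_trans (mul_le_mul_right hle _) ?_
                  rw [← sq]
                  exact le_add_self
      _ = S + S := by
          rw [lintegral_add_left ((hmeas 0).pow_const 2), hSu]
  rw [h1] at h2
  calc c (closedBall u 1) = (volume (closedBall (0 : V) 1))⁻¹ *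
        (volume (closedBall (0 : V) 1) * c (closedBall u 1)) := by
        rw [← mul_assoc, ENNReal.inv_mul_cancel hv0 hvt, one_mul]
    _ ≤ _ := by gcongr

end Config

/-! ### Integrability and polynomial decay for translation bounded measures. -/

section TranslationBounded

open Metric

variable {V : Type*} [NormedAddCommGroup V] [InnerProductSpace ℝ V] [FiniteDimensional ℝ V]
  [MeasurableSpace V] [BorelSpace V]

/-- The weight `(1 + ‖x‖) ^ (-(dim V + 1))`, which is integrable for translation bounded
measures. -/
def polyWeight (x : V) : ℝ := (1 + ‖x‖) ^ (-((Module.finrank ℝ V + 1 : ℕ) : ℝ))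

theorem polyWeight_pos (x : V) : 0 < polyWeight x := by
  unfold polyWeight; positivity

theorem continuous_polyWeight : Continuous (polyWeight : V → ℝ) :=
  (continuous_const.add continuous_norm).rpow_const fun x => Or.inl (by
    have := norm_nonneg x; exact ne_of_gt (show 0 < 1 + ‖x‖ by linarith))

theorem polyWeight_le_of_norm_le {x u : V} {a : ℝ} (ha : 0 < a) (h : a * (1 + ‖u‖) ≤ 1 + ‖x‖) :
    polyWeight x ≤ a ^ (-((Module.finrank ℝ V + 1 : ℕ) : ℝ)) * polyWeight u := by
  unfold polyWeight
  rw [← Real.mul_rpow ha.le (by positivity)]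
  exact Real.rpow_le_rpow_of_nonpos (by positivity) h (neg_nonpos.2 (Nat.cast_nonneg _))

theorem integrable_polyWeight : Integrable (polyWeight : V → ℝ) :=
  integrable_one_add_norm (by push_cast; linarith)

/-- Fubini on the pairs `(x, u)` at distance at most `1`: each `x` sees the volume of a unit ball in
`u`, and each `u` sees a mass at most `C` in `x`. This compares integrals against `μ` with Lebesgue
integrals. -/
theorem lintegral_mul_volume_closedBall_le {μ : Measure V} [SFinite μ] {C : ℝ≥0∞}
    (hC : ∀ u : V, μ (closedBall u 1) ≤ C) {v w : V → ℝ≥0∞} (hv : Measurable v)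
    (hw : Measurable w) (h : ∀ x u : V, ‖x - u‖ ≤ 1 → v x ≤ w u) :
    (∫⁻ x, v x ∂μ) * volume (closedBall (0 : V) 1) ≤ C * ∫⁻ u, w u := by
  have hS : MeasurableSet {p : V × V | dist p.1 p.2 ≤ 1} :=
    (isClosed_le (continuous_fst.dist continuous_snd) continuous_const).measurableSet
  have hm : Measurable fun p : V × V =>
      {p : V × V | dist p.1 p.2 ≤ 1}.indicator (fun p => w p.2) p :=
    (hw.comp measurable_snd).indicator hS
  calc (∫⁻ x, v x ∂μ) * volume (closedBall (0 : V) 1)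
      = ∫⁻ x, v x * volume (closedBall x 1) ∂μ := by
        simp_rw [Measure.addHaar_closedBall_center volume]
        rw [lintegral_mul_const _ hv]
    _ ≤ ∫⁻ x, ∫⁻ u, {p : V × V | dist p.1 p.2 ≤ 1}.indicator (fun p => w p.2) (x, u)
          ∂volume ∂μ := by
        refine lintegral_mono fun x => ?_
        rw [← setLIntegral_const, ← lintegral_indicator measurableSet_closedBall]
        refine lintegral_mono fun u => ?_
        by_cases hu : u ∈ closedBall x 1
        · have hd : dist x u ≤ 1 := by rwa [dist_comm]
          rw [indicator_of_mem hu, indicator_of_mem (by exact hd)]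
          exact h x u (by rwa [← dist_eq_norm])
        · rw [indicator_of_notMem hu]
          exact zero_le
    _ = ∫⁻ u, ∫⁻ x, {p : V × V | dist p.1 p.2 ≤ 1}.indicator (fun p => w p.2) (x, u) ∂μ :=
        lintegral_lintegral_swap hm.aemeasurable
    _ = ∫⁻ u, w u * μ (closedBall u 1) := by
        refine lintegral_congr fun u => ?_
        rw [← setLIntegral_const, ← lintegral_indicator measurableSet_closedBall]
        refine lintegral_congr fun x => ?_
        by_cases hx : x ∈ closedBall u 1
        · rw [indicator_of_mem hx, indicator_of_mem (by exact hx)]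
        · rw [indicator_of_notMem hx, indicator_of_notMem (by exact hx)]
    _ ≤ ∫⁻ u, w u * C := by gcongr with u; exact hC u
    _ = _ := by rw [lintegral_mul_const _ hw, mul_comm]

theorem isLocallyFiniteMeasure_of_closedBall_le {μ : Measure V} {C : ℝ≥0∞} (hCt : C ≠ ∞)
    (hC : ∀ u : V, μ (closedBall u 1) ≤ C) : IsLocallyFiniteMeasure μ :=
  ⟨fun x => ⟨closedBall x 1, closedBall_mem_nhds x one_pos, (hC x).trans_lt hCt.lt_top⟩⟩

theorem IsTranslationBounded.isLocallyFiniteMeasure {μ : Measure V}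
    (h : IsTranslationBounded μ) : IsLocallyFiniteMeasure μ := by
  obtain ⟨C, hCt, hC⟩ := h
  exact isLocallyFiniteMeasure_of_closedBall_le hCt hC

/-- The tails of the weight are small, uniformly for measures with the same bound. -/
theorem lintegral_polyWeight_tail_le {μ : Measure V} [SFinite μ] {C : ℝ≥0∞}
    (hC : ∀ u : V, μ (closedBall u 1) ≤ C) (r : ℝ) :
    ∫⁻ x in (closedBall 0 (r + 1))ᶜ, ENNReal.ofReal (polyWeight x) ∂μ ≤
      (volume (closedBall (0 : V) 1))⁻¹ * C *
        (ENNReal.ofReal (2⁻¹ ^ (-((Module.finrank ℝ V + 1 : ℕ) : ℝ))) *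
        ∫⁻ u in (closedBall (0 : V) r)ᶜ, ENNReal.ofReal (polyWeight u)) := by
  have hm : Measurable fun x : V => ENNReal.ofReal (polyWeight x) :=
    continuous_polyWeight.measurable.ennreal_ofReal
  set K := ENNReal.ofReal (2⁻¹ ^ (-((Module.finrank ℝ V + 1 : ℕ) : ℝ)))
  have h := lintegral_mul_volume_closedBall_le hC
    (v := (closedBall (0 : V) (r + 1))ᶜ.indicator fun x => ENNReal.ofReal (polyWeight x))
    (w := (closedBall (0 : V) r)ᶜ.indicator fun x => K * ENNReal.ofReal (polyWeight x))
    (hm.indicator measurableSet_closedBall.compl)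
    ((hm.const_mul _).indicator measurableSet_closedBall.compl) (by
      intro x u hxu
      by_cases hx : x ∈ closedBall (0 : V) (r + 1)
      · rw [indicator_of_notMem (by simpa using hx)]
        exact zero_le
      · have h1 := norm_sub_norm_le x u
        have h2 : u ∉ closedBall (0 : V) r := by
          simp only [mem_closedBall, dist_zero_right, not_le] at hx ⊢
          linarith
        have h3 := norm_sub_norm_le u x
        rw [norm_sub_rev] at h3
        rw [indicator_of_mem (by exact hx), indicator_of_mem (by exact h2),
          ← ENNReal.ofReal_mul (by positivity)]
        refine ENNReal.ofReal_le_ofReal (polyWeight_le_of_norm_le (by norm_num) ?_)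
        have := norm_nonneg x
        linarith)
  rw [lintegral_indicator measurableSet_closedBall.compl,
    lintegral_indicator measurableSet_closedBall.compl, lintegral_const_mul _ hm] at h
  have hv0 : volume (closedBall (0 : V) 1) ≠ 0 := (measure_closedBall_pos _ _ one_pos).ne'
  have hvt : volume (closedBall (0 : V) 1) ≠ ∞ := measure_closedBall_lt_top.ne
  rw [mul_assoc]
  calc _ = (volume (closedBall (0 : V) 1))⁻¹ *
        ((∫⁻ x in (closedBall 0 (r + 1))ᶜ, ENNReal.ofReal (polyWeight x) ∂μ) *
          volume (closedBall (0 : V) 1)) := by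
        rw [mul_comm _ (volume _), ← mul_assoc, ENNReal.inv_mul_cancel hv0 hvt, one_mul]
    _ ≤ _ := by gcongr

/-- A bound for the integral of the weight, uniform for measures with the same bound. -/
def polyWeightBound (V : Type*) [NormedAddCommGroup V] [InnerProductSpace ℝ V]
    [FiniteDimensional ℝ V] [MeasurableSpace V] [BorelSpace V] (C : ℝ≥0∞) : ℝ≥0∞ :=
  (volume (closedBall (0 : V) 1))⁻¹ * C *
    (ENNReal.ofReal (2⁻¹ ^ (-((Module.finrank ℝ V + 1 : ℕ) : ℝ))) *
    ∫⁻ u : V, ENNReal.ofReal (polyWeight u))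

theorem polyWeightBound_ne_top {C : ℝ≥0∞} (hC : C ≠ ∞) : polyWeightBound V C ≠ ∞ := by
  refine ENNReal.mul_ne_top (ENNReal.mul_ne_top (ENNReal.inv_ne_top.2
    (measure_closedBall_pos _ _ one_pos).ne') hC)
    (ENNReal.mul_ne_top ENNReal.ofReal_ne_top ?_)
  rw [← ofReal_integral_eq_lintegral_ofReal integrable_polyWeight
    (Eventually.of_forall fun x => (polyWeight_pos x).le)]
  exact ENNReal.ofReal_ne_top

theorem lintegral_polyWeight_le {μ : Measure V} [SFinite μ] {C : ℝ≥0∞}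
    (hC : ∀ u : V, μ (closedBall u 1) ≤ C) :
    ∫⁻ x, ENNReal.ofReal (polyWeight x) ∂μ ≤ polyWeightBound V C := by
  -- With `r = -2` both balls have negative radius and are empty, so the tails are the full
  -- integrals.
  have h := lintegral_polyWeight_tail_le hC (-2)
  have h1 : (closedBall (0 : V) (-2 + 1))ᶜ = univ := by
    rw [closedBall_eq_empty.2 (by norm_num), compl_empty]
  have h2 : (closedBall (0 : V) (-2))ᶜ = univ := by
    rw [closedBall_eq_empty.2 (by norm_num), compl_empty]
  rwa [h1, h2, Measure.restrict_univ, Measure.restrict_univ] at h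

theorem IsTranslationBounded.integrable_polyWeight {μ : Measure V} (h : IsTranslationBounded μ) :
    Integrable polyWeight μ := by
  have := h.isLocallyFiniteMeasure
  obtain ⟨C, hCt, hC⟩ := h
  refine ⟨continuous_polyWeight.aestronglyMeasurable, ?_⟩
  rw [hasFiniteIntegral_iff_ofReal (Eventually.of_forall fun x => (polyWeight_pos x).le)]
  exact (lintegral_polyWeight_le hC).trans_lt (polyWeightBound_ne_top hCt).lt_top

theorem IsTranslationBounded.hasTemperateGrowth {μ : Measure V} (h : IsTranslationBounded μ) :
    μ.HasTemperateGrowth :=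
  ⟨⟨Module.finrank ℝ V + 1, h.integrable_polyWeight⟩⟩

theorem isTranslationBounded_volume : IsTranslationBounded (volume : Measure V) :=
  ⟨volume (closedBall (0 : V) 1), measure_closedBall_lt_top.ne, fun u =>
    (Measure.addHaar_closedBall_center volume u 1).le⟩

/-- Functions that decay at least as fast as the weight. -/
def HasPolyDecay {W : Type*} [Norm W] (f : V → W) : Prop := ∃ K : ℝ, ∀ x, ‖f x‖ ≤ K * polyWeight x

theorem IsTranslationBounded.integrable {μ : Measure V} (h : IsTranslationBounded μ) {W : Type*}
    [NormedAddCommGroup W] {f : V → W} (hf : AEStronglyMeasurable f μ) (hd : HasPolyDecay f) :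
    Integrable f μ := by
  obtain ⟨K, hK⟩ := hd
  exact (h.integrable_polyWeight.const_mul K).mono' hf (Eventually.of_forall hK)

/-- From `(1 + r)² ≤ 2 + 2r²`, the left side is at most `exp a` times a Gaussian in `1 + r`, and
`exp t ≥ tⁿ / n!` gives the power. -/
theorem exp_neg_mul_sq_le (n : ℕ) {a : ℝ} (ha : 0 < a) :
    ∃ K : ℝ, 0 ≤ K ∧ ∀ r : ℝ, 0 ≤ r → Real.exp (-a * r ^ 2) ≤ K * (1 + r) ^ (-(n : ℝ)) := by
  refine ⟨Real.exp a * (n.factorial / (a / 2) ^ n), by positivity, fun r hr => ?_⟩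
  have h1 : Real.exp (-a * r ^ 2) ≤ Real.exp a * Real.exp (-(a / 2 * (1 + r) ^ 2)) := by
    rw [← Real.exp_add]
    gcongr
    nlinarith [sq_nonneg (r - 1)]
  refine h1.trans ?_
  rw [mul_assoc]
  gcongr
  have h2 := Real.pow_div_factorial_le_exp (a / 2 * (1 + r) ^ 2) (by positivity) n
  rw [Real.exp_neg, Real.rpow_neg (by positivity), Real.rpow_natCast]
  have h3 : (a / 2) ^ n * (1 + r) ^ n / n.factorial ≤ Real.exp (a / 2 * (1 + r) ^ 2) := by
    refine le_trans ?_ h2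
    rw [← mul_pow]
    have : 1 + r ≤ (1 + r) ^ 2 := by nlinarith
    gcongr
  calc (Real.exp (a / 2 * (1 + r) ^ 2))⁻¹ ≤ ((a / 2) ^ n * (1 + r) ^ n / n.factorial)⁻¹ := by
        gcongr
    _ = _ := by
        rw [inv_div]
        field_simp

theorem hasPolyDecay_gaussian {a : ℝ} (ha : 0 < a) :
    HasPolyDecay fun x : V => Real.exp (-a * ‖x‖ ^ 2) := by
  obtain ⟨K, hK0, hK⟩ := exp_neg_mul_sq_le (Module.finrank ℝ V + 1) ha
  refine ⟨K, fun x => ?_⟩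
  rw [Real.norm_of_nonneg (Real.exp_pos _).le]
  exact hK _ (norm_nonneg x)

theorem HasPolyDecay.comp_sub {W : Type*} [Norm W] {f : V → W} (hf : HasPolyDecay f)
    (hf0 : ∀ x, 0 ≤ ‖f x‖) (u : V) :
    HasPolyDecay fun x => f (x - u) := by
  obtain ⟨K, hK⟩ := hf
  have hK0 : 0 ≤ K := by
    have := (hf0 0).trans (hK 0)
    exact nonneg_of_mul_nonneg_left this (polyWeight_pos 0)
  refine ⟨K * (1 + ‖u‖)⁻¹ ^ (-((Module.finrank ℝ V + 1 : ℕ) : ℝ)), fun x => (hK _).trans ?_⟩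
  rw [mul_assoc]
  gcongr
  refine polyWeight_le_of_norm_le (by positivity) ?_
  rw [inv_mul_le_iff₀ (by positivity)]
  have h1 := norm_le_norm_add_norm_sub' x u
  have h2 := norm_nonneg u
  have h3 := norm_nonneg (x - u)
  nlinarith

end TranslationBounded

/-! ### Gaussian regularization of the spectral measure. -/

section BochnerSchwartz

open Metric

variable {V : Type*} [NormedAddCommGroup V] [InnerProductSpace ℝ V] [FiniteDimensional ℝ V]
  [MeasurableSpace V] [BorelSpace V]

/-- The Gaussian `exp (-π ε ‖x‖²)`. -/
def gauss (ε : ℝ) (x : V) : ℂ := (Real.exp (-(Real.pi * ε) * ‖x‖ ^ 2) : ℝ)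

theorem continuous_gauss (ε : ℝ) : Continuous (gauss ε : V → ℂ) := by
  unfold gauss; fun_prop

theorem norm_gauss (ε : ℝ) (x : V) : ‖gauss ε x‖ = Real.exp (-(Real.pi * ε) * ‖x‖ ^ 2) := by
  rw [gauss, Complex.norm_real, Real.norm_of_nonneg (Real.exp_pos _).le]

theorem norm_gauss_le_one {ε : ℝ} (hε : 0 ≤ ε) (x : V) : ‖gauss ε x‖ ≤ 1 := by
  rw [norm_gauss, Real.exp_le_one_iff]
  have := Real.pi_pos
  have : 0 ≤ Real.pi * ε * ‖x‖ ^ 2 := by positivity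
  linarith

theorem hasPolyDecay_gauss {ε : ℝ} (hε : 0 < ε) : HasPolyDecay (gauss ε : V → ℂ) := by
  obtain ⟨K, hK⟩ := hasPolyDecay_gaussian (V := V) (mul_pos Real.pi_pos hε)
  refine ⟨K, fun x => ?_⟩
  rw [norm_gauss]
  exact (le_abs_self _).trans (hK x)

/-- The Fourier transform of the finite measure `exp (-π ε ‖x‖²) c`. -/
def gaussDensity (c : Measure V) (ε : ℝ) (ξ : V) : ℂ :=
  VectorFourier.fourierIntegral Real.fourierChar c (innerₗ V) (gauss ε) ξ

/-- The measure `c` is positive definite, tested on Gaussians. -/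
def IsGaussPosDef (c : Measure V) : Prop :=
  ∀ ε : ℝ, 0 < ε → ∀ ξ : V, ∃ r : ℝ, 0 ≤ r ∧ gaussDensity c ε ξ = r

theorem continuous_inner_pair : Continuous fun p : V × V => (innerₗ V p.1) p.2 :=
  continuous_inner

theorem continuous_gaussDensity {c : Measure V} (hc : IsTranslationBounded c) {ε : ℝ}
    (hε : 0 < ε) : Continuous (gaussDensity c ε) :=
  VectorFourier.fourierIntegral_continuous Real.continuous_fourierChar continuous_inner_pair
    (hc.integrable (continuous_gauss ε).aestronglyMeasurable (hasPolyDecay_gauss hε))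

/-- The regularized spectral measure. -/
def gaussSpectral (c : Measure V) (ε : ℝ) : Measure V :=
  volume.withDensity fun ξ => ENNReal.ofReal (gaussDensity c ε ξ).re

/-- Self-adjointness of the Fourier transform, between `c` and Lebesgue measure. Positivity is what
makes the density equal to its truncation by `ENNReal.ofReal`. -/
theorem integral_gaussSpectral {c : Measure V} (hc : IsTranslationBounded c)
    (hpos : IsGaussPosDef c) {ε : ℝ} (hε : 0 < ε) {f : V → ℂ} (hf : Integrable f) :
    ∫ ξ, f ξ ∂gaussSpectral c ε = ∫ x, gauss ε x * 𝓕 f x ∂c := by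
  have := hc.isLocallyFiniteMeasure
  have hm : Measurable fun ξ => ENNReal.ofReal (gaussDensity c ε ξ).re :=
    (Complex.continuous_re.comp (continuous_gaussDensity hc hε)).measurable.ennreal_ofReal
  rw [gaussSpectral, integral_withDensity_eq_integral_toReal_smul hm
    (Eventually.of_forall fun _ => ENNReal.ofReal_lt_top)]
  have h1 : ∀ ξ, (ENNReal.ofReal (gaussDensity c ε ξ).re).toReal • f ξ =
      gaussDensity c ε ξ • f ξ := by
    intro ξ
    obtain ⟨r, hr, h⟩ := hpos ε hε ξ
    rw [h, Complex.ofReal_re, ENNReal.toReal_ofReal hr, Complex.coe_smul]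
  simp_rw [h1]
  have h2 := VectorFourier.integral_fourierIntegral_smul_eq_flip (μ := c) (ν := volume)
    (L := innerₗ V) (f := gauss ε) (g := f) Real.continuous_fourierChar continuous_inner_pair
    (hc.integrable (continuous_gauss ε).aestronglyMeasurable (hasPolyDecay_gauss hε)) hf
  have hflip : (innerₗ V).flip = innerₗ V := by ext x y; exact real_inner_comm _ _
  rw [hflip] at h2
  exact h2

theorem fourier_gauss_one (w : V) : 𝓕 (gauss 1 : V → ℂ) w = gauss 1 w := by
  have h : (gauss 1 : V → ℂ) = fun v => Complex.exp (-(Real.pi : ℂ) * ‖v‖ ^ 2) := by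
    ext v; simp [gauss]
  rw [h, fourier_gaussian_innerProductSpace (by simpa using Real.pi_pos)]
  have hpi : (Real.pi : ℂ) ≠ 0 := by exact_mod_cast Real.pi_ne_zero
  rw [div_self hpi, Complex.one_cpow, one_mul]
  congr 1
  field_simp

/-- A translation multiplies the transform by a phase. That the modulus does not depend on `u` is
the source of every bound uniform in the centre of the ball. -/
theorem norm_fourier_gauss_sub (u w : V) :
    ‖𝓕 (fun v : V => gauss 1 (v - u)) w‖ = Real.exp (-Real.pi * ‖w‖ ^ 2) := by
  have h := congrFun (VectorFourier.fourierIntegral_comp_add_right Real.fourierChar volume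
    (innerₗ V) (gauss 1 : V → ℂ) (-u)) w
  have h2 : (fun v : V => gauss 1 (v - u)) = gauss 1 ∘ fun v => v + -u := by
    ext v; simp [sub_eq_add_neg]
  rw [h2]
  change ‖VectorFourier.fourierIntegral Real.fourierChar volume
    (innerₗ V) (gauss 1 ∘ fun v => v + -u) w‖ = _
  rw [h, Circle.norm_smul]
  change ‖𝓕 (gauss 1 : V → ℂ) w‖ = _
  rw [fourier_gauss_one, norm_gauss, mul_one]

/-- A bound for the mass of unit balls, from the Gaussian integrals. -/
theorem measure_closedBall_le_of_gauss {μ : Measure V} (u : V) {M : ℝ}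
    (hi : Integrable (fun v : V => gauss 1 (v - u)) μ)
    (h : ‖∫ v, gauss 1 (v - u) ∂μ‖ ≤ M) :
    μ (closedBall u 1) ≤ ENNReal.ofReal (Real.exp Real.pi * M) := by
  have h1 : ∫ v, gauss 1 (v - u) ∂μ =
      ((∫ v, Real.exp (-(Real.pi * 1) * ‖v - u‖ ^ 2) ∂μ : ℝ) : ℂ) := integral_ofReal
  have hi2 : Integrable (fun v => Real.exp (-(Real.pi * 1) * ‖v - u‖ ^ 2)) μ := by
    refine hi.norm.congr (Eventually.of_forall fun v => ?_)
    exact norm_gauss _ _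
  rw [h1, Complex.norm_real] at h
  have hM := (le_abs_self _).trans h
  calc μ (closedBall u 1) = ∫⁻ v in closedBall u 1, 1 ∂μ := by simp
    _ ≤ ∫⁻ v in closedBall u 1, ENNReal.ofReal (Real.exp Real.pi *
        Real.exp (-(Real.pi * 1) * ‖v - u‖ ^ 2)) ∂μ := by
        refine setLIntegral_mono' measurableSet_closedBall fun v hv => ?_
        rw [mem_closedBall, dist_eq_norm] at hv
        rw [← ENNReal.ofReal_one]
        refine ENNReal.ofReal_le_ofReal ?_
        rw [← Real.exp_add, Real.one_le_exp_iff]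
        have := Real.pi_pos
        have h2 : ‖v - u‖ ^ 2 ≤ 1 := by
          have := norm_nonneg (v - u); nlinarith
        nlinarith
    _ ≤ ∫⁻ v, ENNReal.ofReal (Real.exp Real.pi *
        Real.exp (-(Real.pi * 1) * ‖v - u‖ ^ 2)) ∂μ := setLIntegral_le_lintegral _ _
    _ = ENNReal.ofReal (∫ v, Real.exp Real.pi *
        Real.exp (-(Real.pi * 1) * ‖v - u‖ ^ 2) ∂μ) := by
        rw [ofReal_integral_eq_lintegral_ofReal (hi2.const_mul _)
          (Eventually.of_forall fun v => by positivity)]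
    _ ≤ _ := by
        refine ENNReal.ofReal_le_ofReal ?_
        rw [integral_const_mul]
        gcongr

theorem hasPolyDecay_gauss_sub (u : V) : HasPolyDecay fun v : V => gauss 1 (v - u) :=
  (hasPolyDecay_gauss one_pos).comp_sub (fun _ => norm_nonneg _) u

theorem continuous_gauss_sub (u : V) : Continuous fun v : V => gauss 1 (v - u) :=
  (continuous_gauss 1).comp (continuous_id.sub continuous_const)

/-- The unit ball is tested with a Gaussian centred at `u`. On the side of `c` the regularizing
factor is at most `1` and the transform has modulus `exp(-π‖x‖²)`, so the bound depends neither on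
`ε` nor on `u`. -/
theorem gaussSpectral_closedBall_le {c : Measure V} (hc : IsTranslationBounded c)
    (hpos : IsGaussPosDef c) {ε : ℝ} (hε : 0 < ε) (u : V) :
    gaussSpectral c ε (closedBall u 1) ≤ ENNReal.ofReal (Real.exp Real.pi *
      ∫ x, Real.exp (-Real.pi * ‖x‖ ^ 2) ∂c) := by
  have hgc : Integrable (fun x : V => Real.exp (-Real.pi * ‖x‖ ^ 2)) c :=
    hc.integrable (by fun_prop) (hasPolyDecay_gaussian Real.pi_pos)
  have hgi : Integrable (fun v : V => gauss 1 (v - u)) :=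
    isTranslationBounded_volume.integrable (continuous_gauss_sub u).aestronglyMeasurable
      (hasPolyDecay_gauss_sub u)
  refine measure_closedBall_le_of_gauss u ?_ ?_
  · have hm : Measurable fun ξ => ENNReal.ofReal (gaussDensity c ε ξ).re :=
      (Complex.continuous_re.comp (continuous_gaussDensity hc hε)).measurable.ennreal_ofReal
    rw [gaussSpectral, integrable_withDensity_iff_integrable_smul' hm
      (Eventually.of_forall fun _ => ENNReal.ofReal_lt_top)]
    refine (hgi.bdd_mul (c := ∫ x, ‖gauss ε x‖ ∂c) (f := fun ξ => (gaussDensity c ε ξ))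
      (continuous_gaussDensity hc hε).aestronglyMeasurable
      (Eventually.of_forall fun ξ =>
        VectorFourier.norm_fourierIntegral_le_integral_norm _ _ _ _ _)).congr
      (Eventually.of_forall fun ξ => ?_)
    obtain ⟨r, hr, h⟩ := hpos ε hε ξ
    simp only [h, Complex.ofReal_re, ENNReal.toReal_ofReal hr, Complex.real_smul]
  · rw [integral_gaussSpectral hc hpos hε hgi]
    refine (norm_integral_le_integral_norm _).trans ?_
    refine integral_mono_of_nonneg (Eventually.of_forall fun x => norm_nonneg _) hgc
      (Eventually.of_forall fun x => ?_)
    simp only [norm_mul]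
    rw [norm_fourier_gauss_sub]
    exact mul_le_of_le_one_left (Real.exp_pos _).le (norm_gauss_le_one hε.le x)

end BochnerSchwartz

/-! ### Vague compactness and the Bochner–Schwartz theorem. -/

section BochnerSchwartz

open Metric
open scoped NNReal

variable {V : Type*} [NormedAddCommGroup V] [InnerProductSpace ℝ V] [FiniteDimensional ℝ V]
  [MeasurableSpace V] [BorelSpace V]

theorem tendsto_lintegral_polyWeight_tail :
    Tendsto (fun k : ℕ => ∫⁻ u in (closedBall (0 : V) k)ᶜ, ENNReal.ofReal (polyWeight u))
      atTop (𝓝 0) := by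
  have hm : Measurable fun x : V => ENNReal.ofReal (polyWeight x) :=
    continuous_polyWeight.measurable.ennreal_ofReal
  set τ : Measure V := volume.withDensity fun x => ENNReal.ofReal (polyWeight x)
  have hτ : τ univ ≠ ∞ := by
    rw [withDensity_apply _ MeasurableSet.univ, Measure.restrict_univ,
      ← ofReal_integral_eq_lintegral_ofReal integrable_polyWeight
      (Eventually.of_forall fun x => (polyWeight_pos x).le)]
    exact ENNReal.ofReal_ne_top
  have h := tendsto_measure_iInter_atTop (μ := τ) (s := fun k : ℕ => (closedBall (0 : V) k)ᶜ)
    (fun k => measurableSet_closedBall.compl.nullMeasurableSet)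
    (fun i j hij => compl_subset_compl.2 (closedBall_subset_closedBall (by exact_mod_cast hij)))
    ⟨0, ne_top_of_le_ne_top hτ (measure_mono (subset_univ _))⟩
  rw [← compl_iUnion, iUnion_closedBall_nat, compl_univ, measure_empty] at h
  refine h.congr fun k => ?_
  rw [Function.comp_apply, withDensity_apply _ measurableSet_closedBall.compl]

/-- Vague compactness of uniformly translation bounded measures, tested on continuous functions
with fast decay. -/
theorem exists_tendsto_integral_of_closedBall_le {μ : ℕ → Measure V} [∀ n, SFinite (μ n)]
    {C : ℝ≥0∞} (hCt : C ≠ ∞) (hC : ∀ n u, μ n (closedBall u 1) ≤ C) :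
    ∃ (𝒰 : Ultrafilter ℕ) (η : Measure V), ↑𝒰 ≤ (atTop : Filter ℕ) ∧
      Integrable polyWeight η ∧
      ∀ f : V → ℂ, Continuous f → HasPolyDecay f →
        Tendsto (fun n => ∫ x, f x ∂μ n) 𝒰 (𝓝 (∫ x, f x ∂η)) := by
  have hwm : Measurable fun x : V => ENNReal.ofReal (polyWeight x) :=
    continuous_polyWeight.measurable.ennreal_ofReal
  have hiwm : Measurable fun x : V => ENNReal.ofReal (polyWeight x)⁻¹ :=
    continuous_polyWeight.measurable.inv.ennreal_ofReal
  have hlt : ∀ a : V → ℝ, ∀ κ : Measure V, ∀ᵐ x ∂κ, ENNReal.ofReal (a x) < ∞ := fun a κ =>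
    Eventually.of_forall fun x => ENNReal.ofReal_lt_top
  have hfin : ∀ n, IsFiniteMeasure ((μ n).withDensity fun x => ENNReal.ofReal (polyWeight x)) :=
    fun n => ⟨by
      rw [withDensity_apply _ MeasurableSet.univ, Measure.restrict_univ]
      exact (lintegral_polyWeight_le (hC n)).trans_lt (polyWeightBound_ne_top hCt).lt_top⟩
  -- Weighted by `polyWeight`, the measures have uniformly bounded mass and uniformly small tails,
  -- so Prokhorov's theorem applies. Dividing the weak limit by the weight gives `η`.
  let ν : ℕ → FiniteMeasure V := fun n =>
    ⟨(μ n).withDensity fun x => ENNReal.ofReal (polyWeight x), hfin n⟩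
  let D : ℝ≥0∞ := (volume (closedBall (0 : V) 1))⁻¹ * C *
        ENNReal.ofReal (2⁻¹ ^ (-((Module.finrank ℝ V + 1 : ℕ) : ℝ)))
  have hD : D ≠ ∞ := ENNReal.mul_ne_top (ENNReal.mul_ne_top (ENNReal.inv_ne_top.2
    (measure_closedBall_pos _ _ one_pos).ne') hCt) ENNReal.ofReal_ne_top
  let t : ℕ → ℝ≥0∞ := fun k =>
    D * ∫⁻ u in (closedBall (0 : V) k)ᶜ, ENNReal.ofReal (polyWeight u)
  have ht0 : Tendsto t atTop (𝓝 0) := by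
    have := ENNReal.Tendsto.const_mul (a := D) (tendsto_lintegral_polyWeight_tail (V := V))
      (Or.inr hD)
    rwa [mul_zero] at this
  have hwt : (∫⁻ u : V, ENNReal.ofReal (polyWeight u)) ≠ ∞ := by
    rw [← ofReal_integral_eq_lintegral_ofReal integrable_polyWeight
      (Eventually.of_forall fun x => (polyWeight_pos x).le)]
    exact ENNReal.ofReal_ne_top
  have htt : ∀ k, t k ≠ ∞ := fun k => ENNReal.mul_ne_top hD
    (ne_top_of_le_ne_top hwt (setLIntegral_le_lintegral _ _))
  have hcomp := isCompact_setOfPred_finiteMeasure_mass_le_compl_isCompact_le (E := V)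
    (u := fun k => (t k).toNNReal) (K := fun k => closedBall (0 : V) (k + 1))
    (polyWeightBound V C).toNNReal ((ENNReal.tendsto_toNNReal ENNReal.zero_ne_top).comp ht0)
    (fun k => isCompact_closedBall _ _) (Or.inl inferInstance)
  have hmem : ∀ n, ν n ∈ {μ : FiniteMeasure V | μ.mass ≤ (polyWeightBound V C).toNNReal ∧
      ∀ k : ℕ, μ (closedBall (0 : V) (k + 1))ᶜ ≤ (t k).toNNReal} := by
    intro n
    constructor
    · rw [← ENNReal.coe_le_coe, FiniteMeasure.ennreal_mass,
        ENNReal.coe_toNNReal (polyWeightBound_ne_top hCt)]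
      change (μ n).withDensity _ univ ≤ _
      rw [withDensity_apply _ MeasurableSet.univ, Measure.restrict_univ]
      exact lintegral_polyWeight_le (hC n)
    · intro k
      rw [← ENNReal.coe_le_coe, FiniteMeasure.ennreal_coeFn_eq_coeFn_toMeasure,
        ENNReal.coe_toNNReal (htt k)]
      change (μ n).withDensity _ _ ≤ _
      rw [withDensity_apply _ measurableSet_closedBall.compl]
      refine (lintegral_polyWeight_tail_le (hC n) k).trans (le_of_eq ?_)
      simp only [t, D]
      ring
  -- Convergence along one ultrafilter finer than `atTop` is enough: it will only be compared with
  -- limits known to exist.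
  let 𝒰 : Ultrafilter ℕ := hyperfilter ℕ
  obtain ⟨ν', -, hν'⟩ := hcomp.ultrafilter_le_nhds (𝒰.map ν)
    (by
      rw [le_principal_iff]
      exact Filter.mem_map.2 (Eventually.of_forall hmem))
  have hlim : Tendsto ν 𝒰 (𝓝 ν') := hν'
  let η : Measure V := (ν' : Measure V).withDensity fun x => ENNReal.ofReal (polyWeight x)⁻¹
  refine ⟨𝒰, η, Nat.hyperfilter_le_atTop, ?_, fun f hf hd => ?_⟩
  · rw [integrable_withDensity_iff_integrable_smul' hiwm (hlt _ _)]
    refine (integrable_const (1 : ℝ)).congr (Eventually.of_forall fun x => ?_)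
    have := polyWeight_pos x
    simp only [smul_eq_mul]
    rw [ENNReal.toReal_ofReal (by positivity), inv_mul_cancel₀ this.ne']
  · obtain ⟨K, hK⟩ := hd
    let g : BoundedContinuousFunction V ℂ := BoundedContinuousFunction.ofNormedAddCommGroup
      (fun x => (polyWeight x)⁻¹ • f x)
      ((continuous_polyWeight.inv₀ fun x => (polyWeight_pos x).ne').smul hf) K (fun x => by
        have := polyWeight_pos x
        rw [norm_smul, norm_inv, Real.norm_of_nonneg this.le, inv_mul_le_iff₀ this, mul_comm]
        exact hK x)
    have h1 := (FiniteMeasure.tendsto_iff_forall_integral_rclike_tendsto ℂ).1 hlim g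
    have h2 : ∫ x, f x ∂η = ∫ x, g x ∂(ν' : Measure V) := by
      rw [integral_withDensity_eq_integral_toReal_smul hiwm (hlt _ _)]
      refine integral_congr_ae (Eventually.of_forall fun x => ?_)
      have := polyWeight_pos x
      simp only
      rw [ENNReal.toReal_ofReal (by positivity)]
      rfl
    have h3 : ∀ n, ∫ x, f x ∂μ n = ∫ x, g x ∂(ν n : Measure V) := by
      intro n
      change _ = ∫ x, g x ∂(μ n).withDensity fun x => ENNReal.ofReal (polyWeight x)
      rw [integral_withDensity_eq_integral_toReal_smul hwm (hlt _ _)]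
      refine integral_congr_ae (Eventually.of_forall fun x => ?_)
      have := polyWeight_pos x
      change f x = (ENNReal.ofReal (polyWeight x)).toReal • ((polyWeight x)⁻¹ • f x)
      rw [ENNReal.toReal_ofReal this.le, smul_smul, mul_inv_cancel₀ this.ne', one_smul]
    simp_rw [h2, h3]
    exact h1

/-- **Bochner–Schwartz theorem** for translation bounded measures: a positive definite one is the
Fourier transform of a translation bounded measure. -/
theorem exists_fourier_of_isGaussPosDef {c : Measure V} (hc : IsTranslationBounded c)
    (hpos : IsGaussPosDef c) :
    ∃ η : Measure V, IsTranslationBounded η ∧ ∀ f : V → ℂ, Continuous f → HasPolyDecay f →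
      HasPolyDecay (𝓕 f) → ∫ x, 𝓕 f x ∂c = ∫ x, f x ∂η := by
  have hlf := hc.isLocallyFiniteMeasure
  have hε : ∀ n : ℕ, (0 : ℝ) < 1 / ((n : ℝ) + 1) := fun n => by positivity
  have hsf : ∀ n : ℕ, SFinite (gaussSpectral c (1 / ((n : ℝ) + 1))) := fun n => by
    unfold gaussSpectral; infer_instance
  obtain ⟨𝒰, η, h𝒰, hη, hlim⟩ := exists_tendsto_integral_of_closedBall_le
    (μ := fun n : ℕ => gaussSpectral c (1 / ((n : ℝ) + 1))) ENNReal.ofReal_ne_top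
    (fun n u => gaussSpectral_closedBall_le hc hpos (hε n) u)
  have key : ∀ f : V → ℂ, Continuous f → HasPolyDecay f →
      HasPolyDecay (𝓕 f) → ∫ x, 𝓕 f x ∂c = ∫ x, f x ∂η := by
    intro f hf hd hFd
    have hfi : Integrable f := isTranslationBounded_volume.integrable hf.aestronglyMeasurable hd
    have hFc : Continuous (𝓕 f) := VectorFourier.fourierIntegral_continuous
      Real.continuous_fourierChar continuous_inner_pair hfi
    have hFi : Integrable (𝓕 f) c := hc.integrable hFc.aestronglyMeasurable hFd
    have h1 := hlim f hf hd
    simp_rw [fun n : ℕ => integral_gaussSpectral hc hpos (hε n) hfi] at h1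
    have h2 : Tendsto (fun n : ℕ => ∫ x, gauss (1 / ((n : ℝ) + 1)) x * 𝓕 f x ∂c) atTop
        (𝓝 (∫ x, 𝓕 f x ∂c)) := by
      refine tendsto_integral_of_dominated_convergence (fun x => ‖𝓕 f x‖)
        (fun n => ((continuous_gauss _).mul hFc).aestronglyMeasurable) hFi.norm
        (fun n => Eventually.of_forall fun x => ?_) (Eventually.of_forall fun x => ?_)
      · rw [norm_mul]
        exact mul_le_of_le_one_left (norm_nonneg _) (norm_gauss_le_one (hε n).le x)
      · have h3 : Tendsto (fun n : ℕ => gauss (1 / ((n : ℝ) + 1)) x) atTop (𝓝 (gauss 0 x)) := by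
          have hcont : Continuous fun ε : ℝ => gauss ε x := by unfold gauss; fun_prop
          exact (hcont.tendsto 0).comp tendsto_one_div_add_atTop_nhds_zero_nat
        have h4 : gauss 0 x = 1 := by simp [gauss]
        rw [h4] at h3
        simpa using h3.mul_const (𝓕 f x)
    exact tendsto_nhds_unique (h2.mono_left h𝒰) h1
  -- The bound for `η` is read off from the duality `key` itself, applied to translated Gaussians.
  refine ⟨η, ⟨ENNReal.ofReal (Real.exp Real.pi * ∫ x, Real.exp (-Real.pi * ‖x‖ ^ 2) ∂c),
    ENNReal.ofReal_ne_top, fun u => ?_⟩, key⟩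
  obtain ⟨K, hK⟩ := hasPolyDecay_gauss_sub u
  have hgF : HasPolyDecay (𝓕 fun v : V => gauss 1 (v - u)) := by
    obtain ⟨K, hK⟩ := hasPolyDecay_gaussian (V := V) Real.pi_pos
    refine ⟨K, fun x => ?_⟩
    rw [norm_fourier_gauss_sub]
    exact (le_abs_self _).trans (hK x)
  refine measure_closedBall_le_of_gauss u ?_ ?_
  · exact (hη.const_mul K).mono' (continuous_gauss_sub u).aestronglyMeasurable
      (Eventually.of_forall hK)
  · rw [← key _ (continuous_gauss_sub u) (hasPolyDecay_gauss_sub u) hgF]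
    refine (norm_integral_le_integral_norm _).trans (le_of_eq ?_)
    exact integral_congr_ae (Eventually.of_forall fun x => norm_fourier_gauss_sub u x)

end BochnerSchwartz

/-! ### Positive definiteness of the Palm intensity. -/

namespace Config

open ProbabilityTheory Metric

variable {V : Type*} [NormedAddCommGroup V] [InnerProductSpace ℝ V] [FiniteDimensional ℝ V]
  [MeasurableSpace V] [BorelSpace V] {m : Measure (Config V)}

theorem secondMoment_eq_map [IsProbabilityMeasure m] (hstat : IsStationaryLaw m)
    (hsq : IsSquareIntegrable m) {B : Set V} (hB : MeasurableSet B) (hB0 : volume B ≠ 0)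
    (hBt : volume B ≠ ∞) :
    secondMoment m = (volume.prod (intensity (palm m B hB))).map fun p => (p.1, p.1 + p.2) := by
  rw [← (diffMoment_eq_prod hstat hsq hB hB0 hBt).2, diffMoment,
    Measure.map_map (by fun_prop) (by fun_prop)]
  simp [Function.comp_def]

/-- The integral is the expectation of the squared modulus of the sum of `h` over the configuration.
-/
theorem integral_secondMoment_mul_conj [IsProbabilityMeasure m] {h : V → ℂ}
    (hi : Integrable (fun p : V × V => h p.2 * (starRingEnd ℂ) (h p.1)) (secondMoment m)) :
    ∃ r : ℝ, 0 ≤ r ∧ ∫ p, h p.2 * (starRingEnd ℂ) (h p.1) ∂secondMoment m = r := by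
  refine ⟨∫ φ, ‖∫ x, h x ∂counting φ‖ ^ 2 ∂m, integral_nonneg fun φ => by positivity, ?_⟩
  rw [secondMoment, Measure.comp_eq_comp_const_apply] at hi ⊢
  rw [Kernel.integral_comp hi, ← integral_complex_ofReal, Kernel.const_apply]
  refine integral_congr_ae (Eventually.of_forall fun φ => ?_)
  simp only [Kernel.prod_apply, countingKernel_apply]
  have h1 : ∀ p : V × V, h p.2 * (starRingEnd ℂ) (h p.1) = (starRingEnd ℂ) (h p.1) * h p.2 :=
    fun p => mul_comm _ _
  simp_rw [h1]
  rw [integral_prod_mul (fun x => (starRingEnd ℂ) (h x)) h, integral_conj, mul_comm,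
    Complex.mul_conj']
  push_cast
  rfl

/-- The parallelogram identity `2‖x + z‖² + 2‖x‖² = 4‖x + z/2‖² + ‖z‖²`. The first factor on the
right becomes independent of `z` once integrated over `x`. -/
theorem gauss_mul_gauss (ε : ℝ) (x z : V) :
    gauss (2 * ε) (x + z) * gauss (2 * ε) x =
      gauss (4 * ε) (x + (2⁻¹ : ℝ) • z) * gauss ε z := by
  simp only [gauss]
  rw [← Complex.ofReal_mul, ← Complex.ofReal_mul, ← Real.exp_add, ← Real.exp_add]
  congr 2
  rw [norm_add_sq_real, norm_add_sq_real, norm_smul, inner_smul_right]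
  norm_num
  ring

theorem norm_gauss_mul_gauss_le {ε : ℝ} (hε : 0 < ε) (x z : V) :
    ‖gauss (2 * ε) (x + z) * gauss (2 * ε) x‖ ≤ ‖gauss ε x‖ * ‖gauss (ε / 2) z‖ := by
  rw [norm_mul]
  simp only [norm_gauss]
  rw [← Real.exp_add, ← Real.exp_add]
  refine Real.exp_le_exp.2 ?_
  have h1 : ‖z‖ ^ 2 ≤ 2 * ‖x + z‖ ^ 2 + 2 * ‖x‖ ^ 2 := by
    have h2 : ‖z‖ ≤ ‖x + z‖ + ‖x‖ := by
      have := norm_sub_le (x + z) x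
      simpa using this
    have h3 := norm_nonneg z
    nlinarith [sq_nonneg (‖x + z‖ - ‖x‖), norm_nonneg (x + z), norm_nonneg x]
  have hpe : 0 < Real.pi * ε := mul_pos Real.pi_pos hε
  have h4 : Real.pi * ε * ‖z‖ ^ 2 ≤ Real.pi * ε * (2 * ‖x + z‖ ^ 2 + 2 * ‖x‖ ^ 2) := by gcongr
  have h5 : 0 ≤ Real.pi * ε * ‖x + z‖ ^ 2 := by positivity
  nlinarith

/-- Let `h` be `gauss (2 * ε)` times the character of frequency `ξ`. By the parallelogram identity,
`h(x + z) conj h(x)` is a Gaussian in `x + z/2` times the integrand of `gaussDensity c ε ξ` at `z`.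
Integrating over Lebesgue measure in `x` leaves a positive constant `κ`, so the nonnegative number
`E |∑ h|²` equals `κ` times `gaussDensity c ε ξ`. -/
theorem isGaussPosDef_intensity [IsProbabilityMeasure m] (hstat : IsStationaryLaw m)
    (hsq : IsSquareIntegrable m) {B : Set V} (hB : MeasurableSet B) (hB0 : volume B ≠ 0)
    (hBt : volume B ≠ ∞) : IsGaussPosDef (intensity (palm m B hB)) := by
  have hc := isTranslationBounded_intensity hstat hsq hB hB0 hBt
  have hM := secondMoment_eq_map hstat hsq hB hB0 hBt
  set c := intensity (palm m B hB)
  have := hc.isLocallyFiniteMeasure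
  intro ε hε ξ
  have hgi : ∀ {δ : ℝ}, 0 < δ → ∀ {κ : Measure V}, IsTranslationBounded κ →
      Integrable (gauss δ : V → ℂ) κ := fun hδ κ hκ =>
    hκ.integrable (continuous_gauss _).aestronglyMeasurable (hasPolyDecay_gauss hδ)
  let h : V → ℂ := fun x => gauss (2 * ε) x * (Real.fourierChar (-inner ℝ x ξ) : ℂ)
  have hcont : Continuous h := (continuous_gauss _).mul
    (continuous_subtype_val.comp (Real.continuous_fourierChar.comp
      (continuous_id.inner continuous_const).neg))
  have hh : ∀ x z : V, h (x + z) * (starRingEnd ℂ) (h x) =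
      gauss (4 * ε) (x + (2⁻¹ : ℝ) • z) *
        ((Real.fourierChar (-inner ℝ z ξ) : ℂ) * gauss ε z) := by
    intro x z
    have h1 : (starRingEnd ℂ) (gauss (2 * ε) x) = gauss (2 * ε) x := Complex.conj_ofReal _
    have h2 : (Real.fourierChar (-inner ℝ (x + z) ξ) : ℂ) *
        (starRingEnd ℂ) (Real.fourierChar (-inner ℝ x ξ) : ℂ) =
        (Real.fourierChar (-inner ℝ z ξ) : ℂ) := by
      rw [← Circle.coe_inv_eq_conj, ← Circle.coe_mul, ← AddChar.map_neg_eq_inv,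
        ← AddChar.map_add_eq_mul, inner_add_left]
      congr 2
      ring
    simp only [h, map_mul, h1]
    calc _ = (gauss (2 * ε) (x + z) * gauss (2 * ε) x) *
          ((Real.fourierChar (-inner ℝ (x + z) ξ) : ℂ) *
          (starRingEnd ℂ) (Real.fourierChar (-inner ℝ x ξ) : ℂ)) := by ring
      _ = _ := by rw [h2, gauss_mul_gauss]; ring
  have hnorm : ∀ x z : V, ‖h (x + z) * (starRingEnd ℂ) (h x)‖ ≤
      ‖gauss ε x‖ * ‖gauss (ε / 2) z‖ := by
    intro x z
    refine le_trans (le_of_eq ?_) (norm_gauss_mul_gauss_le hε x z)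
    simp only [h, norm_mul, RCLike.norm_conj, Circle.norm_coe, mul_one]
  have hmeas : Measurable fun p : V × V => (p.1, p.1 + p.2) := by fun_prop
  have hGc : Continuous fun p : V × V => h p.2 * (starRingEnd ℂ) (h p.1) :=
    (hcont.comp continuous_snd).mul (Complex.continuous_conj.comp (hcont.comp continuous_fst))
  have hGi : Integrable (fun p : V × V => h (p.1 + p.2) * (starRingEnd ℂ) (h p.1))
      (volume.prod c) := by
    refine ((hgi hε isTranslationBounded_volume).norm.mul_prod
      (hgi (half_pos hε) hc).norm).mono' ?_ (Eventually.of_forall fun p => hnorm p.1 p.2)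
    exact (hGc.comp (continuous_fst.prodMk (continuous_fst.add continuous_snd))).aestronglyMeasurable
  obtain ⟨r, hr, hrr⟩ := integral_secondMoment_mul_conj (m := m) (h := h) (by
    rw [hM, integrable_map_measure hGc.aestronglyMeasurable hmeas.aemeasurable]
    exact hGi)
  rw [hM, integral_map hmeas.aemeasurable hGc.aestronglyMeasurable] at hrr
  simp only at hrr
  rw [integral_prod_symm _ hGi] at hrr
  simp only [hh] at hrr
  set κ : ℝ := ∫ x : V, Real.exp (-(Real.pi * (4 * ε)) * ‖x‖ ^ 2) with hκ
  have hκpos : 0 < κ := by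
    refine integral_exp_pos ?_
    refine (hgi (δ := 4 * ε) (by positivity) isTranslationBounded_volume).norm.congr
      (Eventually.of_forall fun x => norm_gauss _ _)
  have hinner : ∀ z : V, ∫ x : V, gauss (4 * ε) (x + (2⁻¹ : ℝ) • z) *
        ((Real.fourierChar (-inner ℝ z ξ) : ℂ) * gauss ε z) =
      (κ : ℂ) * ((Real.fourierChar (-inner ℝ z ξ) : ℂ) * gauss ε z) := by
    intro z
    rw [integral_mul_const, integral_add_right_eq_self (fun x : V => gauss (4 * ε) x)]
    congr 1
    exact integral_ofReal
  simp_rw [hinner] at hrr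
  rw [integral_const_mul] at hrr
  have hrr' : (κ : ℂ) * gaussDensity c ε ξ = r := hrr
  refine ⟨r / κ, by positivity, ?_⟩
  have hκ0 : (κ : ℂ) ≠ 0 := by exact_mod_cast hκpos.ne'
  rw [Complex.ofReal_div, eq_div_iff hκ0, mul_comm, hrr']

end Config

/-! ### Polynomial decay of Schwartz functions. -/

section Schwartz

variable {V : Type*} [NormedAddCommGroup V] [InnerProductSpace ℝ V] [FiniteDimensional ℝ V]
  [MeasurableSpace V] [BorelSpace V]

theorem SchwartzMap.hasPolyDecay (f : 𝓢(V, ℂ)) : HasPolyDecay (f : V → ℂ) := by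
  obtain ⟨C₀, h₀⟩ := f.decay' 0 0
  obtain ⟨C₁, h₁⟩ := f.decay' (Module.finrank ℝ V + 1) 0
  refine ⟨2 ^ (Module.finrank ℝ V + 1) * (C₀ + C₁), fun x => ?_⟩
  have h0 := h₀ x
  have h1 := h₁ x
  simp only [norm_iteratedFDeriv_zero, pow_zero, one_mul] at h0 h1
  change ‖f x‖ ≤ C₀ at h0
  change ‖x‖ ^ (Module.finrank ℝ V + 1) * ‖f x‖ ≤ C₁ at h1
  rw [polyWeight, Real.rpow_neg (by positivity), Real.rpow_natCast, ← div_eq_mul_inv,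
    le_div_iff₀ (by positivity)]
  have h2 : (1 + ‖x‖) ^ (Module.finrank ℝ V + 1) ≤
      2 ^ (Module.finrank ℝ V + 1) * (1 + ‖x‖ ^ (Module.finrank ℝ V + 1)) := by
    rcases le_total ‖x‖ 1 with hx | hx
    · calc (1 + ‖x‖) ^ (Module.finrank ℝ V + 1) ≤ 2 ^ (Module.finrank ℝ V + 1) := by
            gcongr; linarith
        _ ≤ _ := le_mul_of_one_le_right (by positivity) (le_add_of_nonneg_right (by positivity))
    · calc (1 + ‖x‖) ^ (Module.finrank ℝ V + 1) ≤ (2 * ‖x‖) ^ (Module.finrank ℝ V + 1) := by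
            gcongr; linarith
        _ ≤ _ := by
            rw [mul_pow]
            gcongr
            linarith
  calc ‖f x‖ * (1 + ‖x‖) ^ (Module.finrank ℝ V + 1) ≤ ‖f x‖ *
        (2 ^ (Module.finrank ℝ V + 1) * (1 + ‖x‖ ^ (Module.finrank ℝ V + 1))) := by gcongr
    _ = 2 ^ (Module.finrank ℝ V + 1) * (‖f x‖ + ‖x‖ ^ (Module.finrank ℝ V + 1) * ‖f x‖) := by
        ring
    _ ≤ _ := by gcongr

end Schwartz

/-! ### The splitting of Lebesgue measure along `E ⊕ F`, and the window function. -/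

section Decomposition

open Metric

variable {V : Type*} [NormedAddCommGroup V] [InnerProductSpace ℝ V] [FiniteDimensional ℝ V]
  {E F : Submodule ℝ V}

/-- The isomorphism `(e, f) ↦ e + f` from `E × F` to `V = E ⊕ F`. -/
def complSumEquiv (h : IsCompl E F) : (E × F) ≃L[ℝ] V :=
  (Submodule.prodEquivOfIsCompl E F h).toContinuousLinearEquiv

theorem complSumEquiv_apply (h : IsCompl E F) (p : E × F) : complSumEquiv h p = (p.1 : V) + p.2 :=
  Submodule.coe_prodEquivOfIsCompl' E F h p

theorem projectionOnto_complSumEquiv_left (h : IsCompl E F) (p : E × F) :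
    E.projectionOnto F h (complSumEquiv h p) = p.1 := by
  rw [complSumEquiv_apply, map_add, Submodule.projectionOnto_apply_left,
    Submodule.projectionOnto_apply_right, add_zero]

theorem projectionOnto_complSumEquiv_right (h : IsCompl E F) (p : E × F) :
    F.projectionOnto E h.symm (complSumEquiv h p) = p.2 := by
  rw [complSumEquiv_apply, map_add, Submodule.projectionOnto_apply_right,
    Submodule.projectionOnto_apply_left, zero_add]

theorem continuous_projectionOnto (h : IsCompl E F) : Continuous (E.projectionOnto F h) :=
  LinearMap.continuous_of_finiteDimensional _

theorem norm_le_projectionOnto (h : IsCompl E F) (x : V) :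
    ‖x‖ ≤ ‖E.projectionOnto F h x‖ + ‖F.projectionOnto E h.symm x‖ := by
  have h3 : (E.projectionOnto F h x : V) + (F.projectionOnto E h.symm x : V) = x := by
    simp only [Submodule.coe_projectionOnto_apply]
    exact Submodule.projection_add_projection_eq_self h x
  calc ‖x‖ = ‖(E.projectionOnto F h x : V) + (F.projectionOnto E h.symm x : V)‖ := by rw [h3]
    _ ≤ _ := norm_add_le _ _

variable [MeasurableSpace V] [BorelSpace V]

/-- Both sides are Haar measures, hence proportional. The ratio is found on `C_E + C_F`, which has
mass `1` for the product measure. -/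
theorem exists_volume_eq_smul_map (h : IsCompl E F) {CE : Set E} (hCE1 : volume CE = 1)
    {CF : Set F} (hCF1 : volume CF = 1) {α : ℝ≥0∞}
    (hα : α = volume (Subtype.val '' CE + Subtype.val '' CF : Set V)) :
    α ≠ 0 ∧ α ≠ ∞ ∧ (volume : Measure V) =
      α • (volume.prod volume : Measure (E × F)).map (complSumEquiv h) := by
  set ρ : Measure V := (volume.prod volume : Measure (E × F)).map (complSumEquiv h)
  have hρ : ρ.IsAddHaarMeasure := (complSumEquiv h).isAddHaarMeasure_map _
  have hv : (volume : Measure V) = (volume : Measure V).addHaarScalarFactor ρ • ρ :=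
    Measure.isAddLeftInvariant_eq_smul _ _
  have hpos := Measure.addHaarScalarFactor_pos_of_isAddHaarMeasure (volume : Measure V) ρ
  have hset : (Subtype.val '' CE + Subtype.val '' CF : Set V) = complSumEquiv h '' (CE ×ˢ CF) := by
    ext x
    simp only [Set.mem_add, mem_image, mem_prod, Prod.exists, complSumEquiv_apply]
    constructor
    · rintro ⟨_, ⟨e, he, rfl⟩, _, ⟨f, hf, rfl⟩, rfl⟩
      exact ⟨e, f, ⟨he, hf⟩, rfl⟩
    · rintro ⟨e, f, ⟨he, hf⟩, rfl⟩
      exact ⟨_, ⟨e, he, rfl⟩, _, ⟨f, hf, rfl⟩, rfl⟩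
  have hα2 : α = ((volume : Measure V).addHaarScalarFactor ρ : ℝ≥0∞) := by
    have hρ1 : ρ (complSumEquiv h '' (CE ×ˢ CF)) = 1 := by
      have hme : MeasurableEmbedding (complSumEquiv h) :=
        (complSumEquiv h).toHomeomorph.measurableEmbedding
      rw [hme.map_apply, preimage_image_eq _ (complSumEquiv h).injective, Measure.prod_prod, hCE1, hCF1,
        one_mul]
    rw [hα, hset]
    conv_lhs => rw [hv]
    rw [Measure.smul_apply, hρ1]
    simp [ENNReal.smul_def]
  refine ⟨?_, ?_, ?_⟩
  · rw [hα2]; exact_mod_cast hpos.ne'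
  · rw [hα2]; exact ENNReal.coe_ne_top
  · rw [hα2]; exact hv

theorem lintegral_eq_complSumEquiv {h : IsCompl E F} {α : ℝ≥0∞} (hv : (volume : Measure V) =
      α • (volume.prod volume : Measure (E × F)).map (complSumEquiv h)) {g : V → ℝ≥0∞}
    (hg : Measurable g) :
    ∫⁻ x, g x = α * ∫⁻ e : E, ∫⁻ f : F, g (complSumEquiv h (e, f)) := by
  have hm : Measurable (complSumEquiv h) := (complSumEquiv h).continuous.measurable
  have hgm : Measurable fun p : E × F => g (complSumEquiv h p) := hg.comp hm
  rw [hv, lintegral_smul_measure, lintegral_map hg hm, lintegral_prod _ hgm.aemeasurable,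
    smul_eq_mul]

variable {W : Set F}

/-- The substitution `u ↦ u + z` in the convolution. Bounds, support, evenness and continuity of `ψ`
are all read from this form. -/
theorem windowAutocorr_eq (hWm : MeasurableSet W) (z : F) :
    windowAutocorr W z = volume.real (W ∩ (fun u => u + z) ⁻¹' W) := by
  have hm : MeasurableSet (W ∩ (fun u => u + z) ⁻¹' W) :=
    hWm.inter ((measurable_add_const z) hWm)
  rw [windowAutocorr, convolution_def, ← integral_indicator_one hm,
    ← integral_add_right_eq_self _ z]
  refine integral_congr_ae (Eventually.of_forall fun u => ?_)
  by_cases h1 : u ∈ W <;> by_cases h2 : u + z ∈ W <;> simp [h1, h2]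

theorem ofReal_windowAutocorr (hWm : MeasurableSet W) (hWb : Bornology.IsBounded W) (z : F) :
    ENNReal.ofReal (windowAutocorr W z) = volume (W ∩ (fun u => u + z) ⁻¹' W) := by
  rw [windowAutocorr_eq hWm, ofReal_measureReal (hWb.subset inter_subset_left).measure_lt_top.ne]

theorem windowAutocorr_nonneg (hWm : MeasurableSet W) (z : F) : 0 ≤ windowAutocorr W z := by
  rw [windowAutocorr_eq hWm]; exact measureReal_nonneg

theorem windowAutocorr_le (hWm : MeasurableSet W) (hWb : Bornology.IsBounded W) (z : F) :
    windowAutocorr W z ≤ volume.real W := by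
  rw [windowAutocorr_eq hWm]
  exact measureReal_mono inter_subset_left hWb.measure_lt_top.ne

theorem exists_windowAutocorr_eq_zero (hWm : MeasurableSet W) (hWb : Bornology.IsBounded W) :
    ∃ r : ℝ, 0 ≤ r ∧ ∀ z : F, r < ‖z‖ → windowAutocorr W z = 0 := by
  obtain ⟨C, hC⟩ := hWb.exists_norm_le
  refine ⟨|C| + |C|, by positivity, fun z hz => ?_⟩
  have : W ∩ (fun u => u + z) ⁻¹' W = ∅ := by
    ext u
    simp only [mem_inter_iff, mem_preimage, mem_empty_iff_false, iff_false, not_and]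
    intro h1 h2
    have h3 := (hC _ h1).trans (le_abs_self C)
    have h4 := (hC _ h2).trans (le_abs_self C)
    have h5 := norm_sub_le (u + z) u
    rw [add_sub_cancel_left] at h5
    linarith
  rw [windowAutocorr_eq hWm, this, measureReal_empty]

theorem measurable_windowAutocorr (hWm : MeasurableSet W) :
    Measurable (windowAutocorr W) := by
  have hS : MeasurableSet {p : F × F | p.2 ∈ W ∧ p.2 + p.1 ∈ W} :=
    (measurable_snd hWm).inter ((measurable_snd.add measurable_fst) hWm)
  rw [funext (windowAutocorr_eq hWm)]
  exact (measurable_measure_prodMk_left (ν := (volume : Measure F)) hS).ennreal_toReal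

end Decomposition

/-! ### Sums over pairs of points in the strip, and their mean. -/

section PairSums

open Metric Config ProbabilityTheory

variable {V : Type*} [NormedAddCommGroup V] [InnerProductSpace ℝ V] [FiniteDimensional ℝ V]
  {E F : Submodule ℝ V} [MeasurableSpace V] [BorelSpace V]

theorem measurableSet_strip (h : IsCompl E F) {W : Set F} (hW : MeasurableSet W) :
    MeasurableSet (strip h W) :=
  (continuous_projectionOnto h.symm).measurable hW

theorem mem_strip {h : IsCompl E F} {W : Set F} {x : V} :
    x ∈ strip h W ↔ F.projectionOnto E h.symm x ∈ W := Iff.rfl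

theorem sub_mem_strip {h : IsCompl E F} {W : Set F} {x : V} (t : E) :
    x - t ∈ strip h W ↔ x ∈ strip h W := by
  rw [mem_strip, mem_strip, map_sub, Submodule.projectionOnto_apply_right, sub_zero]

/-- The sum of `f (y_E - x_E)` over the points `y` of `φ` in the strip. -/
def pairWeight (h : IsCompl E F) (W : Set F) (f : E → ℝ≥0∞) (φ : Config V) (x : V) : ℝ≥0∞ :=
  ∫⁻ y, (strip h W).indicator
    (fun y => f (E.projectionOnto F h y - E.projectionOnto F h x)) y ∂counting φ

/-- The sum of `f (y_E - x_E)` over the points `x`, `y` of `φ` in the strip with `x_E ∈ A`. -/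
def pairSum (h : IsCompl E F) (W : Set F) (f : E → ℝ≥0∞) (A : Set E) (φ : Config V) : ℝ≥0∞ :=
  ∫⁻ x, (strip h W ∩ E.projectionOnto F h ⁻¹' A).indicator (pairWeight h W f φ) x ∂counting φ

variable {h : IsCompl E F} {W : Set F} {f : E → ℝ≥0∞}

theorem measurable_pairWeight (hW : MeasurableSet W) (hf : Measurable f) :
    Measurable fun q : Config V × V => pairWeight h W f q.1 q.2 := by
  have hE := (continuous_projectionOnto h).measurable
  have hg : Measurable fun p : (Config V × V) × V => (strip h W).indicator
      (fun y => f (E.projectionOnto F h y - E.projectionOnto F h p.1.2)) p.2 := by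
    have h1 : Measurable fun p : (Config V × V) × V =>
        f (E.projectionOnto F h p.2 - E.projectionOnto F h p.1.2) :=
      hf.comp ((hE.comp measurable_snd).sub (hE.comp (measurable_snd.comp measurable_fst)))
    exact h1.indicator (measurable_snd (measurableSet_strip h hW))
  exact Measurable.lintegral_kernel_prod_right
    (κ := (countingKernel V).comap Prod.fst (measurable_fst (α := Config V) (β := V)))
    (f := fun q y => (strip h W).indicator
      (fun y => f (E.projectionOnto F h y - E.projectionOnto F h q.2)) y) hg

theorem measurableSet_strip_inter (hW : MeasurableSet W) {A : Set E} (hA : MeasurableSet A) :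
    MeasurableSet (strip h W ∩ E.projectionOnto F h ⁻¹' A) :=
  (measurableSet_strip h hW).inter ((continuous_projectionOnto h).measurable hA)

theorem measurable_pairSum (hW : MeasurableSet W) (hf : Measurable f) {A : Set E}
    (hA : MeasurableSet A) : Measurable (pairSum h W f A) :=
  measurable_lintegral_counting
    (F := fun q => (strip h W ∩ E.projectionOnto F h ⁻¹' A).indicator (pairWeight h W f q.1) q.2)
    ((measurable_pairWeight hW hf).indicator
      (measurable_snd (measurableSet_strip_inter hW hA)))

theorem pairWeight_translate (hW : MeasurableSet W) (hf : Measurable f) (φ : Config V) (t : E)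
    (x : V) : pairWeight h W f (translate (t : V) φ) (x - t) = pairWeight h W f φ x := by
  have hE := (continuous_projectionOnto h).measurable
  rw [pairWeight, lintegral_counting_translate]
  · refine lintegral_congr fun y => ?_
    by_cases hy : y ∈ strip h W
    · rw [indicator_of_mem hy, indicator_of_mem ((sub_mem_strip t).2 hy), map_sub, map_sub]
      congr 1
      abel
    · rw [indicator_of_notMem hy, indicator_of_notMem (fun hy' => hy ((sub_mem_strip t).1 hy'))]
  · exact (hf.comp (hE.sub_const _)).indicator (measurableSet_strip h hW)

/-- Vectors of `E` preserve the strip and the differences, so only the condition `x_E ∈ A` moves.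
This makes the pair sums additive along the flow. -/
theorem pairSum_translate (hW : MeasurableSet W) (hf : Measurable f) {A : Set E}
    (hA : MeasurableSet A) (φ : Config V) (t : E) :
    pairSum h W f A (translate (t : V) φ) = pairSum h W f ((fun e => e - t) ⁻¹' A) φ := by
  rw [pairSum, lintegral_counting_translate]
  · refine lintegral_congr fun x => ?_
    have hiff : x - t ∈ strip h W ∩ E.projectionOnto F h ⁻¹' A ↔
        x ∈ strip h W ∩ E.projectionOnto F h ⁻¹' ((fun e => e - t) ⁻¹' A) := by
      rw [mem_inter_iff, sub_mem_strip, mem_inter_iff, mem_preimage, map_sub,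
        Submodule.projectionOnto_apply_left]
      rfl
    by_cases hx : x ∈ strip h W ∩ E.projectionOnto F h ⁻¹' ((fun e => e - t) ⁻¹' A)
    · rw [indicator_of_mem hx, indicator_of_mem (hiff.2 hx), pairWeight_translate hW hf]
    · rw [indicator_of_notMem hx, indicator_of_notMem (fun hx' => hx (hiff.1 hx'))]
  · exact ((measurable_pairWeight hW hf).comp measurable_prodMk_left).indicator
      (measurableSet_strip_inter hW hA)

theorem pairSum_mono (φ : Config V) {A A' : Set E} (hA : A ⊆ A') :
    pairSum h W f A φ ≤ pairSum h W f A' φ :=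
  lintegral_mono fun _ => indicator_le_indicator_of_subset
    (inter_subset_inter_right _ (preimage_mono hA)) (fun _ => zero_le) _

/-- Fubini: a point `x` contributes for exactly those times `t` with `‖x_E - t‖ ≤ 1`. -/
theorem lintegral_pairSum_translate (hW : MeasurableSet W) (hf : Measurable f) (φ : Config V)
    (A : Set E) :
    ∫⁻ t : E in A, pairSum h W f (closedBall 0 1) (translate (t : V) φ) =
      ∫⁻ x, (strip h W).indicator (pairWeight h W f φ) x *
        volume (A ∩ closedBall (E.projectionOnto F h x) 1) ∂counting φ := by
  have hE := (continuous_projectionOnto h).measurable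
  have hpw : Measurable (pairWeight h W f φ) :=
    (measurable_pairWeight hW hf).comp measurable_prodMk_left
  have hS : MeasurableSet {p : E × V | dist p.1 (E.projectionOnto F h p.2) ≤ 1} :=
    measurableSet_le (measurable_fst.dist (hE.comp measurable_snd)) measurable_const
  let g : E → V → ℝ≥0∞ := fun t x => (strip h W).indicator (pairWeight h W f φ) x *
    (closedBall (E.projectionOnto F h x) 1).indicator 1 t
  have hg : Measurable (Function.uncurry g) :=
    ((hpw.indicator (measurableSet_strip h hW)).comp measurable_snd).mul
      (measurable_one.indicator hS)
  have h1 : ∀ t : E, pairSum h W f (closedBall 0 1) (translate (t : V) φ) =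
      ∫⁻ x, g t x ∂counting φ := by
    intro t
    rw [pairSum_translate hW hf measurableSet_closedBall, pairSum]
    refine lintegral_congr fun x => ?_
    have hiff : E.projectionOnto F h x ∈ (fun e => e - t) ⁻¹' closedBall 0 1 ↔
        t ∈ closedBall (E.projectionOnto F h x) 1 := by
      rw [mem_preimage, mem_closedBall, mem_closedBall, dist_zero_right, dist_comm, dist_eq_norm]
    by_cases hx : x ∈ strip h W <;>
      by_cases hx2 : t ∈ closedBall (E.projectionOnto F h x) 1
    · rw [indicator_of_mem (mem_inter (a := strip h W) hx (mem_preimage.2 (hiff.2 hx2)))]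
      simp only [g]
      rw [indicator_of_mem hx, indicator_of_mem hx2, Pi.one_apply, mul_one]
    · rw [indicator_of_notMem fun hh => hx2 (hiff.1 hh.2)]
      simp only [g]
      rw [indicator_of_notMem hx2, mul_zero]
    · rw [indicator_of_notMem fun hh => hx hh.1]
      simp only [g]
      rw [indicator_of_notMem hx, zero_mul]
    · rw [indicator_of_notMem fun hh => hx hh.1]
      simp only [g]
      rw [indicator_of_notMem hx, zero_mul]
  simp_rw [h1]
  rw [lintegral_lintegral_swap hg.aemeasurable]
  refine lintegral_congr fun x => ?_
  simp only [g]
  rw [lintegral_const_mul _ (measurable_one.indicator measurableSet_closedBall),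
    lintegral_indicator_one measurableSet_closedBall, Measure.restrict_apply
      measurableSet_closedBall, inter_comm]

/-- Averaging the unit ball sum over `B_R` costs one unit of radius on each side: the ball around
`x_E` misses `B_R` if `‖x_E‖ > R + 1`, and lies inside if `‖x_E‖ ≤ R - 1` (used in the reverse
bound). -/
theorem lintegral_pairSum_translate_le (hW : MeasurableSet W) (hf : Measurable f) (φ : Config V)
    (R : ℝ) :
    ∫⁻ t : E in closedBall 0 R, pairSum h W f (closedBall 0 1) (translate (t : V) φ) ≤
      volume (closedBall (0 : E) 1) * pairSum h W f (closedBall 0 (R + 1)) φ := by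
  have hpw : Measurable (pairWeight h W f φ) :=
    (measurable_pairWeight hW hf).comp measurable_prodMk_left
  rw [lintegral_pairSum_translate hW hf φ (closedBall 0 R), pairSum,
    ← lintegral_const_mul _ (hpw.indicator (measurableSet_strip_inter hW measurableSet_closedBall))]
  refine lintegral_mono fun x => ?_
  by_cases hx : x ∈ strip h W
  · by_cases hx2 : E.projectionOnto F h x ∈ closedBall 0 (R + 1)
    · rw [indicator_of_mem hx, indicator_of_mem (mem_inter (a := strip h W) hx (mem_preimage.2 hx2)),
        mul_comm,
        ← Measure.addHaar_closedBall_center volume (E.projectionOnto F h x)]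
      gcongr
      exact inter_subset_right
    · have : closedBall (0 : E) R ∩ closedBall (E.projectionOnto F h x) 1 = ∅ := by
        rw [← disjoint_iff_inter_eq_empty]
        refine closedBall_disjoint_closedBall ?_
        rw [mem_closedBall, not_le] at hx2
        rwa [dist_comm]
      rw [this, measure_empty, mul_zero]
      exact zero_le
  · rw [indicator_of_notMem hx, zero_mul]
    exact zero_le

theorem le_lintegral_pairSum_translate (hW : MeasurableSet W) (hf : Measurable f) (φ : Config V)
    (R : ℝ) :
    volume (closedBall (0 : E) 1) * pairSum h W f (closedBall 0 (R - 1)) φ ≤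
    ∫⁻ t : E in closedBall 0 R, pairSum h W f (closedBall 0 1) (translate (t : V) φ) := by
  have hpw : Measurable (pairWeight h W f φ) :=
    (measurable_pairWeight hW hf).comp measurable_prodMk_left
  rw [lintegral_pairSum_translate hW hf φ (closedBall 0 R), pairSum,
    ← lintegral_const_mul _ (hpw.indicator (measurableSet_strip_inter hW measurableSet_closedBall))]
  refine lintegral_mono fun x => ?_
  by_cases hx : x ∈ strip h W ∩ E.projectionOnto F h ⁻¹' closedBall 0 (R - 1)
  · have hsub : closedBall (E.projectionOnto F h x) 1 ⊆ closedBall (0 : E) R := by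
      have := hx.2
      rw [mem_preimage, mem_closedBall] at this
      exact closedBall_subset_closedBall' (by linarith)
    rw [indicator_of_mem hx, indicator_of_mem hx.1, inter_eq_self_of_subset_right hsub,
      Measure.addHaar_closedBall_center volume (E.projectionOnto F h x), mul_comm]
  · rw [indicator_of_notMem hx, mul_zero]
    exact zero_le

/-- `f` is bounded by `M` and vanishes outside of the ball of radius `r`. -/
def BoundedOnBall (f : E → ℝ≥0∞) (M : ℝ≥0∞) (r : ℝ) : Prop :=
  (∀ e, f e ≤ M) ∧ ∀ e, r < ‖e‖ → f e = 0

/-- The window is bounded and `f` has bounded range, so both points of a contributing pair lie in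
one compact `K`. Square integrability of the process thus becomes integrability of the pair sum. -/
theorem pairSum_le (hWb : Bornology.IsBounded W) {M : ℝ≥0∞} {r : ℝ} (hf : BoundedOnBall f M r)
    (a : ℝ) : ∃ K : Set V, IsCompact K ∧ ∀ φ : Config V,
      pairSum h W f (closedBall 0 a) φ ≤ M * counting φ K ^ 2 := by
  obtain ⟨w, hw⟩ := hWb.exists_norm_le
  refine ⟨closedBall 0 (|a| + |r| + |w|), isCompact_closedBall _ _, fun φ => ?_⟩
  set K := closedBall (0 : V) (|a| + |r| + |w|)
  have hKm : MeasurableSet K := measurableSet_closedBall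
  have hstrip : ∀ x : V, x ∈ strip h W → ‖E.projectionOnto F h x‖ ≤ |a| + |r| → x ∈ K := by
    intro x hx hx2
    have h1 := norm_le_projectionOnto h x
    have h2 := (hw _ hx).trans (le_abs_self w)
    rw [mem_closedBall, dist_zero_right]
    linarith
  calc pairSum h W f (closedBall 0 a) φ
      ≤ ∫⁻ x, K.indicator (fun _ => M * counting φ K) x ∂counting φ := by
        refine lintegral_mono fun x => ?_
        by_cases hx : x ∈ strip h W ∩ E.projectionOnto F h ⁻¹' closedBall 0 a
        · have hxa : ‖E.projectionOnto F h x‖ ≤ |a| := by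
            have := hx.2
            rw [mem_preimage, mem_closedBall, dist_zero_right] at this
            exact this.trans (le_abs_self a)
          have hxK : x ∈ K := hstrip x hx.1 (by have := abs_nonneg r; linarith)
          rw [indicator_of_mem hx, indicator_of_mem hxK, pairWeight, ← setLIntegral_const,
            ← lintegral_indicator hKm]
          refine lintegral_mono fun y => ?_
          by_cases hy : y ∈ strip h W
          · rw [indicator_of_mem hy]
            by_cases hyr : r < ‖E.projectionOnto F h y - E.projectionOnto F h x‖
            · rw [hf.2 _ hyr]
              exact zero_le
            · have hyK : y ∈ K := by
                refine hstrip y hy ?_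
                have h1 := norm_le_norm_add_norm_sub' (E.projectionOnto F h y)
                  (E.projectionOnto F h x)
                have h2 := le_abs_self r
                linarith [not_lt.1 hyr]
              rw [indicator_of_mem hyK]
              exact hf.1 _
          · rw [indicator_of_notMem hy]
            exact zero_le
        · rw [indicator_of_notMem hx]
          exact zero_le
    _ = M * counting φ K ^ 2 := by
        rw [lintegral_indicator hKm, setLIntegral_const]
        ring

theorem pairSum_lt_top (hWb : Bornology.IsBounded W) {M : ℝ≥0∞} {r : ℝ} (hM : M ≠ ∞)
    (hf : BoundedOnBall f M r) (a : ℝ) (φ : Config V) :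
    pairSum h W f (closedBall 0 a) φ < ∞ := by
  obtain ⟨K, hK, hb⟩ := pairSum_le (h := h) hWb hf a
  refine (hb φ).trans_lt (ENNReal.mul_lt_top hM.lt_top (ENNReal.pow_lt_top ?_))
  rw [counting_apply_of_isBounded φ hK.isClosed.measurableSet hK.isBounded]
  exact ENNReal.natCast_lt_top _

variable {m : Measure (Config V)}

theorem lintegral_pairSum_lt_top (hsq : IsSquareIntegrable m)
    (hWb : Bornology.IsBounded W) {M : ℝ≥0∞} {r : ℝ} (hM : M ≠ ∞)
    (hf : BoundedOnBall f M r) (a : ℝ) :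
    ∫⁻ φ, pairSum h W f (closedBall 0 a) φ ∂m < ∞ := by
  obtain ⟨K, hK, hb⟩ := pairSum_le (h := h) hWb hf a
  have hm : Measurable fun φ : Config V => counting φ K ^ 2 :=
    ((Measure.measurable_coe hK.isClosed.measurableSet).comp measurable_counting).pow_const 2
  refine (lintegral_mono hb).trans_lt ?_
  rw [lintegral_const_mul _ hm]
  exact ENNReal.mul_lt_top hM.lt_top (lintegral_count_sq_lt_top hsq hK)

/-- The measure `C ↦ α ∫ ψ(x_F) 1_C(x_E) c(dx)`. -/
def cutAutocorrelation (h : IsCompl E F) (W : Set F) (α : ℝ≥0∞) (c : Measure V) : Measure E :=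
  α • (c.withDensity fun x => ENNReal.ofReal (windowAutocorr W (F.projectionOnto E h.symm x))).map
    (E.projectionOnto F h)

theorem measurable_ofReal_windowAutocorr_projectionOnto (hW : MeasurableSet W) :
    Measurable fun x : V => ENNReal.ofReal (windowAutocorr W (F.projectionOnto E h.symm x)) :=
  ((measurable_windowAutocorr hW).comp (continuous_projectionOnto h.symm).measurable).ennreal_ofReal

theorem lintegral_cutAutocorrelation (hW : MeasurableSet W) {α : ℝ≥0∞} {c : Measure V}
    (hf : Measurable f) :
    ∫⁻ e, f e ∂cutAutocorrelation h W α c = α * ∫⁻ x,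
      ENNReal.ofReal (windowAutocorr W (F.projectionOnto E h.symm x)) *
        f (E.projectionOnto F h x) ∂c := by
  have hE := (continuous_projectionOnto h).measurable
  have hfE : Measurable fun x : V => f (E.projectionOnto F h x) := hf.comp hE
  rw [cutAutocorrelation, lintegral_smul_measure, lintegral_map hf hE,
    lintegral_withDensity_eq_lintegral_mul _
      (measurable_ofReal_windowAutocorr_projectionOnto (h := h) hW) hfE, smul_eq_mul]
  rfl

-- By Campbell's formula the mean is an integral over a point `x` and a difference `z`. Writing `x =
-- e + u` along `E ⊕ F`, the integrand is `1_A(e) f(z_E)` times the indicator at `u` of `W ∩ (W -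
-- z_F)`; the integrals over `e` and `u` give `|A|` and `ψ(z_F)`.
set_option maxHeartbeats 800000 in
theorem lintegral_pairSum [IsProbabilityMeasure m] (hstat : IsStationaryLaw m)
    (hsq : IsSquareIntegrable m) {B : Set V} (hB : MeasurableSet B) (hB0 : volume B ≠ 0)
    (hBt : volume B ≠ ∞) {α : ℝ≥0∞}
    (hv : (volume : Measure V) =
      α • (volume.prod volume : Measure (E × F)).map (complSumEquiv h))
    (hW : MeasurableSet W) (hWb : Bornology.IsBounded W) (hf : Measurable f)
    {A : Set E} (hA : MeasurableSet A) :
    ∫⁻ φ, pairSum h W f A φ ∂m =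
      volume A * ∫⁻ e, f e ∂cutAutocorrelation h W α (intensity (palm m B hB)) := by
  have hE := (continuous_projectionOnto h).measurable
  have hF := (continuous_projectionOnto h.symm).measurable
  have hlf := (diffMoment_eq_prod hstat hsq hB hB0 hBt).1
  set S := strip h W ∩ E.projectionOnto F h ⁻¹' A
  have hS : MeasurableSet S := measurableSet_strip_inter hW hA
  let g : V × V → ℝ≥0∞ := fun p => S.indicator 1 p.1 *
    (strip h W).indicator (fun y => f (E.projectionOnto F h y - E.projectionOnto F h p.1)) p.2
  have hg2 : Measurable fun p : V × V => (strip h W).indicator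
      (fun y => f (E.projectionOnto F h y - E.projectionOnto F h p.1)) p.2 := by
    have h1 : Measurable fun p : V × V =>
        f (E.projectionOnto F h p.2 - E.projectionOnto F h p.1) :=
      hf.comp ((hE.comp measurable_snd).sub (hE.comp measurable_fst))
    exact h1.indicator (measurable_snd (measurableSet_strip h hW))
  have hg : Measurable g := ((measurable_one.indicator hS).comp measurable_fst).mul hg2
  have h1 : ∫⁻ φ, pairSum h W f A φ ∂m =
      ∫⁻ φ, ∫⁻ x, ∫⁻ y, g (x, y) ∂counting φ ∂counting φ ∂m := by
    refine lintegral_congr fun φ => lintegral_congr fun x => ?_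
    simp only [g]
    have hg3 : Measurable fun y => (strip h W).indicator
        (fun y => f (E.projectionOnto F h y - E.projectionOnto F h x)) y :=
      hg2.comp (measurable_prodMk_left (x := x))
    rw [lintegral_const_mul _ hg3]
    by_cases hx : x ∈ S
    · rw [indicator_of_mem hx, indicator_of_mem hx, Pi.one_apply, one_mul]
      rfl
    · rw [indicator_of_notMem hx, indicator_of_notMem hx, zero_mul]
  have hg' : Measurable fun p : V × V => g (p.1, p.1 + p.2) := by fun_prop
  have hfE : Measurable fun x : V => f (E.projectionOnto F h x) := hf.comp hE
  have hprod : Measurable fun x => ENNReal.ofReal (windowAutocorr W (F.projectionOnto E h.symm x)) *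
      f (E.projectionOnto F h x) :=
    (measurable_ofReal_windowAutocorr_projectionOnto (h := h) hW).mul hfE
  rw [h1, lintegral_pairs hstat hsq hB hB0 hBt hg,
    lintegral_lintegral_swap (f := fun x z => g (x, x + z)) hg'.aemeasurable,
    lintegral_cutAutocorrelation hW hf, ← mul_assoc, mul_comm (volume A),
    mul_assoc, ← lintegral_const_mul _ hprod, ← lintegral_const_mul _ (hprod.const_mul _)]
  refine lintegral_congr fun z => ?_
  have hgz : Measurable fun x => g (x, x + z) := hg'.comp (measurable_prodMk_right (y := z))
  rw [lintegral_eq_complSumEquiv (h := h) hv hgz]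
  congr 1
  have h2 : ∀ (e : E) (u : F), g (complSumEquiv h (e, u), complSumEquiv h (e, u) + z) =
      A.indicator 1 e * (f (E.projectionOnto F h z) *
        (W ∩ (fun u => u + F.projectionOnto E h.symm z) ⁻¹' W).indicator 1 u) := by
    intro e u
    have hm1 : complSumEquiv h (e, u) ∈ S ↔ u ∈ W ∧ e ∈ A := by
      rw [mem_inter_iff, mem_strip, projectionOnto_complSumEquiv_right, mem_preimage,
        projectionOnto_complSumEquiv_left]
    have hm2 : complSumEquiv h (e, u) + z ∈ strip h W ↔
        u + F.projectionOnto E h.symm z ∈ W := by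
      rw [mem_strip, map_add, projectionOnto_complSumEquiv_right]
    have hm3 : E.projectionOnto F h (complSumEquiv h (e, u) + z) -
        E.projectionOnto F h (complSumEquiv h (e, u)) = E.projectionOnto F h z := by
      rw [map_add, add_sub_cancel_left]
    classical
    simp only [g, indicator_apply, hm1, hm2, hm3, mem_inter_iff, mem_preimage, Pi.one_apply]
    by_cases ha : u ∈ W <;> by_cases hb : e ∈ A <;>
      by_cases hc : u + F.projectionOnto E h.symm z ∈ W <;> simp [ha, hb, hc]
  have hmW : MeasurableSet (W ∩ (fun u => u + F.projectionOnto E h.symm z) ⁻¹' W) :=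
    hW.inter ((measurable_add_const _) hW)
  simp_rw [h2]
  have h3 : ∀ e : E, ∫⁻ u : F, A.indicator 1 e * (f (E.projectionOnto F h z) *
        (W ∩ (fun u => u + F.projectionOnto E h.symm z) ⁻¹' W).indicator 1 u) =
      A.indicator 1 e * (f (E.projectionOnto F h z) *
        ENNReal.ofReal (windowAutocorr W (F.projectionOnto E h.symm z))) := by
    intro e
    rw [lintegral_const_mul _ ((measurable_one.indicator hmW).const_mul _),
      lintegral_const_mul _ (measurable_one.indicator hmW), lintegral_indicator_one hmW,
      ofReal_windowAutocorr hW hWb]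
  simp_rw [h3]
  rw [lintegral_mul_const _ (measurable_one.indicator hA), lintegral_indicator_one hA]
  ring

end PairSums

/-! ### Passing from ergodic averages to limits of pair sums. -/

section Limits

open Metric Config

/-- Averages are known at integral radii, up to a shift of the radius by `1`. Monotonicity of `s`
interpolates to real radii, and the ratio of the volumes of nearby balls tends to `1`. -/
theorem tendsto_div_measure_closedBall {G : Type*} [NormedAddCommGroup G] [NormedSpace ℝ G]
    [FiniteDimensional ℝ G] [MeasurableSpace G] [BorelSpace G] (μ : Measure G)
    [μ.IsAddHaarMeasure] {s : ℝ → ℝ} {a : ℕ → ℝ} {L : ℝ} (hs : Monotone s)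
    (hs0 : ∀ r, 0 ≤ s r) (ha : Tendsto a atTop (𝓝 L))
    (h1 : ∀ n : ℕ, 1 ≤ n → s (n - 1) ≤ μ.real (closedBall (0 : G) n) * a n)
    (h2 : ∀ n : ℕ, 1 ≤ n → μ.real (closedBall (0 : G) n) * a n ≤ s (n + 1)) (b : ℝ) :
    Tendsto (fun R => s (R + b) / μ.real (closedBall (0 : G) R)) atTop (𝓝 L) := by
  -- Of the extra `2`, one unit pays for rounding `R` to an integer and one for the shift by `1` in
  -- `h1` and `h2`.
  obtain ⟨k, hk⟩ := exists_nat_ge (|b| + 2)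
  set v : ℝ → ℝ := fun R => μ.real (closedBall (0 : G) R)
  have hvm : Monotone v := fun r r' hr => measureReal_mono (closedBall_subset_closedBall hr)
    measure_closedBall_lt_top.ne
  have hv0 : ∀ r, 0 < r → 0 < v r := fun r hr =>
    ENNReal.toReal_pos (measure_closedBall_pos _ _ hr).ne' measure_closedBall_lt_top.ne
  have hb := abs_le.1 (le_refl |b|)
  have hratio := fun c => IsMeasurePreservingFlow.tendsto_measure_closedBall_ratio (μ := μ) c
  have hup : Tendsto (fun n : ℕ => v (n + k) / v n * a (n + k)) atTop (𝓝 L) := by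
    simpa using (hratio k).mul (ha.comp (tendsto_add_atTop_nat k))
  have hlow : Tendsto (fun n : ℕ => (v (n + (k + 1)) / v n)⁻¹ * a n) atTop (𝓝 L) := by
    simpa using ((hratio (k + 1)).inv₀ one_ne_zero).mul ha
  have hfl : Tendsto (fun R : ℝ => ⌊R⌋₊) atTop atTop := tendsto_nat_floor_atTop
  refine tendsto_of_tendsto_of_tendsto_of_le_of_le'
    ((hlow.comp (tendsto_sub_atTop_nat k)).comp hfl) (hup.comp hfl) ?_ ?_
  · filter_upwards [eventually_ge_atTop ((k : ℝ) + 1)] with R hR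
    have hR0 : 0 < R := by linarith [k.cast_nonneg (α := ℝ)]
    have hkn : k + 1 ≤ ⌊R⌋₊ := Nat.le_floor (by exact_mod_cast hR)
    obtain ⟨j, hj⟩ := Nat.exists_eq_add_of_le' (Nat.le_of_succ_le hkn)
    have hj1 : 1 ≤ j := by omega
    have hj0 : (0 : ℝ) < j := by exact_mod_cast hj1
    have h3 : R < j + (k + 1) := by
      have := Nat.lt_floor_add_one R
      rw [hj] at this
      push_cast at this
      linarith
    have h4 : (j : ℝ) + k ≤ R := by
      have := Nat.floor_le hR0.le
      rw [hj] at this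
      exact_mod_cast this
    simp only [Function.comp_apply, hj, Nat.add_sub_cancel]
    have h5 : v j * a j ≤ s (R + b) := (h2 j hj1).trans (hs (by linarith))
    rw [inv_div, div_mul_eq_mul_div]
    calc v j * a j / v (j + (k + 1)) ≤ s (R + b) / v (j + (k + 1)) := by
          gcongr
      _ ≤ s (R + b) / v R := by
          have := hv0 R hR0
          have := hs0 (R + b)
          gcongr
          exact hvm h3.le
  · filter_upwards [eventually_ge_atTop ((k : ℝ) + 1)] with R hR
    have hR0 : 0 < R := by linarith [k.cast_nonneg (α := ℝ)]
    have hkn : k + 1 ≤ ⌊R⌋₊ := Nat.le_floor (by exact_mod_cast hR)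
    set n := ⌊R⌋₊
    have hn0 : (0 : ℝ) < n := by exact_mod_cast (by omega : 0 < n)
    have h3 : R < n + 1 := Nat.lt_floor_add_one R
    have h4 : (n : ℝ) ≤ R := Nat.floor_le hR0.le
    have h5 : s (R + b) ≤ v (n + k) * a (n + k) := by
      have := h1 (n + k) (by omega)
      push_cast at this
      exact (hs (by linarith)).trans this
    simp only [Function.comp_apply]
    rw [div_mul_eq_mul_div]
    calc s (R + b) / v R ≤ s (R + b) / v n := by
          have := hv0 n hn0
          have := hs0 (R + b)
          gcongr
          exact hvm h4
      _ ≤ _ := by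
          gcongr

variable {V : Type*} [NormedAddCommGroup V] [InnerProductSpace ℝ V] [FiniteDimensional ℝ V]
  {E F : Submodule ℝ V} [MeasurableSpace V] [BorelSpace V] {m : Measure (Config V)}
  {h : IsCompl E F} {W : Set F} {f : E → ℝ≥0∞}

theorem isMeasurePreservingFlow_translate (hstat : IsStationaryLaw m) (E : Submodule ℝ V) :
    IsMeasurePreservingFlow (fun (t : E) (φ : Config V) => translate (t : V) φ) m where
  measurable := measurable_translate.comp
    (measurable_snd.prodMk (measurable_subtype_coe.comp measurable_fst))
  measurePreserving t := ⟨measurable_translate_right _, hstat t⟩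
  zero φ := translate_zero φ
  add s t φ := by rw [Config.translate_translate]; rfl

theorem BoundedOnBall.ae_tendsto_pairSum [IsProbabilityMeasure m] (hstat : IsStationaryLaw m)
    (hsq : IsSquareIntegrable m) (herg : IsErgodicUnder m E) {B : Set V} (hB : MeasurableSet B)
    (hB0 : volume B ≠ 0) (hBt : volume B ≠ ∞) {α : ℝ≥0∞}
    (hv : (volume : Measure V) =
      α • (volume.prod volume : Measure (E × F)).map (complSumEquiv h))
    (hW : MeasurableSet W) (hWb : Bornology.IsBounded W) (hf : Measurable f) {M : ℝ≥0∞} {r : ℝ}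
    (hM : M ≠ ∞) (hfb : BoundedOnBall f M r) :
    ∀ᵐ φ ∂m, ∀ b : ℝ, Tendsto (fun R : ℝ => (pairSum h W f (closedBall 0 (R + b)) φ).toReal /
      volume.real (closedBall (0 : E) R)) atTop
      (𝓝 (∫⁻ e, f e ∂cutAutocorrelation h W α (intensity (palm m B hB))).toReal) := by
  have hflow := isMeasurePreservingFlow_translate hstat E
  have hpm := measurable_pairSum (h := h) hW hf (A := closedBall (0 : E) 1) measurableSet_closedBall
  have hfin := fun a => pairSum_lt_top (h := h) hWb hM hfb a
  set v1 := volume (closedBall (0 : E) 1)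
  have hv1 : v1.toReal ≠ 0 := ENNReal.toReal_ne_zero.2
    ⟨(measure_closedBall_pos _ _ one_pos).ne', measure_closedBall_lt_top.ne⟩
  have hv1t : v1 ≠ ∞ := measure_closedBall_lt_top.ne
  have hint : Integrable (fun φ => (pairSum h W f (closedBall 0 1) φ).toReal) m :=
    integrable_toReal_of_lintegral_ne_top hpm.aemeasurable
      (lintegral_pairSum_lt_top hsq hWb hM hfb 1).ne
  have hmean : ∫ φ, (pairSum h W f (closedBall 0 1) φ).toReal ∂m = v1.toReal *
      (∫⁻ e, f e ∂cutAutocorrelation h W α (intensity (palm m B hB))).toReal := by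
    rw [integral_toReal hpm.aemeasurable (Eventually.of_forall fun φ => hfin 1 φ),
      lintegral_pairSum hstat hsq hB hB0 hBt hv hW hWb hf measurableSet_closedBall,
      ENNReal.toReal_mul]
  have hw := hflow.averagesConverge (μ := (volume : Measure E)) (fun s hs hinv => herg s hs
    fun t ht => hinv ⟨t, ht⟩) hint
  filter_upwards [hw] with φ hφ b
  have ha := hφ.const_mul v1.toReal⁻¹
  rw [hmean, inv_mul_cancel_left₀ hv1] at ha
  have hset : ∀ n : ℕ, 1 ≤ n → volume.real (closedBall (0 : E) n) * (v1.toReal⁻¹ *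
      ⨍ t : E in closedBall (0 : E) n, (pairSum h W f (closedBall 0 1) (translate (t : V) φ)).toReal) =
      v1.toReal⁻¹ * (∫⁻ t : E in closedBall (0 : E) n,
        pairSum h W f (closedBall 0 1) (translate (t : V) φ)).toReal := by
    intro n hn
    have hvn : volume.real (closedBall (0 : E) n) ≠ 0 := ENNReal.toReal_ne_zero.2
      ⟨(measure_closedBall_pos _ _ (by exact_mod_cast hn)).ne', measure_closedBall_lt_top.ne⟩
    have hmt : Measurable fun t : E => pairSum h W f (closedBall 0 1) (translate (t : V) φ) :=
      hpm.comp (hflow.measurable.comp measurable_prodMk_right)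
    rw [setAverage_eq, integral_toReal hmt.aemeasurable (Eventually.of_forall fun t => hfin 1 _),
      smul_eq_mul]
    field_simp
  refine tendsto_div_measure_closedBall volume
    (s := fun R => (pairSum h W f (closedBall 0 R) φ).toReal) ?_ (fun R => ENNReal.toReal_nonneg)
    ha ?_ ?_ b
  · exact fun R R' hR => ENNReal.toReal_mono (hfin _ _).ne
      (pairSum_mono φ (closedBall_subset_closedBall hR))
  · intro n hn
    rw [hset n hn, le_inv_mul_iff₀ (lt_of_le_of_ne ENNReal.toReal_nonneg hv1.symm),
      ← ENNReal.toReal_mul]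
    exact ENNReal.toReal_mono
      ((lintegral_pairSum_translate_le hW hf φ n).trans_lt
        (ENNReal.mul_lt_top hv1t.lt_top (hfin _ _))).ne
      (le_lintegral_pairSum_translate hW hf φ n)
  · intro n hn
    rw [hset n hn, inv_mul_le_iff₀ (lt_of_le_of_ne ENNReal.toReal_nonneg hv1.symm),
      ← ENNReal.toReal_mul]
    exact ENNReal.toReal_mono (ENNReal.mul_lt_top hv1t.lt_top (hfin _ _)).ne
      (lintegral_pairSum_translate_le hW hf φ n)

end Limits

/-! ### Comparison of the measures `γ_R` of the projected set with pair sums. -/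

section Patterson

open Metric Config

variable {V : Type*} [NormedAddCommGroup V] [InnerProductSpace ℝ V] [FiniteDimensional ℝ V]
  [MeasurableSpace V] [BorelSpace V]

theorem lintegral_patterson (χ : Config V) (R : ℝ) {f : V → ℝ≥0∞} (hf : Measurable f) :
    ∫⁻ x, f x ∂patterson χ R = (volume (closedBall (0 : V) R))⁻¹ *
      ∫⁻ x in closedBall 0 R, ∫⁻ y in closedBall 0 R, f (y - x) ∂counting χ ∂counting χ := by
  rw [patterson, lintegral_smul_measure, lintegral_sum_measure, smul_eq_mul]
  congr 1
  simp_rw [lintegral_dirac' _ hf, setLIntegral_counting _ _ measurableSet_closedBall]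
  rw [← (Equiv.Set.prod _ _).symm.tsum_eq, ENNReal.tsum_prod']
  rfl

theorem isFiniteMeasure_patterson (χ : Config V) {R : ℝ} (hR : 0 < R) :
    IsFiniteMeasure (patterson χ R) := by
  refine ⟨?_⟩
  rw [← lintegral_one, lintegral_patterson χ R measurable_const]
  simp only [lintegral_const, one_mul, Measure.restrict_apply MeasurableSet.univ, univ_inter]
  rw [counting_apply_of_isBounded χ measurableSet_closedBall isBounded_closedBall]
  refine ENNReal.mul_lt_top (ENNReal.inv_lt_top.2 (measure_closedBall_pos _ _ hR)) ?_
  exact ENNReal.mul_lt_top (ENNReal.natCast_lt_top _) (ENNReal.natCast_lt_top _)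

variable {E F : Submodule ℝ V} {h : IsCompl E F} {W : Set F} {f : E → ℝ≥0∞}

/-- Injectivity of `p_E` on the strip matters here: without it, the image set would count coinciding
projections once and the push-forward measure several times. -/
theorem counting_cutProject (hW : MeasurableSet W) (hWb : Bornology.IsBounded W) {φ : Config V}
    (hinj : InjOn (E.projectionOnto F h) (φ.carrier ∩ strip h W)) :
    counting (cutProject h W hWb φ) =
      ((counting φ).restrict (strip h W)).map (E.projectionOnto F h) := by
  have hE := (continuous_projectionOnto h).measurable
  ext A hA
  rw [counting_apply _ hA, Measure.map_apply hE hA, Measure.restrict_apply (hE hA),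
    counting_apply _ ((hE hA).inter (measurableSet_strip h hW))]
  have h1 : A ∩ (cutProject h W hWb φ).carrier = E.projectionOnto F h ''
      (E.projectionOnto F h ⁻¹' A ∩ strip h W ∩ φ.carrier) := by
    rw [inter_assoc, inter_comm (strip h W), image_preimage_inter]
    rfl
  rw [h1, InjOn.encard_image]
  refine hinj.mono ?_
  rintro x ⟨⟨-, hx⟩, hx2⟩
  exact ⟨hx2, hx⟩

theorem lintegral_patterson_cutProject (hW : MeasurableSet W) (hWb : Bornology.IsBounded W)
    {φ : Config V} (hinj : InjOn (E.projectionOnto F h) (φ.carrier ∩ strip h W)) (R : ℝ)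
    (hf : Measurable f) :
    ∫⁻ e, f e ∂patterson (cutProject h W hWb φ) R = (volume (closedBall (0 : E) R))⁻¹ *
      ∫⁻ x, (strip h W ∩ E.projectionOnto F h ⁻¹' closedBall 0 R).indicator (fun x =>
        ∫⁻ y, (strip h W ∩ E.projectionOnto F h ⁻¹' closedBall 0 R).indicator (fun y =>
          f (E.projectionOnto F h y - E.projectionOnto F h x)) y ∂counting φ) x ∂counting φ := by
  have hE := (continuous_projectionOnto h).measurable
  have hS : MeasurableSet (E.projectionOnto F h ⁻¹' closedBall 0 R) := hE measurableSet_closedBall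
  have hr : ((counting φ).restrict (strip h W)).restrict
      (E.projectionOnto F h ⁻¹' closedBall 0 R) =
      (counting φ).restrict (strip h W ∩ E.projectionOnto F h ⁻¹' closedBall 0 R) := by
    rw [Measure.restrict_restrict hS, inter_comm]
  have hSm := measurableSet_strip_inter (h := h) hW (A := closedBall (0 : E) R)
    measurableSet_closedBall
  have : SFinite (counting φ) := inferInstanceAs (SFinite (countingKernel V φ))
  rw [lintegral_patterson _ _ hf, counting_cutProject hW hWb hinj]
  congr 1
  have hm : Measurable fun p : E × E => f (p.2 - p.1) := hf.comp (measurable_snd.sub measurable_fst)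
  rw [Measure.restrict_map hE measurableSet_closedBall, hr, lintegral_map _ hE,
    ← lintegral_indicator hSm]
  · refine lintegral_congr fun x => ?_
    congr 1
    funext x
    have hfx : Measurable fun y => f (y - E.projectionOnto F h x) :=
      hf.comp (measurable_sub_const _)
    rw [lintegral_map hfx hE, ← lintegral_indicator hSm]
  · exact hm.lintegral_prod_right'

/-- Dropping the condition `y_E ∈ B_R` gives the upper bound. For the lower one, if `‖x_E‖ ≤ R -
|r|` and `f` does not vanish at `y_E - x_E`, then `y_E ∈ B_R` automatically. -/
theorem BoundedOnBall.patterson_cutProject_bounds (hW : MeasurableSet W)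
    (hWb : Bornology.IsBounded W) {φ : Config V}
    (hinj : InjOn (E.projectionOnto F h) (φ.carrier ∩ strip h W)) (R : ℝ)
    (hf : Measurable f) {M : ℝ≥0∞} {r : ℝ} (hfb : BoundedOnBall f M r) :
    (volume (closedBall (0 : E) R))⁻¹ * pairSum h W f (closedBall 0 (R + -|r|)) φ ≤
        ∫⁻ e, f e ∂patterson (cutProject h W hWb φ) R ∧
      ∫⁻ e, f e ∂patterson (cutProject h W hWb φ) R ≤
        (volume (closedBall (0 : E) R))⁻¹ * pairSum h W f (closedBall 0 (R + 0)) φ := by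
  rw [lintegral_patterson_cutProject hW hWb hinj R hf, add_zero]
  constructor
  · refine mul_le_mul_right (lintegral_mono fun x => ?_) _
    by_cases hx : x ∈ strip h W ∩ E.projectionOnto F h ⁻¹' closedBall 0 (R + -|r|)
    · have hxR : ‖E.projectionOnto F h x‖ ≤ R + -|r| := by
        have := hx.2
        rwa [mem_preimage, mem_closedBall, dist_zero_right] at this
      have hx' : x ∈ strip h W ∩ E.projectionOnto F h ⁻¹' closedBall 0 R := by
        refine ⟨hx.1, ?_⟩
        rw [mem_preimage, mem_closedBall, dist_zero_right]
        linarith [abs_nonneg r]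
      rw [indicator_of_mem hx, indicator_of_mem hx']
      refine lintegral_mono fun y => ?_
      by_cases hy : y ∈ strip h W
      · rw [indicator_of_mem hy]
        by_cases hyR : y ∈ strip h W ∩ E.projectionOnto F h ⁻¹' closedBall 0 R
        · rw [indicator_of_mem hyR]
        · rw [hfb.2]
          · exact zero_le
          · by_contra hlt
            refine hyR ⟨hy, ?_⟩
            rw [mem_preimage, mem_closedBall, dist_zero_right]
            have h1 := norm_le_norm_add_norm_sub' (E.projectionOnto F h y)
              (E.projectionOnto F h x)
            linarith [le_abs_self r, not_lt.1 hlt]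
      · rw [indicator_of_notMem hy]
        exact zero_le
    · rw [indicator_of_notMem hx]
      exact zero_le
  · refine mul_le_mul_right (lintegral_mono fun x => ?_) _
    refine indicator_le_indicator (lintegral_mono fun y => ?_)
    exact indicator_le_indicator_of_subset inter_subset_left (fun _ => zero_le) _

end Patterson

/-! ### Almost sure vague convergence to the autocorrelation. -/

section Autocorrelation

open Metric Config

/-- A continuous function equal to `1` on the ball of radius `n`, and to `0` outside of the ball of
radius `n + 1`. -/
def ballCutoff (E : Type*) [NormedAddCommGroup E] (n : ℕ) (x : E) : ℝ := max 0 (min 1 (n + 1 - ‖x‖))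

section Cutoff

variable {E : Type*} [NormedAddCommGroup E]

theorem continuous_ballCutoff (n : ℕ) : Continuous (ballCutoff E n) := by
  unfold ballCutoff
  fun_prop

theorem ballCutoff_nonneg (n : ℕ) (x : E) : 0 ≤ ballCutoff E n x := le_max_left _ _

theorem ballCutoff_eq_one {n : ℕ} {x : E} (hx : ‖x‖ ≤ n) : ballCutoff E n x = 1 := by
  rw [ballCutoff, min_eq_left (by linarith), max_eq_right zero_le_one]

theorem ballCutoff_eq_zero {n : ℕ} {x : E} (hx : (n : ℝ) + 1 ≤ ‖x‖) : ballCutoff E n x = 0 := by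
  rw [ballCutoff, max_eq_left]
  exact (min_le_right _ _).trans (by linarith)

theorem hasCompactSupport_ballCutoff [ProperSpace E] (n : ℕ) :
    HasCompactSupport (ballCutoff E n) := by
  refine HasCompactSupport.of_support_subset_isCompact
    (isCompact_closedBall (0 : E) (n + 1)) fun x hx => ?_
  rw [mem_closedBall, dist_zero_right]
  by_contra hlt
  exact hx (ballCutoff_eq_zero (not_le.1 hlt).le)

theorem abs_integral_sub_le [MeasurableSpace E] {f g k : E → ℝ}
    {μ : Measure E} (hf : Integrable f μ) (hg : Integrable g μ) (hk : Integrable k μ) {ε : ℝ}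
    (hfg : ∀ x, |f x - g x| ≤ ε * k x) : |∫ x, f x ∂μ - ∫ x, g x ∂μ| ≤ ε * ∫ x, k x ∂μ := by
  rw [← integral_sub hf hg, ← integral_const_mul]
  refine (abs_integral_le_integral_abs).trans (integral_mono (hf.sub hg).abs (hk.const_mul ε) hfg)

/-- To check the vague convergence of measures it suffices to check it on the products of the
functions of a dense sequence with cutoffs. -/
theorem tendsto_integral_of_denseRange [ProperSpace E] [MeasurableSpace E] [BorelSpace E]
    {P : ℝ → Measure E} {γ : Measure E} [IsLocallyFiniteMeasure γ]
    (hP : ∀ᶠ R in atTop, IsFiniteMeasure (P R)) {u : ℕ → C(E, ℝ)} (hu : DenseRange u)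
    (h1 : ∀ n, Tendsto (fun R => ∫ x, ballCutoff E n x ∂P R) atTop
      (𝓝 (∫ x, ballCutoff E n x ∂γ)))
    (h2 : ∀ j n, Tendsto (fun R => ∫ x, u j x * ballCutoff E n x ∂P R) atTop
      (𝓝 (∫ x, u j x * ballCutoff E n x ∂γ)))
    {f : E → ℝ} (hf : Continuous f) (hfc : HasCompactSupport f) :
    Tendsto (fun R => ∫ x, f x ∂P R) atTop (𝓝 (∫ x, f x ∂γ)) := by
  obtain ⟨r, hr⟩ := hfc.isCompact.isBounded.exists_norm_le
  obtain ⟨n, hn⟩ := exists_nat_ge r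
  set k := ballCutoff E n
  have hk := continuous_ballCutoff (E := E) n
  have hkc := hasCompactSupport_ballCutoff (E := E) n
  have hfk : ∀ x, f x = f x * k x := by
    intro x
    by_cases hx : x ∈ tsupport f
    · rw [show k x = 1 from ballCutoff_eq_one ((hr x hx).trans hn), mul_one]
    · rw [image_eq_zero_of_notMem_tsupport hx, zero_mul]
  set C := ∫ x, k x ∂γ
  have hC : 0 ≤ C := integral_nonneg (ballCutoff_nonneg n)
  rw [Metric.tendsto_nhds]
  intro ε hε
  -- Eventually the mass of `k` under `P R` is below `C + 1`, so replacing `f` by `u j * k` costs at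
  -- most `ε / 4` for `P R` and for `γ`.
  set δ := ε / (4 * (C + 1))
  have hδ : 0 < δ := by positivity
  obtain ⟨j, hj⟩ : ∃ j, ∀ x ∈ tsupport k, |f x - u j x| < δ := by
    have hev : ∀ᶠ g in 𝓝 (⟨f, hf⟩ : C(E, ℝ)), ∀ x ∈ tsupport k, dist (f x) (g x) < δ :=
      Metric.tendstoUniformlyOn_iff.1
        ((ContinuousMap.tendsto_iff_forall_isCompact_tendstoUniformlyOn
          (F := fun g : C(E, ℝ) => g)).1 tendsto_id _ hkc.isCompact) δ hδ
    obtain ⟨j, hj⟩ := hu.exists_mem_open isOpen_interior ⟨_, mem_interior_iff_mem_nhds.2 hev⟩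
    exact ⟨j, fun x hx => by simpa [Real.dist_eq] using interior_subset hj x hx⟩
  have hclose : ∀ x, |f x - u j x * k x| ≤ δ * k x := by
    intro x
    rw [hfk x, ← sub_mul, abs_mul, abs_of_nonneg (ballCutoff_nonneg n x)]
    by_cases hx : x ∈ tsupport k
    · exact mul_le_mul_of_nonneg_right (hj x hx).le (ballCutoff_nonneg n x)
    · have hk0 : ballCutoff E n x = 0 := image_eq_zero_of_notMem_tsupport hx
      simp [k, hk0]
  have huk : Continuous fun x => u j x * k x := (u j).continuous.mul hk
  have hukc : HasCompactSupport fun x => u j x * k x := hkc.mul_left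
  have hγ := abs_integral_sub_le (hf.integrable_of_hasCompactSupport hfc (μ := γ))
    (huk.integrable_of_hasCompactSupport hukc) (hk.integrable_of_hasCompactSupport hkc) hclose
  filter_upwards [hP, (h1 n).eventually_lt_const (show C < C + 1 by linarith),
    Metric.tendsto_nhds.1 (h2 j n) (ε / 4) (by positivity)] with R hfin hR1 hR2
  have hPR := abs_integral_sub_le (hf.integrable_of_hasCompactSupport hfc (μ := P R))
    (huk.integrable_of_hasCompactSupport hukc) (hk.integrable_of_hasCompactSupport hkc) hclose
  have hδC : δ * (C + 1) = ε / 4 := by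
    simp only [δ]
    field_simp
  have h3 : δ * ∫ x, k x ∂P R ≤ ε / 4 := by
    rw [← hδC]
    exact mul_le_mul_of_nonneg_left hR1.le hδ.le
  have h4 : δ * C ≤ ε / 4 := by
    rw [← hδC]
    exact mul_le_mul_of_nonneg_left (by linarith) hδ.le
  rw [Real.dist_eq] at hR2 ⊢
  rw [abs_lt] at hR2 ⊢
  have h5 := abs_le.1 hPR
  have h6 := abs_le.1 hγ
  constructor <;> linarith [h5.1, h5.2, h6.1, h6.2, hR2.1, hR2.2]

end Cutoff

variable {V : Type*} [NormedAddCommGroup V] [InnerProductSpace ℝ V] [FiniteDimensional ℝ V]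
  [MeasurableSpace V] [BorelSpace V]

theorem IsTranslationBounded.exists_measure_closedBall_le {μ : Measure V}
    (hμ : IsTranslationBounded μ) (r : ℝ) : ∃ C ≠ ∞, ∀ v, μ (closedBall v r) ≤ C := by
  obtain ⟨C, hC, hb⟩ := hμ
  obtain ⟨t, -, htf, ht⟩ := (isCompact_closedBall (0 : V) r).finite_cover_balls one_pos
  lift t to Finset V using htf
  refine ⟨∑ x ∈ t, C, (ENNReal.sum_lt_top.2 fun _ _ => hC.lt_top).ne, fun v => ?_⟩
  have hsub : closedBall v r ⊆ ⋃ x ∈ t, closedBall (v + x) 1 := by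
    intro y hy
    have hy' : y - v ∈ closedBall (0 : V) r := by
      rwa [mem_closedBall, dist_zero_right, ← dist_eq_norm]
    obtain ⟨x, hx, hyx⟩ := mem_iUnion₂.1 (ht hy')
    refine mem_iUnion₂.2 ⟨x, hx, ?_⟩
    rw [mem_ball, dist_eq_norm, sub_sub] at hyx
    rw [mem_closedBall, dist_eq_norm]
    exact hyx.le
  exact (measure_mono hsub).trans ((measure_biUnion_finset_le _ _).trans
    (Finset.sum_le_sum fun x _ => hb _))

variable {E F : Submodule ℝ V} {h : IsCompl E F} {W : Set F}

/-- The function `ψ` is bounded and vanishes beyond a radius `r`, so the points of `V` contributing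
to a unit ball centred at `u ∈ E` lie in the ball of radius `1 + r` around `u`. -/
theorem isTranslationBounded_cutAutocorrelation (hW : MeasurableSet W)
    (hWb : Bornology.IsBounded W) {c : Measure V} (hc : IsTranslationBounded c) {α : ℝ≥0∞}
    (hα : α ≠ ∞) : IsTranslationBounded (cutAutocorrelation h W α c) := by
  obtain ⟨r, hr⟩ := exists_windowAutocorr_eq_zero hW hWb
  obtain ⟨C, hC, hb⟩ := hc.exists_measure_closedBall_le (1 + |r|)
  refine ⟨α * (ENNReal.ofReal (volume.real W) * C),
    ENNReal.mul_ne_top hα (ENNReal.mul_ne_top ENNReal.ofReal_ne_top hC), fun u => ?_⟩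
  rw [← lintegral_indicator_one measurableSet_closedBall,
    lintegral_cutAutocorrelation hW (measurable_one.indicator measurableSet_closedBall)]
  gcongr
  calc _ ≤ ∫⁻ x, (closedBall (u : V) (1 + |r|)).indicator
        (fun _ => ENNReal.ofReal (volume.real W)) x ∂c := by
        refine lintegral_mono fun x => ?_
        by_cases hx : x ∈ closedBall (u : V) (1 + |r|)
        · rw [indicator_of_mem hx]
          refine (mul_le_mul' (ENNReal.ofReal_le_ofReal (windowAutocorr_le hW hWb _))
            (indicator_le_self' (fun _ _ => zero_le) _)).trans ?_
          rw [Pi.one_apply, mul_one]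
        · by_cases h1 : E.projectionOnto F h x ∈ closedBall u 1
          · rw [hr.2, ENNReal.ofReal_zero, zero_mul]
            · exact zero_le
            · by_contra hlt
              refine hx ?_
              have h2 := norm_le_projectionOnto h (x - u)
              rw [map_sub, map_sub, Submodule.projectionOnto_apply_left,
                Submodule.projectionOnto_apply_right, sub_zero] at h2
              rw [mem_closedBall, dist_eq_norm] at h1 ⊢
              linarith [le_abs_self r, not_lt.1 hlt]
          · rw [indicator_of_notMem h1, mul_zero]
            exact zero_le
    _ = ENNReal.ofReal (volume.real W) * c (closedBall (u : V) (1 + |r|)) := by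
        rw [lintegral_indicator measurableSet_closedBall, setLIntegral_const]
    _ ≤ _ := by
        gcongr
        exact hb _

theorem HasCompactSupport.boundedOnBall_ofReal {f : E → ℝ} (hf : Continuous f)
    (hfc : HasCompactSupport f) :
    ∃ (M : ℝ≥0∞) (r : ℝ), M ≠ ∞ ∧ BoundedOnBall (fun e => ENNReal.ofReal (f e)) M r := by
  obtain ⟨r, hr⟩ := hfc.isCompact.isBounded.exists_norm_le
  obtain ⟨M, hM⟩ := hf.bounded_above_of_compact_support hfc
  refine ⟨ENNReal.ofReal M, r, ENNReal.ofReal_ne_top, fun e =>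
    ENNReal.ofReal_le_ofReal ((le_abs_self _).trans (hM e)), fun e he => ?_⟩
  have h0 : f e = 0 :=
    image_eq_zero_of_notMem_tsupport fun hh => absurd (hr e hh) (not_le.2 he)
  simp only [h0, ENNReal.ofReal_zero]

variable {Ω : Type*} [MeasurableSpace Ω] {P : Measure Ω} {φ : Ω → Config V}

theorem ae_tendsto_integral_patterson [IsProbabilityMeasure P] (hφ : Measurable φ)
    (hstat : IsStationaryLaw (P.map φ)) (hsq : IsSquareIntegrable (P.map φ))
    (herg : IsErgodicUnder (P.map φ) E) {B : Set V} (hB : MeasurableSet B)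
    (hB0 : volume B ≠ 0) (hBt : volume B ≠ ∞) {α : ℝ≥0∞} (hα : α ≠ ∞)
    (hv : (volume : Measure V) =
      α • (volume.prod volume : Measure (E × F)).map (complSumEquiv h))
    (hW : MeasurableSet W) (hWb : Bornology.IsBounded W)
    (hinj : ∀ᵐ ω ∂P, InjOn (E.projectionOnto F h) ((φ ω).carrier ∩ strip h W))
    {f : E → ℝ} (hf : Continuous f) (hfc : HasCompactSupport f) :
    ∀ᵐ ω ∂P, Tendsto (fun R => ∫ e, f e ∂patterson (cutProject h W hWb (φ ω)) R) atTop
      (𝓝 (∫ e, f e ∂cutAutocorrelation h W α (intensity (palm (P.map φ) B hB)))) := by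
  have hm : IsProbabilityMeasure (P.map φ) := Measure.isProbabilityMeasure_map hφ.aemeasurable
  -- `ENNReal.ofReal` keeps only the positive part; applying this to `f` and `-f` recovers the
  -- signed integral.
  have key : ∀ f : E → ℝ, Continuous f → HasCompactSupport f → ∀ᵐ ω ∂P, Tendsto (fun R =>
      (∫⁻ e, ENNReal.ofReal (f e) ∂patterson (cutProject h W hWb (φ ω)) R).toReal) atTop
      (𝓝 (∫⁻ e, ENNReal.ofReal (f e)
        ∂cutAutocorrelation h W α (intensity (palm (P.map φ) B hB))).toReal) := by
    intro f hf hfc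
    obtain ⟨M, r, hM, hfb⟩ := HasCompactSupport.boundedOnBall_ofReal hf hfc
    have hfm : Measurable fun e => ENNReal.ofReal (f e) := hf.measurable.ennreal_ofReal
    have hae := ae_of_ae_map hφ.aemeasurable
      (hfb.ae_tendsto_pairSum hstat hsq herg hB hB0 hBt hv hW hWb hfm hM)
    filter_upwards [hae, hinj] with ω h1 h2
    refine tendsto_of_tendsto_of_tendsto_of_le_of_le' (h1 (-|r|)) (h1 0) ?_ ?_
    all_goals
      filter_upwards [eventually_gt_atTop 0] with R hR
      have hvR : (volume (closedBall (0 : E) R))⁻¹ ≠ ∞ :=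
        ENNReal.inv_ne_top.2 (measure_closedBall_pos _ _ hR).ne'
      obtain ⟨h3, h4⟩ := hfb.patterson_cutProject_bounds hW hWb h2 R hfm
      have hfin := ENNReal.mul_ne_top hvR
        (pairSum_lt_top (h := h) hWb hM hfb (R + 0) (φ ω)).ne
      have h5 : ∀ a : ℝ, (pairSum h W (fun e => ENNReal.ofReal (f e)) (closedBall 0 a) (φ ω)).toReal /
          volume.real (closedBall (0 : E) R) = ((volume (closedBall (0 : E) R))⁻¹ *
            pairSum h W (fun e => ENNReal.ofReal (f e)) (closedBall 0 a) (φ ω)).toReal := by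
        intro a
        rw [ENNReal.toReal_mul, ENNReal.toReal_inv, div_eq_inv_mul]
        rfl
      rw [h5]
    · exact ENNReal.toReal_mono (h4.trans_lt hfin.lt_top).ne h3
    · exact ENNReal.toReal_mono hfin h4
  have hlf := (isTranslationBounded_cutAutocorrelation (h := h) hW hWb
    (isTranslationBounded_intensity hstat hsq hB hB0 hBt) hα).isLocallyFiniteMeasure
  filter_upwards [key f hf hfc, key (fun e => -f e) hf.neg hfc.neg] with ω h1 h2
  rw [integral_eq_lintegral_pos_part_sub_lintegral_neg_part
    (hf.integrable_of_hasCompactSupport hfc)]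
  refine (h1.sub h2).congr' ?_
  filter_upwards [eventually_gt_atTop 0] with R hR
  have := isFiniteMeasure_patterson (cutProject h W hWb (φ ω)) hR
  rw [integral_eq_lintegral_pos_part_sub_lintegral_neg_part
    (hf.integrable_of_hasCompactSupport hfc)]

/-- The exceptional null set depends on the test function. Separability of `C(E, ℝ)` for locally
uniform convergence reduces the claim to countably many test functions. -/
theorem ae_hasAutocorrelation_cutProject [IsProbabilityMeasure P] (hφ : Measurable φ)
    (hstat : IsStationaryLaw (P.map φ)) (hsq : IsSquareIntegrable (P.map φ))
    (herg : IsErgodicUnder (P.map φ) E) {B : Set V} (hB : MeasurableSet B)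
    (hB0 : volume B ≠ 0) (hBt : volume B ≠ ∞) {α : ℝ≥0∞} (hα : α ≠ ∞)
    (hv : (volume : Measure V) =
      α • (volume.prod volume : Measure (E × F)).map (complSumEquiv h))
    (hW : MeasurableSet W) (hWb : Bornology.IsBounded W)
    (hinj : ∀ᵐ ω ∂P, InjOn (E.projectionOnto F h) ((φ ω).carrier ∩ strip h W)) :
    ∀ᵐ ω ∂P, HasAutocorrelation (cutProject h W hWb (φ ω))
      (cutAutocorrelation h W α (intensity (palm (P.map φ) B hB))) := by
  have hm : IsProbabilityMeasure (P.map φ) := Measure.isProbabilityMeasure_map hφ.aemeasurable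
  have hlf := (isTranslationBounded_cutAutocorrelation (h := h) hW hWb
    (isTranslationBounded_intensity hstat hsq hB hB0 hBt) hα).isLocallyFiniteMeasure
  have h1 : ∀ n, ∀ᵐ ω ∂P, _ := fun n => ae_tendsto_integral_patterson (h := h) hφ hstat hsq herg hB
    hB0 hBt hα hv hW hWb hinj (continuous_ballCutoff n) (hasCompactSupport_ballCutoff n)
  have h2 : ∀ j n, ∀ᵐ ω ∂P, _ := fun j n => ae_tendsto_integral_patterson (h := h) hφ hstat hsq herg
    hB hB0 hBt hα hv hW hWb hinj
    (((TopologicalSpace.denseSeq C(E, ℝ) j).continuous).mul (continuous_ballCutoff n))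
    (hasCompactSupport_ballCutoff n).mul_left
  filter_upwards [ae_all_iff.2 h1, ae_all_iff.2 fun j => ae_all_iff.2 (h2 j)] with ω h3 h4
  refine ⟨hlf, fun f hf hfc => ?_⟩
  refine tendsto_integral_of_denseRange ?_ (TopologicalSpace.denseRange_denseSeq C(E, ℝ)) h3 h4
    hf hfc
  filter_upwards [eventually_gt_atTop 0] with R hR
  exact isFiniteMeasure_patterson _ hR

end Autocorrelation

/-! ### Rapid decay and products of functions on `E` and `F`. -/

section RapidDecay

variable {V E F : Type*} [NormedAddCommGroup V] [InnerProductSpace ℝ V]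
  [NormedAddCommGroup E] [InnerProductSpace ℝ E]
  [NormedAddCommGroup F] [InnerProductSpace ℝ F]

/-- Functions that decay faster than any power. -/
def HasRapidDecay (f : E → ℂ) : Prop := ∀ k : ℕ, ∃ K : ℝ, ∀ x, (1 + ‖x‖) ^ k * ‖f x‖ ≤ K

theorem HasRapidDecay.mono {f g : E → ℂ} (hf : HasRapidDecay f) {C : ℝ}
    (h : ∀ x, ‖g x‖ ≤ C * ‖f x‖) : HasRapidDecay g := by
  intro k
  obtain ⟨K, hK⟩ := hf k
  refine ⟨|C| * K, fun x => ?_⟩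
  calc (1 + ‖x‖) ^ k * ‖g x‖ ≤ (1 + ‖x‖) ^ k * (|C| * ‖f x‖) := by
        gcongr
        exact (h x).trans (mul_le_mul_of_nonneg_right (le_abs_self C) (norm_nonneg _))
    _ = |C| * ((1 + ‖x‖) ^ k * ‖f x‖) := by ring
    _ ≤ _ := by
        gcongr
        exact hK x

theorem HasRapidDecay.comp_sub {f : E → ℂ} (hf : HasRapidDecay f) (u : E) :
    HasRapidDecay fun x => f (x - u) := by
  intro k
  obtain ⟨K, hK⟩ := hf k
  refine ⟨(1 + ‖u‖) ^ k * K, fun x => ?_⟩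
  have h1 : 1 + ‖x‖ ≤ (1 + ‖u‖) * (1 + ‖x - u‖) := by
    have h2 := norm_le_norm_add_norm_sub' x u
    nlinarith [norm_nonneg u, norm_nonneg (x - u)]
  calc (1 + ‖x‖) ^ k * ‖f (x - u)‖ ≤ ((1 + ‖u‖) * (1 + ‖x - u‖)) ^ k * ‖f (x - u)‖ := by gcongr
    _ = (1 + ‖u‖) ^ k * ((1 + ‖x - u‖) ^ k * ‖f (x - u)‖) := by rw [mul_pow, mul_assoc]
    _ ≤ _ := by
        gcongr
        exact hK _

theorem SchwartzMap.hasRapidDecay (f : 𝓢(E, ℂ)) : HasRapidDecay (f : E → ℂ) := by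
  intro k
  refine ⟨2 ^ k * ((Finset.Iic (k, 0)).sup fun m => SchwartzMap.seminorm ℝ m.1 m.2) f, fun x => ?_⟩
  have := SchwartzMap.one_add_le_sup_seminorm_apply (𝕜 := ℝ) (m := (k, 0)) (k := k) (n := 0)
    le_rfl le_rfl f x
  rwa [norm_iteratedFDeriv_zero] at this

theorem hasRapidDecay_gauss [FiniteDimensional ℝ E] [MeasurableSpace E] [BorelSpace E] {ε : ℝ}
    (hε : 0 < ε) : HasRapidDecay (gauss ε : E → ℂ) := by
  intro k
  obtain ⟨K, -, hK⟩ := exp_neg_mul_sq_le k (mul_pos Real.pi_pos hε)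
  refine ⟨K, fun x => ?_⟩
  have h := hK ‖x‖ (norm_nonneg x)
  rw [Real.rpow_neg (by positivity), Real.rpow_natCast, ← div_eq_mul_inv,
    le_div_iff₀ (by positivity)] at h
  rwa [norm_gauss, mul_comm]

/-- Since `1 + ‖y‖` is bounded by a multiple of `(1 + ‖A y‖)(1 + ‖A' y‖)`, each factor must decay to
the order `dim V + 1`, which exceeds what its own space would require. -/
theorem HasRapidDecay.hasPolyDecay_mul {p : E → ℂ} {q : F → ℂ} (hp : HasRapidDecay p)
    (hq : HasRapidDecay q) {A : V → E} {A' : V → F} {C : ℝ}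
    (hC : ∀ y, ‖y‖ ≤ C * (‖A y‖ + ‖A' y‖)) : HasPolyDecay fun y => p (A y) * q (A' y) := by
  set k := Module.finrank ℝ V + 1
  obtain ⟨K, hK⟩ := hp k
  obtain ⟨K', hK'⟩ := hq k
  refine ⟨(1 + |C|) ^ k * (K * K'), fun y => ?_⟩
  have h1 : 1 + ‖y‖ ≤ (1 + |C|) * ((1 + ‖A y‖) * (1 + ‖A' y‖)) := by
    have h2 := (hC y).trans (mul_le_mul_of_nonneg_right (le_abs_self C) (by positivity))
    nlinarith [norm_nonneg (A y), norm_nonneg (A' y), abs_nonneg C,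
      mul_nonneg (norm_nonneg (A y)) (norm_nonneg (A' y)),
      mul_nonneg (abs_nonneg C) (mul_nonneg (norm_nonneg (A y)) (norm_nonneg (A' y)))]
  have hK0 : 0 ≤ K := (by positivity : 0 ≤ (1 + ‖A y‖) ^ k * ‖p (A y)‖).trans (hK _)
  rw [polyWeight, Real.rpow_neg (by positivity), Real.rpow_natCast, ← div_eq_mul_inv,
    le_div_iff₀ (by positivity), norm_mul]
  calc ‖p (A y)‖ * ‖q (A' y)‖ * (1 + ‖y‖) ^ k
      ≤ ‖p (A y)‖ * ‖q (A' y)‖ * ((1 + |C|) * ((1 + ‖A y‖) * (1 + ‖A' y‖))) ^ k := by gcongr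
    _ = (1 + |C|) ^ k * (((1 + ‖A y‖) ^ k * ‖p (A y)‖) * ((1 + ‖A' y‖) ^ k * ‖q (A' y)‖)) := by
        rw [mul_pow, mul_pow]; ring
    _ ≤ _ := by
        gcongr
        · exact hK _
        · exact hK' _

end RapidDecay

/-! ### Duality between the oblique and the orthogonal projections. -/

section OrthPair

variable {V : Type*} [NormedAddCommGroup V] [InnerProductSpace ℝ V] [FiniteDimensional ℝ V]
  {E F : Submodule ℝ V}

/-- The pairing of `x_E ∈ E` with `y` only sees the orthogonal projection of `y` on `E`, and
likewise for `F`. This is why the oblique projections on the side of `c` become orthogonal ones on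
the Fourier side. -/
theorem inner_eq_projectionOnto (h : IsCompl E F) (x y : V) :
    inner ℝ x y = inner ℝ (E.projectionOnto F h x) (E.orthogonalProjectionOnto y) +
      inner ℝ (F.projectionOnto E h.symm x) (F.orthogonalProjectionOnto y) := by
  have h3 : (E.projectionOnto F h x : V) + (F.projectionOnto E h.symm x : V) = x := by
    simp only [Submodule.coe_projectionOnto_apply]
    exact Submodule.projection_add_projection_eq_self h x
  conv_lhs => rw [← h3]
  rw [inner_add_left, Submodule.inner_orthogonalProjectionOnto_eq_of_mem_left,
    Submodule.inner_orthogonalProjectionOnto_eq_of_mem_left]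

/-- The isomorphism given by the pair of the orthogonal projections on `E` and `F`, when
`V = E ⊕ F`. -/
def orthPairEquiv (h : IsCompl E F) : V ≃L[ℝ] E × F :=
  (LinearMap.linearEquivOfInjective
    ((E.orthogonalProjectionOnto.prod F.orthogonalProjectionOnto : V →L[ℝ] E × F) : V →ₗ[ℝ] E × F)
    (by
      rw [injective_iff_map_eq_zero]
      intro y hy
      have hE : E.orthogonalProjectionOnto y = 0 := congrArg Prod.fst hy
      have hF : F.orthogonalProjectionOnto y = 0 := congrArg Prod.snd hy
      have hyy : inner ℝ y y = 0 := by
        rw [inner_eq_projectionOnto h, hE, hF, inner_zero_right, inner_zero_right, add_zero]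
      exact inner_self_eq_zero.1 hyy)
    (complSumEquiv h).toLinearEquiv.finrank_eq.symm).toContinuousLinearEquiv

theorem orthPairEquiv_apply (h : IsCompl E F) (y : V) :
    orthPairEquiv h y = (E.orthogonalProjectionOnto y, F.orthogonalProjectionOnto y) := rfl

theorem exists_norm_le_orthogonalProjectionOnto (h : IsCompl E F) : ∃ C : ℝ, ∀ y : V,
    ‖y‖ ≤ C * (‖E.orthogonalProjectionOnto y‖ + ‖F.orthogonalProjectionOnto y‖) := by
  refine ⟨‖((orthPairEquiv h).symm : E × F →L[ℝ] V)‖, fun y => ?_⟩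
  have h1 := ((orthPairEquiv h).symm : E × F →L[ℝ] V).le_opNorm (orthPairEquiv h y)
  rw [ContinuousLinearEquiv.coe_coe, ContinuousLinearEquiv.symm_apply_apply] at h1
  refine h1.trans ?_
  gcongr
  rw [orthPairEquiv_apply, Prod.norm_def]
  exact max_le_add_of_nonneg (norm_nonneg _) (norm_nonneg _)

variable [MeasurableSpace V] [BorelSpace V]

theorem fourier_orthogonalProjectionOnto_mul {h : IsCompl E F} {β : ℝ≥0∞}
    (hβ : (volume : Measure V).map (orthPairEquiv h) = β • volume.prod volume)
    (p : E → ℂ) (q : F → ℂ) (x : V) :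
    𝓕 (fun y : V => p (E.orthogonalProjectionOnto y) * q (F.orthogonalProjectionOnto y)) x =
      β.toReal * (𝓕 p (E.projectionOnto F h x) * 𝓕 q (F.projectionOnto E h.symm x)) := by
  have hme : MeasurableEmbedding (orthPairEquiv h) :=
    (orthPairEquiv h).toHomeomorph.measurableEmbedding
  let g : E × F → ℂ := fun z =>
    (Real.fourierChar (-inner ℝ z.1 (E.projectionOnto F h x)) • p z.1) *
    (Real.fourierChar (-inner ℝ z.2 (F.projectionOnto E h.symm x)) • q z.2)
  have h1 : 𝓕 (fun y : V => p (E.orthogonalProjectionOnto y) * q (F.orthogonalProjectionOnto y)) x =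
      ∫ y, g (orthPairEquiv h y) := by
    rw [Real.fourier_eq]
    refine integral_congr_ae (Eventually.of_forall fun y => ?_)
    simp only [g, orthPairEquiv_apply]
    rw [real_inner_comm, inner_eq_projectionOnto h, neg_add, AddChar.map_add_eq_mul,
      real_inner_comm (E.projectionOnto F h x), real_inner_comm (F.projectionOnto E h.symm x)]
    simp only [Circle.smul_def, Circle.coe_mul, smul_eq_mul]
    ring
  have h2 : ∫ z, g z ∂volume.prod volume = 𝓕 p (E.projectionOnto F h x) *
      𝓕 q (F.projectionOnto E h.symm x) := by
    rw [Real.fourier_eq, Real.fourier_eq]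
    exact integral_prod_mul
      (fun u : E => Real.fourierChar (-inner ℝ u (E.projectionOnto F h x)) • p u)
      (fun v : F => Real.fourierChar (-inner ℝ v (F.projectionOnto E h.symm x)) • q v)
  rw [h1, ← hme.integral_map, hβ, integral_smul_measure, h2, Complex.real_smul]

/-- The pair of orthogonal projections is adjoint to the sum map `E × F → V`, so the two have the
same Jacobian. Here the constant `β` is found without determinants: the product Gaussian `G` has
transform `β` times a product Gaussian in `(x_E, x_F)`, and Fourier inversion at `0` reads `1 = G 0
= β α`. -/
theorem map_orthPairEquiv {h : IsCompl E F} {α : ℝ≥0∞}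
    (hv : (volume : Measure V) = α • (volume.prod volume : Measure (E × F)).map (complSumEquiv h)) :
    (volume : Measure V).map (orthPairEquiv h) = α⁻¹ • volume.prod volume := by
  set ρ : Measure (E × F) := (volume : Measure V).map (orthPairEquiv h)
  have hρ : ρ.IsAddHaarMeasure := (orthPairEquiv h).isAddHaarMeasure_map _
  set β := ρ.addHaarScalarFactor (volume.prod volume)
  have hβ : ρ = (β : ℝ≥0∞) • volume.prod volume := by
    have := Measure.isAddLeftInvariant_eq_smul ρ (volume.prod volume)
    rw [this]
    rfl
  suffices hαβ : (β : ℝ≥0∞) = α⁻¹ by rw [hβ, hαβ]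
  let G : V → ℂ := fun y =>
    gauss 1 (E.orthogonalProjectionOnto y) * gauss 1 (F.orthogonalProjectionOnto y)
  have hG : Continuous G := ((continuous_gauss 1).comp (map_continuous _)).mul
    ((continuous_gauss 1).comp (map_continuous _))
  have hF : 𝓕 G = fun x => (β : ℝ) * (gauss 1 (E.projectionOnto F h x) *
      gauss 1 (F.projectionOnto E h.symm x)) := by
    funext x
    rw [fourier_orthogonalProjectionOnto_mul hβ, fourier_gauss_one, fourier_gauss_one]
    rfl
  have hint1 : ∀ {H : Type _} [NormedAddCommGroup H] [InnerProductSpace ℝ H] [FiniteDimensional ℝ H]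
      [MeasurableSpace H] [BorelSpace H], ∫ x : H, gauss 1 x = 1 := by
    intro H _ _ _ _ _
    have h1 := fourier_gauss_one (0 : H)
    rw [Real.fourier_eq] at h1
    simpa [gauss] using h1
  obtain ⟨C, hC⟩ := exists_norm_le_orthogonalProjectionOnto h
  have hGi : Integrable G := isTranslationBounded_volume.integrable hG.aestronglyMeasurable
    ((hasRapidDecay_gauss one_pos).hasPolyDecay_mul (hasRapidDecay_gauss one_pos) hC)
  have hFi : Integrable (𝓕 G) := by
    refine isTranslationBounded_volume.integrable
      (VectorFourier.fourierIntegral_continuous Real.continuous_fourierChar continuous_inner_pair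
        hGi).aestronglyMeasurable ?_
    obtain ⟨K, hK⟩ := (hasRapidDecay_gauss (E := E) one_pos).hasPolyDecay_mul
      (hasRapidDecay_gauss (E := F) one_pos) (C := 1)
      (fun x => (norm_le_projectionOnto h x).trans_eq (one_mul _).symm)
    refine ⟨β * K, fun x => ?_⟩
    rw [hF, norm_mul, Complex.norm_real, Real.norm_of_nonneg β.coe_nonneg, mul_assoc]
    gcongr
    exact hK x
  have hinv := congrFun (hG.fourierInv_fourier_eq hGi hFi) 0
  rw [Real.fourierInv_eq] at hinv
  simp only [inner_zero_right, AddChar.map_zero_eq_one, one_smul] at hinv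
  have hme : MeasurableEmbedding (complSumEquiv h) :=
    (complSumEquiv h).toHomeomorph.measurableEmbedding
  rw [hF, integral_const_mul, hv, integral_smul_measure, hme.integral_map] at hinv
  simp only [projectionOnto_complSumEquiv_left, projectionOnto_complSumEquiv_right] at hinv
  rw [integral_prod_mul, hint1, hint1] at hinv
  have h1 : (β : ℝ) * α.toReal = 1 := by
    have h2 : ((β : ℝ) : ℂ) * (α.toReal : ℂ) = 1 := by
      simpa [G, gauss] using hinv
    exact_mod_cast h2
  refine ENNReal.eq_inv_of_mul_eq_one_left ((ENNReal.toReal_eq_one_iff _).1 ?_)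
  rw [ENNReal.toReal_mul]
  exact h1

end OrthPair

/-! ### Gaussian summability of Fourier integrals, with uniform bounds. -/

section GaussianRegularization

variable {V : Type*} [NormedAddCommGroup V] [InnerProductSpace ℝ V] [FiniteDimensional ℝ V]
  [MeasurableSpace V] [BorelSpace V]

/-- The heat kernel, i.e. the Fourier transform of `gauss s⁻¹`. -/
def heat (s : ℝ) (x : V) : ℝ :=
  s ^ (Module.finrank ℝ V / 2 : ℝ) * Real.exp (-(Real.pi * s) * ‖x‖ ^ 2)

theorem ofReal_heat {s : ℝ} (hs : 0 ≤ s) (x : V) : (heat s x : ℂ) =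
    (s : ℂ) ^ (Module.finrank ℝ V / 2 : ℂ) * Complex.exp (-(Real.pi * s) * ‖x‖ ^ 2) := by
  rw [heat, Complex.ofReal_mul, Complex.ofReal_cpow hs]
  push_cast
  rfl

theorem fourier_gauss_mul_cexp {s : ℝ} (hs : 0 < s) (x w : V) :
    𝓕 (fun v : V => gauss s⁻¹ v * Complex.exp (2 * Real.pi * Complex.I * inner ℝ x v)) w =
      heat s (x - w) := by
  have hpi := Real.pi_pos
  have h1 : (fun v : V => gauss s⁻¹ v * Complex.exp (2 * Real.pi * Complex.I * inner ℝ x v)) =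
      fun v => Complex.exp (-((Real.pi * s⁻¹ : ℝ) : ℂ) * ‖v‖ ^ 2 +
        2 * Real.pi * Complex.I * inner ℝ x v) := by
    funext v
    rw [Complex.exp_add, gauss]
    push_cast
    rfl
  have hb : 0 < Complex.re ((Real.pi * s⁻¹ : ℝ) : ℂ) := by
    rw [Complex.ofReal_re]; positivity
  rw [h1, fourier_gaussian_innerProductSpace' hb, ofReal_heat hs.le]
  have hpi' : (Real.pi : ℂ) ≠ 0 := by exact_mod_cast Real.pi_ne_zero
  have hs' : (s : ℂ) ≠ 0 := by exact_mod_cast hs.ne'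
  congr 1
  · push_cast
    congr 1
    field_simp
  · push_cast
    congr 1
    field_simp

theorem integrable_gauss {ε : ℝ} (hε : 0 < ε) : Integrable (gauss ε : V → ℂ) :=
  isTranslationBounded_volume.integrable (continuous_gauss ε).aestronglyMeasurable
    (hasPolyDecay_gauss hε)

/-- Self-adjointness moves the transform onto the Gaussian, which becomes a heat kernel.
Transforming forward twice reflects, so the kernel concentrates at `-x`. -/
theorem fourier_gauss_mul_fourier {f : V → ℂ} (hf : Integrable f) {s : ℝ} (hs : 0 < s) (x : V) :
    𝓕 (fun v => gauss s⁻¹ v * 𝓕 f v) x = ∫ w, heat s (x + w) • f w := by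
  have hcont : Continuous fun v : V =>
      gauss s⁻¹ v * Complex.exp (2 * Real.pi * Complex.I * inner ℝ (-x) v) :=
    (continuous_gauss _).mul (by fun_prop)
  have hi : Integrable fun v : V =>
      gauss s⁻¹ v * Complex.exp (2 * Real.pi * Complex.I * inner ℝ (-x) v) := by
    refine (integrable_gauss (inv_pos.2 hs)).mono hcont.aestronglyMeasurable
      (Eventually.of_forall fun v => ?_)
    rw [norm_mul, show (2 * Real.pi * Complex.I * inner ℝ (-x) v : ℂ) =
      ((2 * Real.pi * inner ℝ (-x) v : ℝ) : ℂ) * Complex.I by push_cast; ring,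
      Complex.norm_exp_ofReal_mul_I, mul_one]
  have hflip : (innerₗ V).flip = innerₗ V := by ext x y; exact real_inner_comm _ _
  have h1 := VectorFourier.integral_fourierIntegral_smul_eq_flip (μ := volume) (ν := volume)
    (L := innerₗ V) Real.continuous_fourierChar continuous_inner_pair hi hf
  rw [hflip] at h1
  have h2 : 𝓕 (fun v => gauss s⁻¹ v * 𝓕 f v) x = ∫ v, (gauss s⁻¹ v *
      Complex.exp (2 * Real.pi * Complex.I * inner ℝ (-x) v)) • 𝓕 f v := by
    rw [Real.fourier_eq']
    refine integral_congr_ae (Eventually.of_forall fun v => ?_)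
    simp only [smul_eq_mul, inner_neg_left, real_inner_comm x v]
    rw [show ((-2 * Real.pi * inner ℝ x v : ℝ) : ℂ) * Complex.I =
      2 * Real.pi * Complex.I * ((-inner ℝ x v : ℝ) : ℂ) by push_cast; ring]
    ring
  rw [h2]
  refine h1.symm.trans (integral_congr_ae (Eventually.of_forall fun w => ?_))
  have h3 := fourier_gauss_mul_cexp hs (-x) w
  have h4 : heat s (-x - w) = heat s (x + w) := by
    rw [show -x - w = -(x + w) by abel, heat, heat, norm_neg]
  rw [h4] at h3
  change 𝓕 (fun v : V => gauss s⁻¹ v * Complex.exp (2 * Real.pi * Complex.I * inner ℝ (-x) v)) w •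
    f w = _
  rw [h3, Complex.coe_smul]

theorem tendsto_fourier_gauss_mul_fourier {f : V → ℂ} (hf : Integrable f) {x : V}
    (hx : ContinuousAt f (-x)) :
    Tendsto (fun s : ℝ => 𝓕 (fun v => gauss s⁻¹ v * 𝓕 f v) x) atTop (𝓝 (f (-x))) := by
  have hpi := Real.pi_pos
  have h1 := (Real.tendsto_integral_gaussian_smul' hf hx).comp
    (tendsto_id.const_mul_atTop (inv_pos.2 hpi))
  refine h1.congr' ?_
  filter_upwards [eventually_gt_atTop 0] with s hs
  rw [fourier_gauss_mul_fourier hf hs]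
  refine integral_congr_ae (Eventually.of_forall fun w => ?_)
  have hpi' : (Real.pi : ℂ) ≠ 0 := by exact_mod_cast Real.pi_ne_zero
  have h4 : heat s (x + w) = heat s (-x - w) := by
    rw [show -x - w = -(x + w) by abel, heat, heat, norm_neg]
  simp only [h4, id]
  rw [← Complex.coe_smul, ofReal_heat hs.le]
  congr 2
  · push_cast
    congr 1
    field_simp
  · push_cast
    congr 1
    field_simp

theorem integral_heat {s : ℝ} (hs : 0 < s) (x : V) : ∫ w, heat s (x + w) = 1 := by
  have hpi := Real.pi_pos
  rw [integral_add_left_eq_self (heat s) x]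
  simp only [heat]
  rw [integral_const_mul, GaussianFourier.integral_rexp_neg_mul_sq_norm (by positivity),
    ← Real.mul_rpow hs.le (by positivity)]
  rw [show s * (Real.pi / (Real.pi * s)) = 1 by field_simp, Real.one_rpow]

/-- Half of the exponent is kept as the kernel of parameter `s / 2`. As `s ≥ 1`, the other half is
at least `π/2 ‖x + w‖²`, which bounds `π/4 ‖x‖² - π/2 r²` from above. The constant is thus
independent of `s`. -/
theorem heat_le {s r : ℝ} (hs : 1 ≤ s) {x w : V} (hw : ‖w‖ ≤ r) :
    heat s (x + w) ≤ 2 ^ (Module.finrank ℝ V / 2 : ℝ) * Real.exp (Real.pi / 2 * r ^ 2) *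
      Real.exp (-(Real.pi * 4⁻¹) * ‖x‖ ^ 2) * heat (s / 2) (x + w) := by
  have hpi := Real.pi_pos
  have hs0 : 0 < s := by linarith
  have h1 : ‖x‖ ^ 2 ≤ 2 * ‖x + w‖ ^ 2 + 2 * r ^ 2 := by
    have h2 : ‖x‖ ≤ ‖x + w‖ + ‖w‖ := by simpa using norm_sub_le (x + w) w
    nlinarith [norm_nonneg x, norm_nonneg (x + w), norm_nonneg w, sq_nonneg (‖x + w‖ - ‖w‖)]
  have h3 : (s : ℝ) ^ (Module.finrank ℝ V / 2 : ℝ) =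
      2 ^ (Module.finrank ℝ V / 2 : ℝ) * (s / 2) ^ (Module.finrank ℝ V / 2 : ℝ) := by
    rw [← Real.mul_rpow (by norm_num) (by positivity)]
    congr 1
    ring
  have h4 : Real.exp (-(Real.pi * s) * ‖x + w‖ ^ 2) ≤ Real.exp (Real.pi / 2 * r ^ 2) *
      Real.exp (-(Real.pi * 4⁻¹) * ‖x‖ ^ 2) * Real.exp (-(Real.pi * (s / 2)) * ‖x + w‖ ^ 2) := by
    rw [← Real.exp_add, ← Real.exp_add, Real.exp_le_exp]
    have h5 : 0 ≤ Real.pi * (s - 1) * ‖x + w‖ ^ 2 := by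
      have : 0 ≤ s - 1 := by linarith
      positivity
    nlinarith
  calc heat s (x + w) ≤ (2 ^ (Module.finrank ℝ V / 2 : ℝ) * (s / 2) ^ (Module.finrank ℝ V / 2 : ℝ)) *
        (Real.exp (Real.pi / 2 * r ^ 2) * Real.exp (-(Real.pi * 4⁻¹) * ‖x‖ ^ 2) *
          Real.exp (-(Real.pi * (s / 2)) * ‖x + w‖ ^ 2)) := by
        rw [heat, h3]
        gcongr
    _ = _ := by rw [heat]; ring

/-- The regularizations of a bounded function of compact support are uniformly dominated by a
Gaussian. -/
theorem exists_norm_fourier_gauss_mul_fourier_le {f : V → ℂ} (hf : Integrable f) {M r : ℝ}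
    (hM : ∀ x, ‖f x‖ ≤ M) (hr : ∀ x, r < ‖x‖ → f x = 0) :
    ∃ K, ∀ s, 1 ≤ s → ∀ x, ‖𝓕 (fun v => gauss s⁻¹ v * 𝓕 f v) x‖ ≤ K * ‖gauss 4⁻¹ x‖ := by
  have hM0 : 0 ≤ M := (norm_nonneg _).trans (hM 0)
  refine ⟨2 ^ (Module.finrank ℝ V / 2 : ℝ) * Real.exp (Real.pi / 2 * r ^ 2) * M,
    fun s hs x => ?_⟩
  have hs0 : 0 < s := by linarith
  have hnn : ∀ s' : ℝ, 0 < s' → ∀ y : V, 0 ≤ heat s' y := fun s' hs' y => by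
    unfold heat; positivity
  have hhi : Integrable fun w => heat (s / 2) (x + w) := by
    -- The integral of a nonintegrable function is `0` by convention, while this one is `1`.
    by_contra hni
    have := integral_heat (half_pos hs0) x
    rw [integral_undef hni] at this
    exact zero_ne_one this
  set D := 2 ^ (Module.finrank ℝ V / 2 : ℝ) * Real.exp (Real.pi / 2 * r ^ 2) *
      Real.exp (-(Real.pi * 4⁻¹) * ‖x‖ ^ 2)
  rw [fourier_gauss_mul_fourier hf hs0, norm_gauss]
  calc ‖∫ w, heat s (x + w) • f w‖ ≤ ∫ w, D * M * heat (s / 2) (x + w) := by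
        refine norm_integral_le_of_norm_le (hhi.const_mul _) (Eventually.of_forall fun w => ?_)
        have h0 := hnn (s / 2) (half_pos hs0) (x + w)
        by_cases hw : r < ‖w‖
        · rw [hr w hw, smul_zero, norm_zero]
          positivity
        · rw [norm_smul, Real.norm_of_nonneg (hnn s hs0 _)]
          calc heat s (x + w) * ‖f w‖ ≤ (D * heat (s / 2) (x + w)) * M := by
                gcongr
                · exact heat_le hs (not_lt.1 hw)
                · exact hM w
            _ = _ := by ring
    _ = D * M := by rw [integral_const_mul, integral_heat (half_pos hs0), mul_one]
    _ = _ := by simp only [D]; ring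

end GaussianRegularization

/-! ### Continuity of `ψ` and positivity of its Fourier transform. -/

section Window

variable {V : Type*} [NormedAddCommGroup V] [InnerProductSpace ℝ V] [FiniteDimensional ℝ V]
  [MeasurableSpace V] [BorelSpace V] {F : Submodule ℝ V} {W : Set F}

-- The values at `y` and `z` differ at most by the measure of the symmetric difference of `W - y`
-- and `W - z`, and translation is continuous in measure.
open scoped symmDiff in
theorem continuous_windowAutocorr (hW : MeasurableSet W) (hWb : Bornology.IsBounded W) :
    Continuous (windowAutocorr W) := by
  rw [continuous_iff_continuousAt]
  intro z
  let T : C(F, C(F, F)) := ContinuousMap.curry ⟨fun p : F × F => p.2 + p.1, by fun_prop⟩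
  have hT : ∀ z : F, (T z : F → F) = fun u => u + z := fun z => rfl
  have hmp : ∀ z : F, MeasurePreserving (T z) (volume : Measure F) volume := fun z =>
    measurePreserving_add_right volume z
  have hWt : volume W ≠ ∞ := hWb.measure_lt_top.ne
  have h1 := tendsto_measure_symmDiff_preimage_nhds_zero (T.continuous.tendsto z)
    (Eventually.of_forall hmp) (hmp z) hW.nullMeasurableSet hWt
  have hpre : ∀ z : F, MeasurableSet (T z ⁻¹' W) := fun z => (hmp z).measurable hW
  have hpret : ∀ z : F, volume (T z ⁻¹' W) ≠ ∞ := fun z => by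
    rw [(hmp z).measure_preimage hW.nullMeasurableSet]
    exact hWt
  have h2 : Tendsto (fun y => volume.real ((T y ⁻¹' W) ∆ (T z ⁻¹' W))) (𝓝 z) (𝓝 0) := by
    have h3 := (ENNReal.tendsto_toReal ENNReal.zero_ne_top).comp h1
    rwa [ENNReal.toReal_zero] at h3
  rw [ContinuousAt, tendsto_iff_dist_tendsto_zero]
  refine squeeze_zero (fun _ => dist_nonneg) (fun y => ?_) h2
  rw [windowAutocorr_eq hW, windowAutocorr_eq hW, Real.dist_eq]
  have key : ∀ y z : F, volume.real (W ∩ T y ⁻¹' W) ≤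
      volume.real (W ∩ T z ⁻¹' W) + volume.real ((T y ⁻¹' W) ∆ (T z ⁻¹' W)) := by
    intro y z
    refine (measureReal_mono ?_ ?_).trans (measureReal_union_le _ _)
    · rintro u ⟨hu, huy⟩
      by_cases huz : u ∈ T z ⁻¹' W
      · exact Or.inl ⟨hu, huz⟩
      · exact Or.inr (Or.inl ⟨huy, huz⟩)
    · refine (measure_union_lt_top ((measure_mono inter_subset_left).trans_lt hWt.lt_top) ?_).ne
      exact (measure_mono symmDiff_subset_union).trans_lt
        (measure_union_lt_top (hpret y).lt_top (hpret z).lt_top)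
  have k1 := key y z
  have k2 := key z y
  rw [symmDiff_comm] at k2
  rw [abs_le]
  simp only [hT] at k1 k2 ⊢
  constructor <;> linarith

theorem windowAutocorr_neg (hW : MeasurableSet W) (z : F) :
    windowAutocorr W (-z) = windowAutocorr W z := by
  rw [windowAutocorr_eq hW, windowAutocorr_eq hW]
  have h1 := (measurePreserving_add_right (volume : Measure F) z).measureReal_preimage
    (hW.inter ((measurable_add_const (-z)) hW)).nullMeasurableSet
  rw [← h1]
  congr 1
  ext u
  simp [and_comm]

theorem integrable_windowAutocorr (hW : MeasurableSet W) (hWb : Bornology.IsBounded W) :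
    Integrable fun z => (windowAutocorr W z : ℂ) := by
  obtain ⟨r, -, hr⟩ := exists_windowAutocorr_eq_zero hW hWb
  refine Continuous.integrable_of_hasCompactSupport
    (Complex.continuous_ofReal.comp (continuous_windowAutocorr hW hWb))
    (HasCompactSupport.of_support_subset_isCompact (isCompact_closedBall (0 : F) r) fun z hz => ?_)
  rw [mem_closedBall_zero_iff]
  by_contra hlt
  refine hz ?_
  simp only [hr z (not_le.1 hlt), Complex.ofReal_zero]

/-- The convolution theorem; as `1_W` is real, the transform of `1_{-W}` is the conjugate of that of
`1_W`. -/
theorem fourier_windowAutocorr (hW : MeasurableSet W) (hWb : Bornology.IsBounded W) (y : F) :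
    𝓕 (fun z => (windowAutocorr W z : ℂ)) y =
      (‖𝓕 (W.indicator fun _ => (1 : ℂ)) y‖ ^ 2 : ℝ) := by
  have hWn : MeasurableSet (-W) := hW.neg
  have hint : ∀ S : Set F, MeasurableSet S → Bornology.IsBounded S →
      Integrable (S.indicator fun _ => (1 : ℂ)) := fun S hS hb =>
    (integrable_indicator_iff hS).2 (integrableOn_const hb.measure_lt_top.ne)
  have h1 : (fun z => (windowAutocorr W z : ℂ)) = convolution (W.indicator fun _ => (1 : ℂ))
      ((-W).indicator fun _ => (1 : ℂ)) (ContinuousLinearMap.mul ℂ ℂ) volume := by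
    funext z
    rw [windowAutocorr, convolution_def, convolution_def, ← integral_complex_ofReal]
    refine integral_congr_ae (Eventually.of_forall fun u => ?_)
    by_cases h1 : u ∈ W <;> by_cases h2 : z - u ∈ -W <;> simp [h1, h2]
  have h2 : 𝓕 ((-W).indicator fun _ => (1 : ℂ)) y =
      (starRingEnd ℂ) (𝓕 (W.indicator fun _ => (1 : ℂ)) y) := by
    rw [Real.fourier_eq', Real.fourier_eq', ← integral_conj, ← integral_neg_eq_self]
    refine integral_congr_ae (Eventually.of_forall fun u => ?_)
    have h3 : ((-W).indicator (fun _ => (1 : ℂ)) (-u)) = W.indicator (fun _ => (1 : ℂ)) u := by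
      by_cases hu : u ∈ W <;> simp [hu]
    have h4 : (starRingEnd ℂ) (W.indicator (fun _ => (1 : ℂ)) u) =
        W.indicator (fun _ => (1 : ℂ)) u := by
      by_cases hu : u ∈ W <;> simp [hu]
    simp only [h3, smul_eq_mul, map_mul, h4, ← Complex.exp_conj, Complex.conj_ofReal,
      Complex.conj_I, inner_neg_left]
    congr 2
    push_cast
    ring
  rw [h1, Real.fourier_mul_convolution_eq (hint W hW hWb) (hint _ hWn hWb.neg), h2,
    Complex.mul_conj, Complex.normSq_eq_norm_sq]

theorem windowIntensity_eq (hW : MeasurableSet W) (hWb : Bornology.IsBounded W) (y : F) :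
    windowIntensity W y = ‖𝓕 (W.indicator fun _ => (1 : ℂ)) y‖ ^ 2 := by
  rw [windowIntensity, fourier_windowAutocorr hW hWb, Complex.ofReal_re]

theorem windowIntensity_nonneg (hW : MeasurableSet W) (hWb : Bornology.IsBounded W) (y : F) :
    0 ≤ windowIntensity W y := by
  rw [windowIntensity_eq hW hWb]; positivity

theorem ofReal_windowIntensity (hW : MeasurableSet W) (hWb : Bornology.IsBounded W) (y : F) :
    (windowIntensity W y : ℂ) = 𝓕 (fun z => (windowAutocorr W z : ℂ)) y := by
  rw [windowIntensity_eq hW hWb, fourier_windowAutocorr hW hWb]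

theorem continuous_windowIntensity (hW : MeasurableSet W) (hWb : Bornology.IsBounded W) :
    Continuous (windowIntensity W) :=
  Complex.continuous_re.comp (VectorFourier.fourierIntegral_continuous Real.continuous_fourierChar
    continuous_inner_pair (integrable_windowAutocorr hW hWb))

end Window

/-! ### The diffraction measure. -/

section Diffraction

open Metric

variable {V : Type*} [NormedAddCommGroup V] [InnerProductSpace ℝ V] [FiniteDimensional ℝ V]
  [MeasurableSpace V] [BorelSpace V]

theorem HasRapidDecay.hasPolyDecay {f : V → ℂ} (hf : HasRapidDecay f) : HasPolyDecay f := by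
  obtain ⟨K, hK⟩ := hf (Module.finrank ℝ V + 1)
  refine ⟨K, fun x => ?_⟩
  rw [polyWeight, Real.rpow_neg (by positivity), Real.rpow_natCast, ← div_eq_mul_inv,
    le_div_iff₀ (by positivity), mul_comm]
  exact hK x

theorem hasRapidDecay_fourier_gauss_sub (u : V) :
    HasRapidDecay (𝓕 fun v : V => gauss 1 (v - u)) := by
  refine (hasRapidDecay_gauss one_pos).mono (C := 1) fun w => ?_
  rw [norm_fourier_gauss_sub, norm_gauss, one_mul, mul_one]

variable {E F : Submodule ℝ V} {h : IsCompl E F} {W : Set F}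

/-- The product of `ψ̂` with the Gaussian `gauss s⁻¹`. -/
def regularizedIntensity (W : Set F) (s : ℝ) (v : F) : ℂ :=
  gauss s⁻¹ v * 𝓕 (fun z => (windowAutocorr W z : ℂ)) v

theorem continuous_regularizedIntensity (hW : MeasurableSet W) (hWb : Bornology.IsBounded W)
    (s : ℝ) : Continuous (regularizedIntensity W s) :=
  (continuous_gauss _).mul (VectorFourier.fourierIntegral_continuous Real.continuous_fourierChar
    continuous_inner_pair (integrable_windowAutocorr hW hWb))

theorem hasRapidDecay_regularizedIntensity (W : Set F) {s : ℝ} (hs : 0 < s) :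
    HasRapidDecay (regularizedIntensity W s) := by
  refine (hasRapidDecay_gauss (inv_pos.2 hs)).mono
    (C := ∫ z, ‖(windowAutocorr W z : ℂ)‖) fun v => ?_
  rw [regularizedIntensity, norm_mul, mul_comm]
  gcongr
  exact VectorFourier.norm_fourierIntegral_le_integral_norm _ _ _ _ _

theorem exists_norm_fourier_regularizedIntensity_le (hW : MeasurableSet W)
    (hWb : Bornology.IsBounded W) : ∃ K : ℝ, 0 ≤ K ∧ ∀ s, 1 ≤ s → ∀ x,
      ‖𝓕 (regularizedIntensity W s) x‖ ≤ K * ‖gauss 4⁻¹ x‖ := by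
  obtain ⟨r, -, hr⟩ := exists_windowAutocorr_eq_zero hW hWb
  obtain ⟨K, hK⟩ := exists_norm_fourier_gauss_mul_fourier_le (M := volume.real W) (r := r)
    (integrable_windowAutocorr hW hWb)
    (fun x => by
      rw [Complex.norm_real, Real.norm_of_nonneg (windowAutocorr_nonneg hW x)]
      exact windowAutocorr_le hW hWb x)
    (fun x hx => by rw [hr x hx, Complex.ofReal_zero])
  exact ⟨|K|, abs_nonneg K, fun s hs x => (hK s hs x).trans
    (mul_le_mul_of_nonneg_right (le_abs_self K) (norm_nonneg _))⟩

theorem tendsto_fourier_regularizedIntensity (hW : MeasurableSet W)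
    (hWb : Bornology.IsBounded W) (x : F) :
    Tendsto (fun s => 𝓕 (regularizedIntensity W s) x) atTop (𝓝 (windowAutocorr W x : ℂ)) := by
  have h1 := tendsto_fourier_gauss_mul_fourier (integrable_windowAutocorr hW hWb) (x := x)
    (Complex.continuous_ofReal.comp (continuous_windowAutocorr hW hWb)).continuousAt
  rwa [windowAutocorr_neg hW] at h1

theorem tendsto_regularizedIntensity (hW : MeasurableSet W) (hWb : Bornology.IsBounded W) (v : F) :
    Tendsto (fun s => regularizedIntensity W s v) atTop (𝓝 (windowIntensity W v : ℂ)) := by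
  rw [ofReal_windowIntensity hW hWb]
  have h1 : Tendsto (fun s : ℝ => gauss s⁻¹ v) atTop (𝓝 1) := by
    have h2 : Continuous fun ε : ℝ => gauss ε v := by
      unfold gauss; fun_prop
    have h3 := (h2.tendsto 0).comp tendsto_inv_atTop_zero
    have h0 : gauss 0 v = 1 := by simp [gauss]
    rwa [h0] at h3
  have h4 := h1.mul_const (𝓕 (fun z => (windowAutocorr W z : ℂ)) v)
  rwa [one_mul] at h4

theorem norm_regularizedIntensity_le (hW : MeasurableSet W) (hWb : Bornology.IsBounded W) {s : ℝ}
    (hs : 0 < s) (v : F) : ‖regularizedIntensity W s v‖ ≤ windowIntensity W v := by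
  rw [regularizedIntensity, ← ofReal_windowIntensity hW hWb, norm_mul, Complex.norm_real,
    Real.norm_of_nonneg (windowIntensity_nonneg hW hWb v)]
  exact mul_le_of_le_one_left (windowIntensity_nonneg hW hWb v)
    (norm_gauss_le_one (inv_pos.2 hs).le v)

variable {c η : Measure V} {α : ℝ≥0∞}

/-- `η` is the Fourier transform of `c`, tested on continuous functions of sufficient decay. -/
def IsFourierPair (c η : Measure V) : Prop := ∀ f : V → ℂ, Continuous f → HasPolyDecay f →
  HasPolyDecay (𝓕 f) → ∫ x, 𝓕 f x ∂c = ∫ x, f x ∂η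

theorem hasPolyDecay_mul_regularizedIntensity (h : IsCompl E F) (W : Set F) {f : E → ℂ}
    (hf : HasRapidDecay f) {s : ℝ} (hs : 0 < s) : HasPolyDecay fun y : V =>
      f (E.orthogonalProjectionOnto y) * regularizedIntensity W s (F.orthogonalProjectionOnto y) := by
  obtain ⟨C, hC⟩ := exists_norm_le_orthogonalProjectionOnto h
  exact hf.hasPolyDecay_mul (hasRapidDecay_regularizedIntensity W hs) hC

theorem hasPolyDecay_mul_projectionOnto (h : IsCompl E F) {p : E → ℂ} {q : F → ℂ}
    (hp : HasRapidDecay p) (hq : HasRapidDecay q) : HasPolyDecay fun x : V =>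
      p (E.projectionOnto F h x) * q (F.projectionOnto E h.symm x) :=
  hp.hasPolyDecay_mul hq (C := 1) fun x => (norm_le_projectionOnto h x).trans_eq (one_mul _).symm

/-- The Gaussian factor makes the product decay in all directions of `V`, so that it is admissible
in the duality of `c` and `η`. Its transform splits along `E ⊕ F`, with the Jacobian `α⁻¹`. -/
theorem IsFourierPair.integral_mul_regularizedIntensity (hcη : IsFourierPair c η)
    (hv : (volume : Measure V) = α • (volume.prod volume : Measure (E × F)).map (complSumEquiv h))
    (hW : MeasurableSet W) (hWb : Bornology.IsBounded W) {f : E → ℂ} (hfc : Continuous f)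
    (hf : HasRapidDecay f) (hff : HasRapidDecay (𝓕 f)) {s : ℝ} (hs : 1 ≤ s) :
    ∫ y, f (E.orthogonalProjectionOnto y) *
        regularizedIntensity W s (F.orthogonalProjectionOnto y) ∂η =
      (α⁻¹).toReal * ∫ x, 𝓕 f (E.projectionOnto F h x) *
        𝓕 (regularizedIntensity W s) (F.projectionOnto E h.symm x) ∂c := by
  have hs0 : 0 < s := by linarith
  have hF := fourier_orthogonalProjectionOnto_mul (map_orthPairEquiv hv) f
    (regularizedIntensity W s)
  have hcont : Continuous fun y : V => f (E.orthogonalProjectionOnto y) *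
      regularizedIntensity W s (F.orthogonalProjectionOnto y) :=
    (hfc.comp (map_continuous _)).mul
      ((continuous_regularizedIntensity hW hWb s).comp (map_continuous _))
  obtain ⟨K, -, hK⟩ := exists_norm_fourier_regularizedIntensity_le hW hWb
  have hqq : HasRapidDecay (𝓕 (regularizedIntensity W s)) :=
    (hasRapidDecay_gauss (by norm_num : (0 : ℝ) < 4⁻¹)).mono (hK s hs)
  rw [← hcη _ hcont (hasPolyDecay_mul_regularizedIntensity h W hf hs0), ← integral_const_mul]
  · exact integral_congr_ae (Eventually.of_forall hF)
  · obtain ⟨K', hK'⟩ := hasPolyDecay_mul_projectionOnto h hff hqq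
    refine ⟨(α⁻¹).toReal * K', fun x => ?_⟩
    rw [hF, norm_mul, Complex.norm_real, Real.norm_of_nonneg ENNReal.toReal_nonneg, mul_assoc]
    gcongr
    exact hK' x

/-- On the side of `c` the regularizations of `ψ` converge pointwise and are dominated by a single
Gaussian in `x_F`, because `ψ` is bounded with bounded support. -/
theorem IsFourierPair.tendsto_integral_mul_regularizedIntensity (hc : IsTranslationBounded c)
    (hcη : IsFourierPair c η)
    (hv : (volume : Measure V) = α • (volume.prod volume : Measure (E × F)).map (complSumEquiv h))
    (hW : MeasurableSet W) (hWb : Bornology.IsBounded W) {f : E → ℂ} (hfc : Continuous f)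
    (hf : HasRapidDecay f) (hff : HasRapidDecay (𝓕 f)) (hffc : Continuous (𝓕 f)) :
    Tendsto (fun n : ℕ => ∫ y, f (E.orthogonalProjectionOnto y) *
        regularizedIntensity W (n + 1) (F.orthogonalProjectionOnto y) ∂η) atTop
      (𝓝 ((α⁻¹).toReal * ∫ x, 𝓕 f (E.projectionOnto F h x) *
        (windowAutocorr W (F.projectionOnto E h.symm x) : ℂ) ∂c)) := by
  have hs : ∀ n : ℕ, (1 : ℝ) ≤ n + 1 := fun n => by linarith [n.cast_nonneg (α := ℝ)]
  simp_rw [fun n : ℕ => hcη.integral_mul_regularizedIntensity hv hW hWb hfc hf hff (hs n)]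
  refine Tendsto.const_mul _ ?_
  obtain ⟨K, -, hK⟩ := exists_norm_fourier_regularizedIntensity_le hW hWb
  have hE := continuous_projectionOnto h
  have hF := continuous_projectionOnto h.symm
  have hlim : Tendsto (fun n : ℕ => (n : ℝ) + 1) atTop atTop :=
    tendsto_atTop_add_const_right _ _ tendsto_natCast_atTop_atTop
  have hbi : Integrable (fun x => 𝓕 f (E.projectionOnto F h x) *
      gauss 4⁻¹ (F.projectionOnto E h.symm x)) c :=
    hc.integrable ((hffc.comp hE).mul ((continuous_gauss _).comp hF)).aestronglyMeasurable
      (hasPolyDecay_mul_projectionOnto h hff (hasRapidDecay_gauss (by norm_num)))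
  refine tendsto_integral_of_dominated_convergence _ (fun n => ?_) (hbi.norm.const_mul K)
    (fun n => Eventually.of_forall fun x => ?_) (Eventually.of_forall fun x => ?_)
  · have hi : Integrable (regularizedIntensity W (n + 1)) :=
      isTranslationBounded_volume.integrable
        (continuous_regularizedIntensity hW hWb _).aestronglyMeasurable
        (hasRapidDecay_regularizedIntensity W (by linarith [hs n])).hasPolyDecay
    exact ((hffc.comp hE).mul ((VectorFourier.fourierIntegral_continuous Real.continuous_fourierChar
      continuous_inner_pair hi).comp hF)).aestronglyMeasurable
  · rw [norm_mul, norm_mul]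
    calc _ ≤ ‖𝓕 f (E.projectionOnto F h x)‖ *
          (K * ‖gauss 4⁻¹ (F.projectionOnto E h.symm x)‖) := by
          gcongr
          exact hK _ (hs n) _
      _ = _ := by ring
  · exact ((tendsto_fourier_regularizedIntensity hW hWb _).comp hlim).const_mul _

/-- The measure `C ↦ α² ∫ ψ̂(x_F^⊥) 1_C(x_E^⊥) η(dx)`. -/
def cutDiffraction (E : Submodule ℝ V) (W : Set F) (α : ℝ≥0∞) (η : Measure V) : Measure E :=
  α ^ 2 • (η.withDensity fun x =>
    ENNReal.ofReal (windowIntensity W (F.orthogonalProjectionOnto x))).map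
      E.orthogonalProjectionOnto

theorem measurable_ofReal_windowIntensity (hW : MeasurableSet W) (hWb : Bornology.IsBounded W) :
    Measurable fun x : V => ENNReal.ofReal (windowIntensity W (F.orthogonalProjectionOnto x)) :=
  ((continuous_windowIntensity hW hWb).comp (map_continuous _)).measurable.ennreal_ofReal

theorem lintegral_cutDiffraction (hW : MeasurableSet W) (hWb : Bornology.IsBounded W)
    {f : E → ℝ≥0∞} (hf : Measurable f) :
    ∫⁻ e, f e ∂cutDiffraction E W α η = α ^ 2 * ∫⁻ x,
      ENNReal.ofReal (windowIntensity W (F.orthogonalProjectionOnto x)) *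
        f (E.orthogonalProjectionOnto x) ∂η := by
  have hE : Measurable fun x : V => E.orthogonalProjectionOnto x :=
    (map_continuous E.orthogonalProjectionOnto).measurable
  have hfE : Measurable fun x : V => f (E.orthogonalProjectionOnto x) := hf.comp hE
  rw [cutDiffraction, lintegral_smul_measure, lintegral_map hf hE,
    lintegral_withDensity_eq_lintegral_mul _ (measurable_ofReal_windowIntensity hW hWb) hfE,
    smul_eq_mul]
  rfl

/-- A unit ball is tested with a Gaussian centred at `u`. Its regularized integrals against `η`
equal integrals against `c` that are bounded uniformly in `u` and in the regularization, and Fatou's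
lemma, available since `ψ̂ ≥ 0`, removes the regularization. -/
theorem IsFourierPair.isTranslationBounded_cutDiffraction (hc : IsTranslationBounded c)
    (hη : IsTranslationBounded η) (hcη : IsFourierPair c η)
    (hv : (volume : Measure V) = α • (volume.prod volume : Measure (E × F)).map (complSumEquiv h))
    (hα : α ≠ ∞) (hW : MeasurableSet W) (hWb : Bornology.IsBounded W) :
    IsTranslationBounded (cutDiffraction E W α η) := by
  obtain ⟨K, hK0, hK⟩ := exists_norm_fourier_regularizedIntensity_le hW hWb
  have hE := continuous_projectionOnto h
  have hF := continuous_projectionOnto h.symm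
  have hs : ∀ n : ℕ, (1 : ℝ) ≤ n + 1 := fun n => by linarith [n.cast_nonneg (α := ℝ)]
  have hbi : Integrable (fun x => gauss 1 (E.projectionOnto F h x) *
      gauss 4⁻¹ (F.projectionOnto E h.symm x)) c :=
    hc.integrable (((continuous_gauss _).comp hE).mul
      ((continuous_gauss _).comp hF)).aestronglyMeasurable
      (hasPolyDecay_mul_projectionOnto h (hasRapidDecay_gauss one_pos)
        (hasRapidDecay_gauss (by norm_num)))
  set M := (α⁻¹).toReal * ∫ x, K * ‖gauss 1 (E.projectionOnto F h x) *
      gauss 4⁻¹ (F.projectionOnto E h.symm x)‖ ∂c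
  refine ⟨ENNReal.ofReal (Real.exp Real.pi) * (α ^ 2 * ENNReal.ofReal M),
    ENNReal.mul_ne_top ENNReal.ofReal_ne_top
      (ENNReal.mul_ne_top (ENNReal.pow_ne_top hα) ENNReal.ofReal_ne_top), fun u => ?_⟩
  let G : E → ℝ := fun v => ‖gauss 1 (v - u)‖
  have hGm : Measurable fun v => ENNReal.ofReal (G v) :=
    (continuous_gauss_sub u).norm.measurable.ennreal_ofReal
  have hGc : ∀ v, (G v : ℂ) = gauss 1 (v - u) := fun v => by
    simp only [G]
    rw [norm_gauss, gauss]
  calc cutDiffraction E W α η (closedBall u 1)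
      ≤ ∫⁻ v, ENNReal.ofReal (Real.exp Real.pi) * ENNReal.ofReal (G v) ∂cutDiffraction E W α η := by
        rw [← lintegral_indicator_one measurableSet_closedBall]
        refine lintegral_mono fun v => ?_
        by_cases hvu : v ∈ closedBall u 1
        · rw [indicator_of_mem hvu, Pi.one_apply, ← ENNReal.ofReal_mul (Real.exp_pos _).le,
            ENNReal.one_le_ofReal]
          simp only [G]
          rw [norm_gauss, ← Real.exp_add, Real.one_le_exp_iff]
          rw [mem_closedBall, dist_eq_norm] at hvu
          have : ‖v - u‖ ^ 2 ≤ 1 := pow_le_one₀ (norm_nonneg _) hvu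
          nlinarith [Real.pi_pos]
        · rw [indicator_of_notMem hvu]
          exact zero_le
    _ = ENNReal.ofReal (Real.exp Real.pi) * (α ^ 2 * ∫⁻ x,
          ENNReal.ofReal (windowIntensity W (F.orthogonalProjectionOnto x)) *
            ENNReal.ofReal (G (E.orthogonalProjectionOnto x)) ∂η) := by
        rw [lintegral_const_mul _ hGm, lintegral_cutDiffraction hW hWb hGm]
    _ ≤ _ := ?_
  gcongr
  let r : ℕ → V → ℝ := fun n y => G (E.orthogonalProjectionOnto y) *
    (regularizedIntensity W (n + 1) (F.orthogonalProjectionOnto y)).re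
  have hq : ∀ (n : ℕ) (v : F), ((regularizedIntensity W (n + 1) v).re : ℂ) =
      regularizedIntensity W (n + 1) v := by
    intro n v
    rw [regularizedIntensity, ← ofReal_windowIntensity hW hWb, gauss, ← Complex.ofReal_mul,
      Complex.ofReal_re]
  have hq0 : ∀ (n : ℕ) (v : F), 0 ≤ (regularizedIntensity W (n + 1) v).re := by
    intro n v
    rw [regularizedIntensity, ← ofReal_windowIntensity hW hWb, gauss, ← Complex.ofReal_mul,
      Complex.ofReal_re]
    exact mul_nonneg (Real.exp_pos _).le (windowIntensity_nonneg hW hWb v)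
  have hr0 : ∀ n y, 0 ≤ r n y := fun n y => mul_nonneg (norm_nonneg _) (hq0 n _)
  have hrc : ∀ n y, (r n y : ℂ) = gauss 1 (E.orthogonalProjectionOnto y - u) *
      regularizedIntensity W (n + 1) (F.orthogonalProjectionOnto y) := by
    intro n y
    simp only [r]
    rw [Complex.ofReal_mul, hq, hGc]
  have hcont : ∀ n, Continuous (r n) := fun n =>
    ((continuous_gauss_sub u).norm.comp (map_continuous _)).mul (Complex.continuous_re.comp
      ((continuous_regularizedIntensity hW hWb _).comp (map_continuous _)))
  have hri : ∀ n, Integrable (r n) η := fun n => by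
    refine hη.integrable (hcont n).aestronglyMeasurable ?_
    obtain ⟨K', hK'⟩ := hasPolyDecay_mul_regularizedIntensity h W
      ((hasRapidDecay_gauss (E := E) one_pos).comp_sub u) (by linarith [hs n] : (0 : ℝ) < n + 1)
    refine ⟨K', fun y => ?_⟩
    rw [← Complex.norm_real, hrc]
    exact hK' y
  have hint : ∀ n, ∫ y, r n y ∂η ≤ M := by
    intro n
    have h1 := hcη.integral_mul_regularizedIntensity hv hW hWb (continuous_gauss_sub u)
      ((hasRapidDecay_gauss (E := E) one_pos).comp_sub u) (hasRapidDecay_fourier_gauss_sub u) (hs n)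
    simp_rw [← hrc, integral_complex_ofReal] at h1
    refine (le_abs_self _).trans ?_
    rw [← Real.norm_eq_abs, ← Complex.norm_real, h1, norm_mul, Complex.norm_real,
      Real.norm_of_nonneg ENNReal.toReal_nonneg]
    refine mul_le_mul_of_nonneg_left ?_ ENNReal.toReal_nonneg
    refine norm_integral_le_of_norm_le (hbi.norm.const_mul K) (Eventually.of_forall fun x => ?_)
    rw [norm_mul, norm_mul, norm_fourier_gauss_sub, norm_gauss 1, mul_one]
    calc _ ≤ Real.exp (-Real.pi * ‖E.projectionOnto F h x‖ ^ 2) *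
          (K * ‖gauss 4⁻¹ (F.projectionOnto E h.symm x)‖) := by
          gcongr
          exact hK _ (hs n) _
      _ = _ := by ring
  have hlim : Tendsto (fun n : ℕ => (n : ℝ) + 1) atTop atTop :=
    tendsto_atTop_add_const_right _ _ tendsto_natCast_atTop_atTop
  have hptw : ∀ y : V, liminf (fun n => ENNReal.ofReal (r n y)) atTop =
      ENNReal.ofReal (windowIntensity W (F.orthogonalProjectionOnto y)) *
        ENNReal.ofReal (G (E.orthogonalProjectionOnto y)) := by
    intro y
    refine Tendsto.liminf_eq ?_
    rw [← ENNReal.ofReal_mul (windowIntensity_nonneg hW hWb _), mul_comm]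
    refine ENNReal.tendsto_ofReal (Tendsto.const_mul _ ?_)
    exact (Complex.continuous_re.tendsto
      (windowIntensity W (F.orthogonalProjectionOnto y) : ℂ)).comp
      ((tendsto_regularizedIntensity hW hWb _).comp hlim)
  simp_rw [← hptw]
  refine (lintegral_liminf_le fun n => (hcont n).measurable.ennreal_ofReal).trans ?_
  refine liminf_le_of_frequently_le' (Frequently.of_forall fun n => ?_)
  rw [← ofReal_integral_eq_lintegral_ofReal (hri n) (Eventually.of_forall (hr0 n))]
  exact ENNReal.ofReal_le_ofReal (hint n)

theorem integral_cutAutocorrelation (hW : MeasurableSet W) {f : E → ℂ} (hf : Continuous f) :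
    ∫ e, f e ∂cutAutocorrelation h W α c = α.toReal * ∫ x, f (E.projectionOnto F h x) *
      (windowAutocorr W (F.projectionOnto E h.symm x) : ℂ) ∂c := by
  rw [cutAutocorrelation, integral_smul_measure, integral_map
    (continuous_projectionOnto h).aemeasurable hf.aestronglyMeasurable,
    integral_withDensity_eq_integral_toReal_smul
      (measurable_ofReal_windowAutocorr_projectionOnto (h := h) hW)
      (Eventually.of_forall fun _ => ENNReal.ofReal_lt_top), Complex.real_smul]
  congr 1
  refine integral_congr_ae (Eventually.of_forall fun x => ?_)
  simp only
  rw [ENNReal.toReal_ofReal (windowAutocorr_nonneg hW _), Complex.real_smul, mul_comm]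

theorem integral_cutDiffraction (hW : MeasurableSet W) (hWb : Bornology.IsBounded W) {f : E → ℂ}
    (hf : Continuous f) :
    ∫ e, f e ∂cutDiffraction E W α η = α.toReal ^ 2 * ∫ x, f (E.orthogonalProjectionOnto x) *
      (windowIntensity W (F.orthogonalProjectionOnto x) : ℂ) ∂η := by
  rw [cutDiffraction, integral_smul_measure, integral_map
    (map_continuous E.orthogonalProjectionOnto).aemeasurable hf.aestronglyMeasurable,
    integral_withDensity_eq_integral_toReal_smul (measurable_ofReal_windowIntensity hW hWb)
      (Eventually.of_forall fun _ => ENNReal.ofReal_lt_top), Complex.real_smul, ENNReal.toReal_pow,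
    Complex.ofReal_pow]
  congr 1
  refine integral_congr_ae (Eventually.of_forall fun x => ?_)
  simp only
  rw [ENNReal.toReal_ofReal (windowIntensity_nonneg hW hWb _), Complex.real_smul, mul_comm]

theorem integrable_of_integrable_cutDiffraction (hW : MeasurableSet W)
    (hWb : Bornology.IsBounded W) (hα0 : α ≠ 0) (hα : α ≠ ∞) {f : E → ℂ} (hf : Continuous f)
    (hfi : Integrable f (cutDiffraction E W α η)) :
    Integrable (fun x => f (E.orthogonalProjectionOnto x) *
      (windowIntensity W (F.orthogonalProjectionOnto x) : ℂ)) η := by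
  rw [cutDiffraction, integrable_smul_measure (pow_ne_zero 2 hα0) (ENNReal.pow_ne_top hα),
    integrable_map_measure hf.aestronglyMeasurable
      (map_continuous E.orthogonalProjectionOnto).aemeasurable,
    integrable_withDensity_iff_integrable_smul' (measurable_ofReal_windowIntensity hW hWb)
      (Eventually.of_forall fun _ => ENNReal.ofReal_lt_top)] at hfi
  refine hfi.congr (Eventually.of_forall fun x => ?_)
  simp only [Function.comp_apply]
  rw [ENNReal.toReal_ofReal (windowIntensity_nonneg hW hWb _), Complex.real_smul, mul_comm]

/-- Both sides are limits of the same regularized integrals. Translation boundedness of the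
diffraction measure makes `f(x_E^⊥) ψ̂(x_F^⊥)` integrable for `η`, and this dominates the
regularizations there. The constants agree as `α² α⁻¹ = α`. -/
theorem IsFourierPair.isFourierTransform_cutDiffraction (hc : IsTranslationBounded c)
    (hη : IsTranslationBounded η) (hcη : IsFourierPair c η)
    (hv : (volume : Measure V) = α • (volume.prod volume : Measure (E × F)).map (complSumEquiv h))
    (hα0 : α ≠ 0) (hα : α ≠ ∞) (hW : MeasurableSet W) (hWb : Bornology.IsBounded W) :
    IsFourierTransform (cutAutocorrelation h W α c) (cutDiffraction E W α η) := by
  have hb := hcη.isTranslationBounded_cutDiffraction hc hη hv hα hW hWb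
  refine ⟨(isTranslationBounded_cutAutocorrelation hW hWb hc hα).hasTemperateGrowth,
    hb.hasTemperateGrowth, fun f => ?_⟩
  have hff : (𝓕 (f : E → ℂ)) = (𝓕 f : 𝓢(E, ℂ)) := (SchwartzMap.fourier_coe f).symm
  have hffr : HasRapidDecay (𝓕 (f : E → ℂ)) := by rw [hff]; exact (𝓕 f).hasRapidDecay
  have hffc : Continuous (𝓕 (f : E → ℂ)) := by rw [hff]; exact (𝓕 f).continuous
  rw [integral_cutAutocorrelation hW hffc, integral_cutDiffraction hW hWb f.continuous]
  have h1 := hcη.tendsto_integral_mul_regularizedIntensity hc hv hW hWb f.continuous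
    f.hasRapidDecay hffr hffc
  have hfi := integrable_of_integrable_cutDiffraction hW hWb hα0 hα f.continuous
    (hb.integrable f.continuous.aestronglyMeasurable f.hasPolyDecay)
  have hlim : Tendsto (fun n : ℕ => (n : ℝ) + 1) atTop atTop :=
    tendsto_atTop_add_const_right _ _ tendsto_natCast_atTop_atTop
  have h2 : Tendsto (fun n : ℕ => ∫ y, f (E.orthogonalProjectionOnto y) *
      regularizedIntensity W (n + 1) (F.orthogonalProjectionOnto y) ∂η) atTop
      (𝓝 (∫ x, f (E.orthogonalProjectionOnto x) *
        (windowIntensity W (F.orthogonalProjectionOnto x) : ℂ) ∂η)) := by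
    refine tendsto_integral_of_dominated_convergence _ (fun n => ?_) hfi.norm
      (fun n => Eventually.of_forall fun y => ?_) (Eventually.of_forall fun y => ?_)
    · exact ((f.continuous.comp (map_continuous _)).mul
        ((continuous_regularizedIntensity hW hWb _).comp (map_continuous _))).aestronglyMeasurable
    · rw [norm_mul, norm_mul, Complex.norm_real,
        Real.norm_of_nonneg (windowIntensity_nonneg hW hWb _)]
      gcongr
      exact norm_regularizedIntensity_le hW hWb (by positivity) _
    · exact ((tendsto_regularizedIntensity hW hWb _).comp hlim).const_mul _
  rw [tendsto_nhds_unique h2 h1, ← mul_assoc]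
  congr 1
  have hαr : (α.toReal : ℂ) ≠ 0 := by exact_mod_cast (ENNReal.toReal_ne_zero.2 ⟨hα0, hα⟩)
  rw [ENNReal.toReal_inv, Complex.ofReal_inv]
  field_simp

theorem IsFourierPair.isFourierTransform (hc : IsTranslationBounded c)
    (hη : IsTranslationBounded η) (hcη : IsFourierPair c η) : IsFourierTransform c η := by
  refine ⟨hc.hasTemperateGrowth, hη.hasTemperateGrowth, fun f =>
    hcη f f.continuous f.hasPolyDecay ?_⟩
  rw [← SchwartzMap.fourier_coe f]
  exact (𝓕 f).hasPolyDecay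

end Diffraction

end

/-! ### The main theorem. -/

theorem theorem4 (d : ℕ) (E F : Submodule ℝ (EuclideanSpace ℝ (Fin d))) (hEF : IsCompl E F)
    (W : Set F) (hWm : MeasurableSet W) (hWb : Bornology.IsBounded W)
    {Ω : Type*} [MeasurableSpace Ω] (P : Measure Ω) [IsProbabilityMeasure P]
    (φ : Ω → Config (EuclideanSpace ℝ (Fin d))) (hφ : Measurable φ)
    (hstat : IsStationaryLaw (P.map φ))
    (hsq : IsSquareIntegrable (P.map φ))
    (herg : IsErgodicUnder (P.map φ) E)
    (hinj : ∀ᵐ ω ∂P, InjOn (E.projectionOnto F hEF) ((φ ω).carrier ∩ strip hEF W))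
    (B : Set (EuclideanSpace ℝ (Fin d))) (hB : MeasurableSet B)
    (hB0 : volume B ≠ 0) (hBtop : volume B ≠ ∞)
    (CE : Set E) (hCE : MeasurableSet CE) (hCE1 : volume CE = 1)
    (CF : Set F) (hCF : MeasurableSet CF) (hCF1 : volume CF = 1)
    (α : ℝ≥0∞)
    (hα : α = volume ((Subtype.val '' CE + Subtype.val '' CF : Set (EuclideanSpace ℝ (Fin d)))))
    (Q : Measure (Config (EuclideanSpace ℝ (Fin d)))) (hQ : Q = Config.palm (P.map φ) B hB) :
    ∃ (η : Measure (EuclideanSpace ℝ (Fin d))) (γ γhat : Measure E),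
      IsFourierTransform (Config.intensity Q) η ∧
      (∀ C : Set E, MeasurableSet C →
        γ C = α * ∫⁻ x, ENNReal.ofReal (windowAutocorr W (F.projectionOnto E hEF.symm x)) *
          C.indicator (fun _ => 1) (E.projectionOnto F hEF x) ∂(Config.intensity Q)) ∧
      (∀ C : Set E, MeasurableSet C →
        γhat C = α ^ 2 * ∫⁻ x, ENNReal.ofReal (windowIntensity W (F.orthogonalProjectionOnto x)) *
          C.indicator (fun _ => 1) (E.orthogonalProjectionOnto x) ∂η) ∧
      ∀ᵐ ω ∂P, HasAutocorrelation (cutProject hEF W hWb (φ ω)) γ ∧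
        HasDiffraction (cutProject hEF W hWb (φ ω)) γhat := by
  obtain ⟨hα0, hαt, hv⟩ := exists_volume_eq_smul_map hEF hCE1 hCF1 hα
  have hm : IsProbabilityMeasure (P.map φ) := Measure.isProbabilityMeasure_map hφ.aemeasurable
  subst hQ
  have hc := Config.isTranslationBounded_intensity hstat hsq hB hB0 hBtop
  obtain ⟨η, hη, hcη⟩ := exists_fourier_of_isGaussPosDef hc
    (Config.isGaussPosDef_intensity hstat hsq hB hB0 hBtop)
  have hpair : IsFourierPair (Config.intensity (Config.palm (P.map φ) B hB)) η := hcη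
  refine ⟨η, cutAutocorrelation hEF W α (Config.intensity (Config.palm (P.map φ) B hB)),
    cutDiffraction E W α η, hpair.isFourierTransform hc hη, fun C hC => ?_, fun C hC => ?_, ?_⟩
  · rw [← lintegral_indicator_one hC]
    exact lintegral_cutAutocorrelation hWm (measurable_one.indicator hC)
  · rw [← lintegral_indicator_one hC]
    exact lintegral_cutDiffraction hWm hWb (measurable_one.indicator hC)
  · filter_upwards [ae_hasAutocorrelation_cutProject hφ hstat hsq herg hB hB0 hBtop hαt hv hWm hWb
      hinj] with ω hω
    exact ⟨hω, _, hω, hpair.isFourierTransform_cutDiffraction hc hη hv hα0 hαt hWm hWb⟩
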